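/- Let $\mathbb K\in\{\mathbb R,\mathbb C\}$, let $(A_\lambda:X_\lambda\to Y_\lambda)_{\lambda\in\Lambda}$ be bounded linear operators between Banach spaces over $\mathbb K$ with $\sup_\lambda\|A_\lambda\|<\infty$, and write $\ell_0$ for $c_0$. Let $p,r\in\{0\}\cup[1,\infty]$ be such that either $r=0$ and $p<\infty$, or $1\le p\le r\le\infty$, $1<r$ and $p<\infty$, and let $$D=D^{p,r}_\Lambda:\Bigl(\bigoplus_{\lambda\in\Lambda} X_\lambda\Bigr)_{\ell_p(\Lambda)}\to\Bigl(\bigoplus_{\lambda\in\Lambda} Y_\lambda\Bigr)_{\ell_r(\Lambda)},\qquad D(x_\lambda)_\lambda=(A_\lambda x_\lambda)_\lambda .$$ **Szlenk index.** For a weak$^*$-compact $K\subset X^*$ and $\varepsilon>0$ let $s_\varepsilon(K)$ be the set of $x^*\in K$ such that $\operatorname{diam}(V\cap K)>\varepsilon$ for every weak$^*$-neighbourhood $V$ of $x^*$; let $s^0_\varepsilon(K)=K$, $s^{\alpha+1}_\varepsilon(K)=s_\varepsilon(s^\alpha_\varepsilon(K))$, and $s^\alpha_\varepsilon(K)=\bigcap_{\beta<\alpha}s^\beta_\varepsilon(K)$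 for limit $\alpha$. $Sz(K,\varepsilon)$ is the least ordinal $\alpha$ with $s^\alpha_\varepsilon(K)=\varnothing$ ($\infty$ if there is none), and $Sz(K)=\sup_{\varepsilon>0}Sz(K,\varepsilon)$. For an operator $A:X\to Y$, $Sz(A,\varepsilon)=Sz(A^*B_{Y^*},\varepsilon)$ and $Sz(A)=Sz(A^*B_{Y^*})$. **Trees and coefficients.** For ordinals $\xi$ and integers $n\ge1$, the sets $\Gamma_{\xi,n}$ of non-empty finite sequences of ordinals, ordered by extension, and the functions $\mathbb P_{\xi,n}:\Gamma_{\xi,n}\to[0,1]$ are defined as follows, where $\beta+(\zeta_j)_j=(\beta+\zeta_j)_j$. $\Gamma_{0,1}=\{(0)\}$ and $\mathbb P_{0,1}((0))=1$. $\Gamma_{\xi,n}$ is the set of all $s=(\omega^\xi(n-1)+t_1)\smallfrown\cdots\smallfrown(\omega^\xi(n-i)+t_i)$ with $1\le i\le n$, $t_1,\dots,t_i\in\Gamma_{\xi,1}$ and $t_1,\dots,t_{i-1}$ maximal in $\Gamma_{\xi,1}$, and $\mathbb P_{\xi,n}(s)=\mathbb P_{\xi,1}(t_i)$. $\Gamma_{\xi+1,1}=\bigcup_{n\ge1}\Gamma_{\xi,n}$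 (a disjoint union) and $\mathbb P_{\xi+1,1}=\frac1n\mathbb P_{\xi,n}$ on $\Gamma_{\xi,n}$. For limit $\xi$, $\Gamma_{\xi,1}=\bigcup_{\zeta<\xi}(\omega^\zeta+\Gamma_{\zeta+1,1})$ and $\mathbb P_{\xi,1}(\omega^\zeta+t)=\mathbb P_{\zeta+1,1}(t)$. For a directed set $D_0$, $\Gamma_{\xi,n}.D_0$ is the set of all $(\zeta_j,u_j)_{j=1}^k$ with $(\zeta_j)_{j=1}^k\in\Gamma_{\xi,n}$ and $u_j\in D_0$, with $\mathbb P_{\xi,n}$ evaluated at $(\zeta_j)_j$. A family $(x_t)_{t\in\Gamma_{\xi,n}.D_0}\subset X$ is weakly null if for every $t\in\{\varnothing\}\cup\Gamma_{\xi,n}.D_0$ and every ordinal $\zeta$ such that $t\smallfrown(\zeta,u)\in\Gamma_{\xi,n}.D_0$ for all $u\in D_0$, the net $(x_{t\smallfrown(\zeta,u)})_{u\in D_0}$ is weakly null. **The quantities $\theta_{\xi,n}$.** For a non-empty weak$^*$-compact $K\subset X^*$, $\theta_{\xi,n}(K)$ is the infimum of all $\theta>0$ such that for every directed set $D_0$ and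 every weakly null $(x_t)_{t\in\Gamma_{\xi,n}.D_0}\subset B_X$, $$\inf_{t\in MAX(\Gamma_{\xi,n}.D_0)}\ \max_{x^*\in K}\operatorname{Re}x^*\Bigl(\frac1n\sum_{\varnothing<s\le t}\mathbb P_{\xi,n}(s)x_s\Bigr)\le\theta ,$$ and $\theta_{\xi,n}(A)=\theta_{\xi,n}(A^*B_{Y^*})$. **Theorem.** Suppose that $\sup_{\lambda\in\Lambda}Sz(A_\lambda)=\omega^\xi>1$ for an ordinal $\xi$. Then the following are equivalent: 1. $Sz(D)=\omega^\xi$; 2. for every $\varepsilon>0$, $\sup_{\lambda\in\Lambda}Sz(A_\lambda,\varepsilon)<\omega^\xi$; 3. $\inf\{\sup_{\lambda\in\Lambda}\theta_{\zeta,m}(A_\lambda):\zeta<\xi,\ m\in\mathbb N,\ m\ge 1\}=0$. Moreover, if these conditions fail, then $Sz(D)=\omega^{\xi+1}$. -/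

import Mathlib

open Filter Topology
open scoped ENNReal Ordinal

universe u v

namespace Szlenk

noncomputable section

/-! ### Szlenk index -/

section Index

variable {𝕜 : Type*} [RCLike 𝕜] {X : Type u} [NormedAddCommGroup X] [NormedSpace 𝕜 X]

/-- The Szlenk derivation `s_ε(K)`: all `x* ∈ K` such that for every weak* neighbourhood `V` of
`x*`, the norm diameter of `V ∩ K` exceeds `ε` (only used with `ε > 0`). -/
def deriv (ε : ℝ) (K : Set (WeakDual 𝕜 X)) : Set (WeakDual 𝕜 X) :=
  {f | f ∈ K ∧ ∀ V ∈ 𝓝 f,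
    ENNReal.ofReal ε < Metric.ediam (WeakDual.toStrongDual '' (V ∩ K))}

/-- The transfinite derivations `s_ε^α(K)`. -/
def iterDeriv (ε : ℝ) (K : Set (WeakDual 𝕜 X)) (α : Ordinal.{u}) : Set (WeakDual 𝕜 X) :=
  Ordinal.limitRecOn α K (fun _ S => deriv ε S) (fun β _ S => ⋂ (γ) (h : γ < β), S γ h)

/-- `Sz(K, ε)`, with `⊤` playing the role of `∞`. -/
def indexEps (K : Set (WeakDual 𝕜 X)) (ε : ℝ) : WithTop Ordinal.{u} :=
  sInf {a | ∃ α : Ordinal.{u}, iterDeriv ε K α = ∅ ∧ a = α}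

/-- `Sz(K) = sup_{ε > 0} Sz(K, ε)`. -/
def index (K : Set (WeakDual 𝕜 X)) : WithTop Ordinal.{u} :=
  ⨆ ε : {ε : ℝ // 0 < ε}, indexEps K ε

variable {Y : Type v} [NormedAddCommGroup Y] [NormedSpace 𝕜 Y]

/-- `A* B_{Y*}`, the image of the closed dual unit ball under the adjoint of `A : X → Y`. -/
def dualBallImage (A : X →L[𝕜] Y) : Set (WeakDual 𝕜 X) :=
  {f | ∃ g : StrongDual 𝕜 Y, ‖g‖ ≤ 1 ∧ f = StrongDual.toWeakDual (g.comp A)}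

/-- `Sz(A, ε) = Sz(A* B_{Y*}, ε)`. -/
def opIndexEps (A : X →L[𝕜] Y) (ε : ℝ) : WithTop Ordinal.{u} := indexEps (dualBallImage A) ε

/-- `Sz(A) = Sz(A* B_{Y*})`. -/
def opIndex (A : X →L[𝕜] Y) : WithTop Ordinal.{u} := index (dualBallImage A)

end Index

/-! ### The trees `Γ_{ξ,n}`, `Γ_{ξ,n}.D` and the coefficients `ℙ_{ξ,n}` -/

/-- `β + (ζ_i)_i = (β + ζ_i)_i`. -/
def shift (β : Ordinal.{u}) (t : List Ordinal.{u}) : List Ordinal.{u} := t.map (β + ·)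

/-- The maximal members of a set of finite sequences, ordered by extension. -/
def maxNodes {α : Type*} (G : Set (List α)) : Set (List α) :=
  {t | t ∈ G ∧ ∀ s ∈ G, t <+: s → s = t}

/-- If `G = Γ_{ξ,1}`, this is `Γ_{ξ,n}`, i.e. the set of all
`(ω^ξ(n-1)+t_1)⌢…⌢(ω^ξ(n-i)+t_i)` with `1 ≤ i ≤ n`, `t_1, …, t_i ∈ G` and
`t_1, …, t_{i-1}` maximal in `G` (built by splitting off the first block). -/
def stack (ξ : Ordinal.{u}) (G : Set (List Ordinal.{u})) : ℕ → Set (List Ordinal.{u})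
  | 0 => ∅
  | n + 1 => {l | ∃ t ∈ G, l = shift (ω ^ ξ * n) t} ∪
      {l | ∃ t ∈ maxNodes G, ∃ s ∈ stack ξ G n, l = shift (ω ^ ξ * n) t ++ s}

/-- `Γ_{ξ,1}`: `Γ_{0,1} = {(0)}`, `Γ_{ξ+1,1} = ⋃_{n ≥ 1} Γ_{ξ,n}`, and
`Γ_{ξ,1} = ⋃_{ζ<ξ} (ω^ζ + Γ_{ζ+1,1})` for limit `ξ`. -/
def treeOne (ξ : Ordinal.{u}) : Set (List Ordinal.{u}) :=
  Ordinal.limitRecOn ξ {[0]} (fun ζ G => {l | ∃ n : ℕ, 1 ≤ n ∧ l ∈ stack ζ G n})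
    (fun ξ hξ G => {l | ∃ (ζ : Ordinal.{u}) (h : ζ < ξ),
      ∃ t ∈ G (Order.succ ζ) (hξ.succ_lt h), l = shift (ω ^ ζ) t})

/-- `Γ_{ξ,n}`. -/
def tree (ξ : Ordinal.{u}) (n : ℕ) : Set (List Ordinal.{u}) := stack ξ (treeOne ξ) n

/-- For `s = (ω^ξ(n-1)+t_1)⌢…⌢(ω^ξ(n-i)+t_i) ∈ Γ_{ξ,n}`, this is `t_i`: the entries of the last
block are those with the same quotient by `ω^ξ` as the last entry of `s`. -/
def lastBlock (ξ : Ordinal.{u}) (s : List Ordinal.{u}) : List Ordinal.{u} :=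
  (s.filter (fun a => decide (a / ω ^ ξ = s.getLastD 0 / ω ^ ξ))).map (· % ω ^ ξ)

/-- The coefficients `ℙ_{ξ,1}` on `Γ_{ξ,1}` (irrelevant values elsewhere):
* `ℙ_{0,1}((0)) = 1`;
* `ℙ_{ξ+1,1}(s) = ℙ_{ξ,n}(s) / n` for `s ∈ Γ_{ξ,n}`; here `n` is the least natural number such that
  the first entry of `s` is below `ω^ξ n`;
* `ℙ_{ξ,1}(ω^ζ + t) = ℙ_{ζ+1,1}(t)` for `ξ` limit, `ζ < ξ`, `t ∈ Γ_{ζ+1,1}`; here `ζ` is the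
  base-`ω` logarithm of the first entry of `ω^ζ + t`. -/
def coeffOne (ξ : Ordinal.{u}) : List Ordinal.{u} → ℝ :=
  Ordinal.limitRecOn ξ (fun _ => 1)
    (fun ζ P s => P (lastBlock ζ s) / (sInf {n : ℕ | s.headD 0 < ω ^ ζ * n} : ℕ))
    (fun ξ _ P s =>
      if h : Order.succ (Ordinal.log ω (s.headD 0)) < ξ then
        P (Order.succ (Ordinal.log ω (s.headD 0))) h
          (s.map (· - ω ^ (Ordinal.log ω (s.headD 0))))
      else 0)

/-- The coefficients `ℙ_{ξ,n}` on `Γ_{ξ,n}`: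
`ℙ_{ξ,n}((ω^ξ(n-1)+t_1)⌢…⌢(ω^ξ(n-i)+t_i)) = ℙ_{ξ,1}(t_i)`; this formula does not
involve `n`. -/
def coeff (ξ : Ordinal.{u}) (s : List Ordinal.{u}) : ℝ := coeffOne ξ (lastBlock ξ s)

/-- `Γ_{ξ,n}.D`: sequences `(ζ_j, u_j)_j` with `(ζ_j)_j ∈ Γ_{ξ,n}` and `u_j ∈ D`. -/
def treeD (ξ : Ordinal.{u}) (n : ℕ) (D : Type u) : Set (List (Ordinal.{u} × D)) :=
  {t | t.map Prod.fst ∈ tree ξ n}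

/-! ### The quantities `θ_{ξ,n}` -/

section Theta

variable {𝕜 : Type*} [RCLike 𝕜] {X : Type u} [NormedAddCommGroup X] [NormedSpace 𝕜 X]

/-- `r_K(x) = max_{x* ∈ K} Re x*(x)`, and `0` if `K` is empty. -/
def supportFun (K : Set (WeakDual 𝕜 X)) (x : X) : ℝ := sSup ((fun f => RCLike.re (f x)) '' K)

variable (𝕜) in
/-- `(x_t)_{t ∈ Γ_{ξ,n}.D}` is weakly null: for each `t` (empty or in the tree) and each ordinal
`ζ` for which the sequences `t⌢(ζ,u)`, `u ∈ D`, lie in the tree, the net `(x_{t⌢(ζ,u)})_{u ∈ D}`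
converges weakly to `0`. Only the values of `x` on the tree matter. -/
def WeaklyNull (ξ : Ordinal.{u}) (n : ℕ) (D : Type u) [Preorder D]
    (x : List (Ordinal.{u} × D) → X) : Prop :=
  ∀ (t : List (Ordinal.{u} × D)) (ζ : Ordinal.{u}), (∀ a : D, t ++ [(ζ, a)] ∈ treeD ξ n D) →
    ∀ f : StrongDual 𝕜 X, Tendsto (fun a : D => f (x (t ++ [(ζ, a)]))) atTop (𝓝 0)

/-- For `t` maximal in `Γ_{ξ,n}.D`, the vector `∑_{∅ < s ≤ t} ℙ_{ξ,n}(s) x_s = ∑_{i=1}^n z_i^t`;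
`s` runs over the nonempty initial segments of `t`. -/
def branchSum (𝕜 : Type*) [RCLike 𝕜] {X : Type u} [NormedAddCommGroup X] [NormedSpace 𝕜 X]
    (ξ : Ordinal.{u}) {D : Type u} (x : List (Ordinal.{u} × D) → X)
    (t : List (Ordinal.{u} × D)) : X :=
  ∑ k ∈ Finset.range t.length,
    ((coeff ξ ((t.take (k + 1)).map Prod.fst) : ℝ) : 𝕜) • x (t.take (k + 1))

/-- `θ_{ξ,n}(K)`, for `n ≥ 1`. -/
def theta (ξ : Ordinal.{u}) (n : ℕ) (K : Set (WeakDual 𝕜 X)) : ℝ :=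
  sInf {θ : ℝ | 0 < θ ∧
    ∀ (D : Type u) [Preorder D] [IsDirectedOrder D] [Nonempty D]
      (x : List (Ordinal.{u} × D) → X),
      WeaklyNull 𝕜 ξ n D x → (∀ t ∈ treeD ξ n D, ‖x t‖ ≤ 1) →
      ⨅ t : maxNodes (treeD ξ n D), supportFun K ((1 / (n : 𝕜)) • branchSum 𝕜 ξ x t) ≤ θ}

/-- `θ_{ξ,n}(A) = θ_{ξ,n}(A* B_{Y*})`. -/
def opTheta {Y : Type v} [NormedAddCommGroup Y] [NormedSpace 𝕜 Y]
    (ξ : Ordinal.{u}) (n : ℕ) (A : X →L[𝕜] Y) : ℝ := theta ξ n (dualBallImage A)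

end Theta

/-! ### Direct sums and diagonal operators -/

/-- Exponents in `{0} ∪ [1, ∞]`. -/
abbrev Exponent := {p : ℝ≥0∞ // p = 0 ∨ 1 ≤ p}

/-- The `ℓ_q` whose norm is used for the exponent `p`: `q = p` if `p ≥ 1`, and `q = ∞` if
`p = 0`. -/
def Exponent.norm (p : Exponent) : ℝ≥0∞ := if p.1 = 0 then ∞ else p.1

instance (p : Exponent) : Fact (1 ≤ p.norm) := ⟨by
  unfold Exponent.norm
  split_ifs with h
  · exact le_top
  · exact p.2.resolve_left h⟩

section Sums

variable {ι : Type u} (𝕜 : Type*) [RCLike 𝕜]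

/-- `(⊕_i X_i)_{ℓ_p}` for `p ∈ {0} ∪ [1, ∞]`, where `ℓ_0` means `c_0`: for `p ≥ 1` this is all of
`lp X p`, and for `p = 0` it is the subspace of `lp X ∞` of all families tending to `0` in norm. -/
def directSum (X : ι → Type v) [∀ i, NormedAddCommGroup (X i)] [∀ i, NormedSpace 𝕜 (X i)]
    (p : Exponent) : Submodule 𝕜 (lp X p.norm) where
  carrier := {x | p.1 = 0 → Tendsto (fun i => ‖x i‖) cofinite (𝓝 0)}
  zero_mem' := fun _ => by simpa using tendsto_const_nhds
  add_mem' := by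
    intro a b ha hb h
    have := (ha h).add (hb h)
    rw [add_zero] at this
    exact squeeze_zero (fun _ => norm_nonneg _) (fun i => norm_add_le _ _) this
  smul_mem' := by
    intro c x hx h
    have := (hx h).const_mul ‖c‖
    rw [mul_zero] at this
    exact squeeze_zero (fun _ => norm_nonneg _) (fun i => (norm_smul_le c (x i))) this

variable {𝕜}
variable {X : ι → Type u} [∀ i, NormedAddCommGroup (X i)] [∀ i, NormedSpace 𝕜 (X i)]
  {Y : ι → Type v} [∀ i, NormedAddCommGroup (Y i)] [∀ i, NormedSpace 𝕜 (Y i)]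

/-- Either `r = 0` and `p < ∞`, or `1 ≤ p ≤ r ≤ ∞`, `1 < r` and `p < ∞`. -/
def Admissible (p r : Exponent) : Prop :=
  (r.1 = 0 ∧ p.1 < ∞) ∨ (1 ≤ p.1 ∧ p.1 ≤ r.1 ∧ 1 < r.1 ∧ p.1 < ∞)

variable (A : ∀ i, X i →L[𝕜] Y i) {p r : Exponent}

/-- The values of the diagonal operator lie in the target space. -/
theorem diag_memℓp (hA : ∃ R, ∀ i, ‖A i‖ ≤ R) (h : Admissible p r) (x : directSum 𝕜 X p) :
    Memℓp (fun i => A i (x.1 i)) r.norm := by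
  obtain ⟨R, hR⟩ := hA
  have h1 : Memℓp (fun i => A i (x.1 i)) p.norm := by
    have hx : Memℓp (fun i => R • ‖x.1 i‖) p.norm := (lp.memℓp x.1).norm.const_smul R
    refine hx.mono' fun i => ?_
    have := (A i).le_of_opNorm_le (hR i) (x.1 i)
    rw [norm_smul, norm_norm, Real.norm_eq_abs]
    exact this.trans (mul_le_mul_of_nonneg_right (le_abs_self R) (norm_nonneg _))
  refine h1.of_exponent_ge ?_
  rcases h with ⟨hr, -⟩ | ⟨hp, hpr, -, -⟩
  · simp [Exponent.norm, hr]
  · have h0 : p.1 ≠ 0 := (zero_lt_one.trans_le hp).ne'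
    have h0' : r.1 ≠ 0 := (zero_lt_one.trans_le (hp.trans hpr)).ne'
    simpa [Exponent.norm, h0, h0'] using hpr

theorem tendsto_norm_zero (h : p.1 < ∞) (x : directSum 𝕜 X p) :
    Tendsto (fun i => ‖x.1 i‖) cofinite (𝓝 0) := by
  by_cases hp : p.1 = 0
  · exact x.2 hp
  · have hn : p.norm = p.1 := by simp [Exponent.norm, hp]
    have hpos : 0 < p.norm.toReal := by
      rw [hn]; exact ENNReal.toReal_pos hp h.ne
    have := ((lp.memℓp x.1).summable hpos).tendsto_cofinite_zero
    have h2 := this.rpow_const (p := p.norm.toReal⁻¹) (Or.inr (by positivity))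
    rw [Real.zero_rpow (by positivity)] at h2
    refine h2.congr fun i => ?_
    rw [← Real.rpow_mul (norm_nonneg _), mul_inv_cancel₀ hpos.ne', Real.rpow_one]

/-- `D^{p,r}` as a linear map, `(x_i)_i ↦ (A_i x_i)_i`. -/
def diagLinear (hA : ∃ R, ∀ i, ‖A i‖ ≤ R) (h : Admissible p r) :
    directSum 𝕜 X p →ₗ[𝕜] directSum 𝕜 Y r where
  toFun x := ⟨⟨fun i => A i (x.1 i), diag_memℓp A hA h x⟩, fun hr => by
    obtain ⟨R, hR⟩ := hA
    have hp : p.1 < ∞ := by rcases h with h | h <;> tauto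
    have := (tendsto_norm_zero hp x).const_mul R
    rw [mul_zero] at this
    exact squeeze_zero (fun _ => norm_nonneg _)
      (fun i => (A i).le_of_opNorm_le (hR i) (x.1 i)) this⟩
  map_add' x y := by
    ext i
    exact map_add (A i) _ _
  map_smul' c x := by
    ext i
    exact map_smul (A i) _ _

theorem norm_diagLinear_le (hA : ∃ R, ∀ i, ‖A i‖ ≤ R) (h : Admissible p r) :
    ∃ C, ∀ x, ‖diagLinear A hA h x‖ ≤ C * ‖x‖ := by
  obtain ⟨R, hR⟩ := id hA
  refine ⟨max R 0, fun x => ?_⟩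
  have hR0 : (0 : ℝ) ≤ max R 0 := le_max_right _ _
  have hpt : ∀ i, ‖A i (x.1 i)‖ ≤ max R 0 * ‖x.1 i‖ := fun i =>
    (A i).le_of_opNorm_le ((hR i).trans (le_max_left _ _)) _
  have hp0 : p.norm ≠ 0 := (zero_lt_one.trans_le Fact.out).ne'
  have hr0 : r.norm ≠ 0 := (zero_lt_one.trans_le Fact.out).ne'
  have hx0 : 0 ≤ ‖x.1‖ := norm_nonneg _
  change ‖(diagLinear A hA h x).1‖ ≤ max R 0 * ‖x.1‖
  have hval : ∀ i, (diagLinear A hA h x).1 i = A i (x.1 i) := fun _ => rfl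
  generalize (diagLinear A hA h x).1 = y at hval ⊢
  have hCx : 0 ≤ max R 0 * ‖x.1‖ := mul_nonneg hR0 hx0
  by_cases hrt : r.norm = ∞
  · have hy : ∀ i, ‖y i‖ ≤ max R 0 * ‖x.1‖ := fun i => by
      rw [hval]
      exact (hpt i).trans (mul_le_mul_of_nonneg_left (lp.norm_apply_le_norm hp0 x.1 i) hR0)
    generalize r.norm = q at y hrt hy
    subst hrt
    exact lp.norm_le_of_forall_le hCx hy
  · have hrpos : 0 < r.norm.toReal := ENNReal.toReal_pos hr0 hrt
    have hpr : p.norm ≤ r.norm := by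
      rcases h with ⟨hr, -⟩ | ⟨hp, hpr, -, -⟩
      · exact absurd (by simp [Exponent.norm, hr]) hrt
      · have h0 : p.1 ≠ 0 := (zero_lt_one.trans_le hp).ne'
        have h0' : r.1 ≠ 0 := (zero_lt_one.trans_le (hp.trans hpr)).ne'
        simpa [Exponent.norm, h0, h0'] using hpr
    have hpt' : p.norm ≠ ∞ := ne_top_of_le_ne_top hrt hpr
    have hppos : 0 < p.norm.toReal := ENNReal.toReal_pos hp0 hpt'
    have hle : p.norm.toReal ≤ r.norm.toReal := ENNReal.toReal_mono hrt hpr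
    refine lp.norm_le_of_forall_sum_le hrpos hCx fun s => ?_
    have key : ∀ i, ‖y i‖ ^ r.norm.toReal ≤ max R 0 ^ r.norm.toReal *
        ‖x.1‖ ^ (r.norm.toReal - p.norm.toReal) * ‖x.1 i‖ ^ p.norm.toReal := fun i => by
      rw [hval]
      calc ‖A i (x.1 i)‖ ^ r.norm.toReal
          ≤ (max R 0 * ‖x.1 i‖) ^ r.norm.toReal :=
            Real.rpow_le_rpow (norm_nonneg _) (hpt i) hrpos.le
        _ = max R 0 ^ r.norm.toReal *
            (‖x.1 i‖ ^ (r.norm.toReal - p.norm.toReal) * ‖x.1 i‖ ^ p.norm.toReal) := by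
            rw [Real.mul_rpow hR0 (norm_nonneg _), ← Real.rpow_add_of_nonneg (norm_nonneg _)
              (sub_nonneg.2 hle) hppos.le, sub_add_cancel]
        _ ≤ _ := by
            rw [mul_assoc]
            gcongr
            exact lp.norm_apply_le_norm hp0 x.1 i
    calc ∑ i ∈ s, ‖y i‖ ^ r.norm.toReal
        ≤ ∑ i ∈ s, max R 0 ^ r.norm.toReal *
          ‖x.1‖ ^ (r.norm.toReal - p.norm.toReal) * ‖x.1 i‖ ^ p.norm.toReal :=
          Finset.sum_le_sum fun i _ => key i
      _ = max R 0 ^ r.norm.toReal * ‖x.1‖ ^ (r.norm.toReal - p.norm.toReal) *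
          ∑ i ∈ s, ‖x.1 i‖ ^ p.norm.toReal := by rw [Finset.mul_sum]
      _ ≤ max R 0 ^ r.norm.toReal * ‖x.1‖ ^ (r.norm.toReal - p.norm.toReal) *
          ‖x.1‖ ^ p.norm.toReal := by
          gcongr
          exact lp.sum_rpow_le_norm_rpow hppos x.1 s
      _ = (max R 0 * ‖x.1‖) ^ r.norm.toReal := by
          rw [Real.mul_rpow hR0 hx0, mul_assoc, ← Real.rpow_add_of_nonneg hx0
              (sub_nonneg.2 hle) hppos.le, sub_add_cancel]

/-- The diagonal operator `D^{p,r} : (⊕ X_i)_{ℓ_p} → (⊕ Y_i)_{ℓ_r}`, `(x_i)_i ↦ (A_i x_i)_i`. -/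
def diagOp (hA : ∃ R, ∀ i, ‖A i‖ ≤ R) (h : Admissible p r) :
    directSum 𝕜 X p →L[𝕜] directSum 𝕜 Y r :=
  (diagLinear A hA h).mkContinuousOfExistsBound (norm_diagLinear_le A hA h)

end Sums

/-! ### The formulas for `ℙ_{ξ,n}` satisfy the recursion defining these coefficients -/

section Recursion

open Ordinal

/-- All members of `G` are nonempty sequences with entries below `ω^ξ`. -/
def BoundedBy (ξ : Ordinal.{u}) (G : Set (List Ordinal.{u})) : Prop := ∀ s ∈ G, s ≠ [] ∧ ∀ a ∈ s, a < ω ^ ξ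

theorem omega_opow_pos (ξ : Ordinal.{u}) : (0 : Ordinal.{u}) < ω ^ ξ := opow_pos _ omega0_pos

theorem stack_ok {ξ : Ordinal.{u}} {G} (hG : BoundedBy ξ G) (n : ℕ) : ∀ s ∈ stack ξ G (n+1),
    s ≠ [] ∧ (∀ a ∈ s, a < ω ^ ξ * ((n+1 : ℕ) : Ordinal)) ∧ ω ^ ξ * n ≤ s.headD 0 := by
  induction n with
  | zero =>
    intro s hs
    rcases hs with ⟨t, ht, rfl⟩ | ⟨t, ht, u, hu, rfl⟩
    · obtain ⟨h1, h2⟩ := hG t ht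
      refine ⟨by simpa [shift] using h1, ?_, by simp⟩
      intro a ha
      simp [shift] at ha
      simpa using h2 a ha
    · exact hu.elim
  | succ n ih =>
    have hsh : ∀ t ∈ G, shift (ω ^ ξ * (n+1 : ℕ)) t ≠ [] ∧ (∀ a ∈ shift (ω ^ ξ * (n+1 : ℕ)) t, a < ω ^ ξ * ((n+1+1 : ℕ) : Ordinal)) ∧ ω ^ ξ * (n+1 : ℕ) ≤ (shift (ω ^ ξ * (n+1 : ℕ)) t).headD 0 := by
      intro t ht
      obtain ⟨h1, h2⟩ := hG t ht
      refine ⟨by simpa [shift] using h1, ?_, ?_⟩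
      · intro a ha
        simp only [shift, List.mem_map] at ha
        obtain ⟨b, hb, rfl⟩ := ha
        rw [Nat.cast_succ (n+1), mul_add_one]
        exact (add_lt_add_iff_left _).2 (h2 b hb)
      · cases t with
        | nil => exact absurd rfl h1
        | cons a t => simp [shift]
    intro s hs
    rcases hs with ⟨t, ht, rfl⟩ | ⟨t, ht, u, hu, rfl⟩
    · exact hsh t ht
    · obtain ⟨a, b, c⟩ := hsh t ht.1
      obtain ⟨a', b', c'⟩ := ih u hu
      refine ⟨by simp [a'], ?_, ?_⟩
      · intro z hz
        rcases List.mem_append.1 hz with hz | hz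
        · exact b z hz
        · refine (b' z hz).trans_le ?_
          gcongr; simp
      · revert a c
        cases shift (ω ^ ξ * (n+1 : ℕ)) t with
        | nil => simp
        | cons x t => simp

theorem treeOne_ok (ξ : Ordinal.{u}) : BoundedBy ξ (treeOne ξ) := by
  induction ξ using Ordinal.limitRecOn with
  | zero => unfold treeOne; rw [limitRecOn_zero]; intro s hs; obtain rfl : s = [0] := hs; simp
  | add_one ζ ih =>
    unfold treeOne; rw [limitRecOn_add_one]; intro s hs
    obtain ⟨n, hn, hs⟩ := hs
    obtain ⟨n, rfl⟩ := Nat.exists_eq_add_of_le' hn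
    obtain ⟨a, b, c⟩ := stack_ok ih n s hs
    refine ⟨a, fun z hz => (b z hz).trans ?_⟩
    rw [opow_add, opow_one]
    exact (mul_lt_mul_iff_right₀ (omega_opow_pos ζ)).2 (natCast_lt_omega0 _)
  | limit ξ hξ ih =>
    unfold treeOne; rw [limitRecOn_limit _ _ _ _ hξ]; intro s hs
    obtain ⟨ζ, h, t, ht, rfl⟩ := hs
    obtain ⟨a, b⟩ := ih _ (hξ.succ_lt h) t ht
    refine ⟨by simpa [shift] using a, fun z hz => ?_⟩
    simp only [shift, List.mem_map] at hz
    obtain ⟨y, hy, rfl⟩ := hz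
    have h1 : ω ^ (Order.succ ζ) < ω ^ ξ := (opow_lt_opow_iff_right one_lt_omega0).2 (hξ.succ_lt h)
    exact isPrincipal_add_omega0_opow ξ ((opow_lt_opow_iff_right one_lt_omega0).2 h) ((b y hy).trans h1)

theorem lastBlock_shift {ξ : Ordinal.{u}} {t} (ht : t ∈ treeOne ξ) (c : Ordinal) :
    lastBlock ξ (shift (ω ^ ξ * c) t) = t := by
  obtain ⟨a, b⟩ := treeOne_ok ξ t ht
  have hd : ∀ x ∈ t, (ω ^ ξ * c + x) / ω ^ ξ = c := fun x hx => by
    rw [mul_add_div _ (omega_opow_pos ξ).ne', div_eq_zero_of_lt (b x hx), add_zero]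
  have hl : (shift (ω ^ ξ * c) t).getLastD 0 / ω ^ ξ = c := by
    obtain ⟨l, x, rfl⟩ := List.eq_nil_or_concat t |>.resolve_left a
    simp [shift]
    simpa using hd x (by simp)
  unfold lastBlock
  rw [hl, List.filter_eq_self.2]
  · conv_rhs => rw [← List.map_id t]
    simp only [shift, List.map_map]
    refine List.map_congr_left fun x hx => ?_
    simp [mul_add_mod_self, mod_eq_of_lt (b x hx)]
  · intro y hy
    simp only [shift, List.mem_map] at hy
    obtain ⟨x, hx, rfl⟩ := hy
    simpa using hd x hx

theorem lastBlock_append {ξ : Ordinal.{u}} {n : ℕ} {t s} (ht : t ∈ treeOne ξ) (hs : s ∈ tree ξ n) :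
    lastBlock ξ (shift (ω ^ ξ * n) t ++ s) = lastBlock ξ s := by
  cases n with
  | zero => exact hs.elim
  | succ n =>
  obtain ⟨a, b⟩ := treeOne_ok ξ t ht
  obtain ⟨a', b', -⟩ := stack_ok (treeOne_ok ξ) n s hs
  have hd : ∀ x ∈ t, (ω ^ ξ * (n+1 : ℕ) + x) / ω ^ ξ = (n+1 : ℕ) := fun x hx => by
    rw [mul_add_div _ (omega_opow_pos ξ).ne', div_eq_zero_of_lt (b x hx), add_zero]
  obtain ⟨l, x, rfl⟩ := List.eq_nil_or_concat s |>.resolve_left a'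
  have hx : x / ω ^ ξ < (n+1 : ℕ) := (lt_mul_iff_div_lt (omega_opow_pos ξ).ne').1 (b' x (by simp))
  have e : ∀ l' : List Ordinal.{u}, (l' ++ l.concat x).getLastD 0 = x := fun l' => by
    rw [List.getLastD_eq_getLast?]; simp
  have e' : (l.concat x).getLastD 0 = x := e []
  unfold lastBlock
  rw [e, e', List.filter_append, List.filter_eq_nil_iff.2]
  · simp
  · intro y hy
    simp only [shift, List.mem_map] at hy
    obtain ⟨z, hz, rfl⟩ := hy
    rw [hd z hz]
    simpa using hx.ne'

theorem coeff_shift {ξ : Ordinal.{u}} {t} (ht : t ∈ treeOne ξ) (c : Ordinal) :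
    coeff ξ (shift (ω ^ ξ * c) t) = coeffOne ξ t := by rw [coeff, lastBlock_shift ht]

theorem coeff_append {ξ : Ordinal.{u}} {n : ℕ} {t s} (ht : t ∈ treeOne ξ) (hs : s ∈ tree ξ n) :
    coeff ξ (shift (ω ^ ξ * n) t ++ s) = coeff ξ s := by rw [coeff, coeff, lastBlock_append ht hs]

theorem coeffOne_zero : coeffOne (0 : Ordinal.{u}) [0] = 1 := by
  unfold coeffOne; rw [limitRecOn_zero]

theorem coeffOne_succ {ξ : Ordinal.{u}} {n : ℕ} {s} (hs : s ∈ tree ξ n) :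
    coeffOne (ξ + 1) s = coeff ξ s / n := by
  cases n with
  | zero => exact hs.elim
  | succ n =>
  obtain ⟨a, b, c⟩ := stack_ok (treeOne_ok ξ) n s hs
  have : sInf {k : ℕ | s.headD 0 < ω ^ ξ * k} = n + 1 := by
    apply le_antisymm
    · refine Nat.sInf_le ?_
      cases s with
      | nil => exact absurd rfl a
      | cons x s => exact b _ (by simp)
    · refine le_csInf ⟨n+1, ?_⟩ fun k hk => ?_
      · cases s with
        | nil => exact absurd rfl a
        | cons x s => exact b _ (by simp)
      · have := c.trans_lt hk
        rw [mul_lt_mul_iff_right₀ (omega_opow_pos ξ)] at this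
        exact_mod_cast this
  unfold coeffOne; rw [limitRecOn_add_one, this]; rfl

theorem coeffOne_limit {ξ : Ordinal.{u}} (hξ : Order.IsSuccLimit ξ) {ζ} (h : ζ < ξ) {t}
    (ht : t ∈ treeOne (Order.succ ζ)) :
    coeffOne ξ (shift (ω ^ ζ) t) = coeffOne (Order.succ ζ) t := by
  obtain ⟨a, b⟩ := treeOne_ok _ t ht
  have hlog : log ω ((shift (ω ^ ζ) t).headD 0) = ζ := by
    cases t with
    | nil => exact absurd rfl a
    | cons x t =>
      have := b x (by simp)
      have hp : (shift (ω ^ ζ) (x :: t)).headD 0 = ω ^ ζ + x := by simp [shift]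
      rw [hp]
      have hlt : ω ^ ζ + x < ω ^ (Order.succ ζ) :=
        isPrincipal_add_omega0_opow _ ((opow_lt_opow_iff_right one_lt_omega0).2 (Order.lt_succ ζ)) this
      apply le_antisymm
      · rw [← Order.lt_succ_iff]; exact (lt_opow_iff_log_lt one_lt_omega0 (by simp )).1 hlt
      · exact (opow_le_iff_le_log one_lt_omega0 (by simp)).1 le_self_add
  have hm : (shift (ω ^ ζ) t).map (· - ω ^ ζ) = t := by simp [shift, Function.comp_def]
  conv_lhs => unfold coeffOne
  rw [limitRecOn_limit _ _ _ _ hξ]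
  simp only [hlog]
  rw [dif_pos (hξ.succ_lt h), hm]; rfl

end Recursion

end

end Szlenk

namespace Szlenk

/-! ### Elementary properties of the derivations -/

section Basics

variable {𝕜 : Type*} [RCLike 𝕜] {X : Type u} [NormedAddCommGroup X] [NormedSpace 𝕜 X]

/-! Everything passes through condition 2. Write K_l for A_l* B. Composition with a coordinate
projection embeds K_l isometrically into D* B (`iterDeriv_eq_empty_of_diagOp`), so Sz(D, ε)
dominates every Sz(A_l, ε). By compactness, derived sets never become empty for the first time at a
limit ordinal; hence Sz(D) ≤ ω^ξ forces sup Sz(A_l, ε) < ω^ξ.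

Conversely, D* B lies in the ℓ_q-sum of the sets K_l, with q conjugate to r. If ω^ζ m derivations at
scale ε/8 empty every K_l, then ω^ζ M derivations at scale ε empty the sum, for some finite M
(`exists_iterDeriv_sumSet_eq_empty`). Near a functional of almost full ℓ_q-mass, finitely many
coordinates carry nearly all of it; a weighted count of the ω^ζ-blocks survived by these coordinates
is at most m and must grow by c with each block survived in the sum. A single block is treated by
ranks in a finite product: ordinals below ω^ζ have natural sum below ω^ζ
(`iterDeriv_omega0_opow_eq_empty`). So boundedly many blocks shrink the mass by the factor 1 - c,
and homogeneity allows repetition. This gives 2 → 1, and, used with ξ + 1 in place of ξ, the bound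
Sz(D) ≤ ω^(ξ+1) in all cases.

If condition 2 fails at ε, no derived set of D* B of order below ω^ξ is empty at that scale.
Self-similarity of the dual ball (`smul_mem_iterDeriv_dualBallImage`) then keeps 0 alive through ω^ξ
n derivations at scale ε/2^(n+1), so Sz(D) ≥ ω^(ξ+1).

Conditions 2 and 3 are compared level by level. On a well-chosen branch a functional is large on at
most m blocks, so its average over many blocks is small (`opTheta_le`). In the other direction,
descending through the derived sets along decreasing sequences of ordinals builds a weakly null tree
with one functional above ε/5 along each branch (`le_opTheta`). -/

theorem mem_deriv_iff {ε : ℝ} (hε : 0 ≤ ε) {K : Set (WeakDual 𝕜 X)} {f : WeakDual 𝕜 X} :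
    f ∈ deriv ε K ↔ f ∈ K ∧ ∀ V ∈ 𝓝 f, ∃ g ∈ V ∩ K, ∃ h ∈ V ∩ K,
      ε < ‖WeakDual.toStrongDual (g - h)‖ := by
  have key : ∀ S : Set (WeakDual 𝕜 X),
      ENNReal.ofReal ε < Metric.ediam (WeakDual.toStrongDual '' S) ↔
        ∃ g ∈ S, ∃ h ∈ S, ε < ‖WeakDual.toStrongDual (g - h)‖ := by
    intro S
    rw [← not_le, Metric.ediam_image_le_iff]
    push Not
    refine exists_congr fun g => and_congr_right fun _ => exists_congr fun h =>
      and_congr_right fun _ => ?_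
    rw [edist_dist, ENNReal.ofReal_lt_ofReal_iff_of_nonneg hε, dist_eq_norm, map_sub]
  unfold deriv
  simp only [Set.mem_ofPred_eq, key]

theorem exists_nhds_of_notMem_deriv {ε : ℝ} (hε : 0 ≤ ε) {K : Set (WeakDual 𝕜 X)}
    {f : WeakDual 𝕜 X} (hf : f ∈ K) (h : f ∉ deriv ε K) :
    ∃ V ∈ 𝓝 f, ∀ g ∈ V ∩ K, ∀ h ∈ V ∩ K, ‖WeakDual.toStrongDual (g - h)‖ ≤ ε := by
  rw [mem_deriv_iff hε] at h
  push Not at h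
  exact h hf

theorem deriv_subset (ε : ℝ) (K : Set (WeakDual 𝕜 X)) : deriv ε K ⊆ K := fun _ h => h.1

theorem deriv_mono {ε ε' : ℝ} (h : ε' ≤ ε) {K L : Set (WeakDual 𝕜 X)} (hKL : K ⊆ L) :
    deriv ε K ⊆ deriv ε' L := fun _ hf => ⟨hKL hf.1, fun V hV =>
  (ENNReal.ofReal_le_ofReal h).trans_lt ((hf.2 V hV).trans_le
    (Metric.ediam_mono (Set.image_mono (Set.inter_subset_inter_right _ hKL))))⟩

theorem isClosed_deriv (ε : ℝ) {K : Set (WeakDual 𝕜 X)} (hK : IsClosed K) :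
    IsClosed (deriv ε K) := by
  rw [← isOpen_compl_iff, isOpen_iff_mem_nhds]
  intro f hf
  by_cases hfK : f ∈ K
  · have : ∃ V ∈ 𝓝 f, ¬ ENNReal.ofReal ε < Metric.ediam (WeakDual.toStrongDual '' (V ∩ K)) := by
      by_contra! h
      exact hf ⟨hfK, h⟩
    obtain ⟨V, hV, hd⟩ := this
    filter_upwards [eventually_mem_nhds_iff.2 hV] with g hg hgd
    exact hd (hgd.2 V hg)
  · filter_upwards [hK.isOpen_compl.mem_nhds hfK] with g hg hgd
    exact hg hgd.1

@[simp]
theorem iterDeriv_zero (ε : ℝ) (K : Set (WeakDual 𝕜 X)) : iterDeriv ε K 0 = K :=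
  Ordinal.limitRecOn_zero _ _ _

theorem iterDeriv_add_one (ε : ℝ) (K : Set (WeakDual 𝕜 X)) (α : Ordinal.{u}) :
    iterDeriv ε K (α + 1) = deriv ε (iterDeriv ε K α) :=
  Ordinal.limitRecOn_add_one _ _ _ _

theorem iterDeriv_limit (ε : ℝ) (K : Set (WeakDual 𝕜 X)) {α : Ordinal.{u}}
    (hα : Order.IsSuccLimit α) : iterDeriv ε K α = ⋂ β < α, iterDeriv ε K β :=
  Ordinal.limitRecOn_limit _ _ _ _ hα

theorem iterDeriv_antitone (ε : ℝ) (K : Set (WeakDual 𝕜 X)) : Antitone (iterDeriv ε K) := by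
  intro α β h
  induction β using Ordinal.limitRecOn with
  | zero => rw [nonpos_iff_eq_zero.1 h]
  | add_one β ih =>
    rcases h.eq_or_lt with rfl | h
    · exact le_rfl
    · rw [iterDeriv_add_one]
      exact (deriv_subset _ _).trans (ih (Order.lt_add_one_iff.1 h))
  | limit β hβ ih =>
    rcases h.eq_or_lt with rfl | h
    · exact le_rfl
    · rw [iterDeriv_limit _ _ hβ]
      exact Set.iInter₂_subset α h

theorem iterDeriv_subset (ε : ℝ) (K : Set (WeakDual 𝕜 X)) (α : Ordinal.{u}) :
    iterDeriv ε K α ⊆ K := by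
  simpa using iterDeriv_antitone ε K (zero_le (a := α))

theorem iterDeriv_mono {ε ε' : ℝ} (h : ε' ≤ ε) {K L : Set (WeakDual 𝕜 X)} (hKL : K ⊆ L)
    (α : Ordinal.{u}) : iterDeriv ε K α ⊆ iterDeriv ε' L α := by
  induction α using Ordinal.limitRecOn with
  | zero => simpa using hKL
  | add_one β ih =>
    rw [iterDeriv_add_one, iterDeriv_add_one]
    exact deriv_mono h ih
  | limit β hβ ih =>
    rw [iterDeriv_limit _ _ hβ, iterDeriv_limit _ _ hβ]
    exact Set.iInter₂_mono ih

theorem isClosed_iterDeriv (ε : ℝ) {K : Set (WeakDual 𝕜 X)} (hK : IsClosed K) (α : Ordinal.{u}) :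
    IsClosed (iterDeriv ε K α) := by
  induction α using Ordinal.limitRecOn with
  | zero => simpa using hK
  | add_one β ih => rw [iterDeriv_add_one]; exact isClosed_deriv _ ih
  | limit β hβ ih => rw [iterDeriv_limit _ _ hβ]; exact isClosed_biInter ih

theorem iterDeriv_add (ε : ℝ) (K : Set (WeakDual 𝕜 X)) (α β : Ordinal.{u}) :
    iterDeriv ε K (α + β) = iterDeriv ε (iterDeriv ε K α) β := by
  induction β using Ordinal.limitRecOn with
  | zero => simp
  | add_one β ih => rw [← add_assoc, iterDeriv_add_one, iterDeriv_add_one, ih]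
  | limit β hβ ih =>
    rw [iterDeriv_limit _ _ hβ, iterDeriv_limit _ _ (Ordinal.isSuccLimit_add α hβ)]
    refine Set.Subset.antisymm (Set.subset_iInter₂ fun γ hγ => ?_)
      (Set.subset_iInter₂ fun γ hγ => ?_)
    · rw [← ih γ hγ]
      exact Set.iInter₂_subset (α + γ) (by gcongr)
    · rcases le_total γ α with h | h
      · refine (Set.iInter₂_subset 0 hβ.bot_lt).trans ?_
        rw [iterDeriv_zero]
        exact iterDeriv_antitone _ _ h
      · have hlt : γ - α < β := by
          rw [← Ordinal.add_sub_cancel_of_le h] at hγ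
          simpa using hγ
        refine (Set.iInter₂_subset (γ - α) hlt).trans ?_
        rw [← ih _ hlt, Ordinal.add_sub_cancel_of_le h]

theorem iterDeriv_mul_natCast_add_one (ε : ℝ) (K : Set (WeakDual 𝕜 X)) (α : Ordinal.{u}) (n : ℕ) :
    iterDeriv ε K (α * ((n + 1 : ℕ) : Ordinal.{u})) =
      iterDeriv ε (iterDeriv ε K (α * (n : Ordinal.{u}))) α := by
  rw [Nat.cast_succ, mul_add_one, iterDeriv_add]

/-- Derivations are local: they only depend on the set near the point. -/
theorem iterDeriv_inter_subset (ε : ℝ) (L : Set (WeakDual 𝕜 X)) {U : Set (WeakDual 𝕜 X)}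
    (hU : IsOpen U) (α : Ordinal.{u}) :
    iterDeriv ε L α ∩ U ⊆ iterDeriv ε (L ∩ U) α := by
  induction α using Ordinal.limitRecOn with
  | zero => simp
  | add_one β ih =>
    rw [iterDeriv_add_one, iterDeriv_add_one]
    rintro f ⟨hf, hfU⟩
    refine ⟨ih ⟨hf.1, hfU⟩, fun V hV => (hf.2 (V ∩ U) (inter_mem hV (hU.mem_nhds hfU))).trans_le
      (Metric.ediam_mono (Set.image_mono ?_))⟩
    rintro g ⟨⟨h1, h2⟩, h3⟩
    exact ⟨h1, ih ⟨h3, h2⟩⟩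
  | limit β hβ ih =>
    rw [iterDeriv_limit _ _ hβ, iterDeriv_limit _ _ hβ]
    rintro f ⟨hf, hfU⟩
    simp only [Set.mem_iInter] at hf ⊢
    exact fun γ hγ => ih γ hγ ⟨hf γ hγ, hfU⟩

/-- A weak*-continuous map that contracts distances at most by the factor `c` maps `ε`-derived
sets into `cε`-derived sets. -/
theorem map_mem_iterDeriv {Z : Type u} [NormedAddCommGroup Z] [NormedSpace 𝕜 Z]
    {K : Set (WeakDual 𝕜 X)} {L : Set (WeakDual 𝕜 Z)} {T : WeakDual 𝕜 X → WeakDual 𝕜 Z}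
    {c ε : ℝ} (hc : 0 < c) (hε : 0 ≤ ε) (hT : Continuous T) (hKL : Set.MapsTo T K L)
    (hd : ∀ f ∈ K, ∀ g ∈ K, c * ‖WeakDual.toStrongDual (f - g)‖ ≤
      ‖WeakDual.toStrongDual (T f - T g)‖)
    (α : Ordinal.{u}) : Set.MapsTo T (iterDeriv ε K α) (iterDeriv (c * ε) L α) := by
  induction α using Ordinal.limitRecOn with
  | zero => simpa using hKL
  | add_one β ih =>
    rw [iterDeriv_add_one, iterDeriv_add_one]
    intro f hf
    rw [mem_deriv_iff hε] at hf
    rw [mem_deriv_iff (by positivity)]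
    refine ⟨ih hf.1, fun V hV => ?_⟩
    obtain ⟨g, hg, h, hh, hlt⟩ := hf.2 _ (hT.continuousAt hV)
    exact ⟨T g, ⟨hg.1, ih hg.2⟩, T h, ⟨hh.1, ih hh.2⟩,
      (mul_lt_mul_of_pos_left hlt hc).trans_le
        (hd g (iterDeriv_subset _ _ _ hg.2) h (iterDeriv_subset _ _ _ hh.2))⟩
  | limit β hβ ih =>
    rw [iterDeriv_limit _ _ hβ, iterDeriv_limit _ _ hβ]
    intro f hf
    simp only [Set.mem_iInter] at hf ⊢
    exact fun γ hγ => ih γ hγ (hf γ hγ)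

/-- A decreasing family of compact sets whose intersection lies in an open set has a member inside
it. With `O = ∅`: the derived sets of a compact set do not first become empty at a limit ordinal. -/
theorem exists_iterDeriv_subset_of_limit {ε : ℝ} {K O : Set (WeakDual 𝕜 X)} (hK : IsCompact K)
    (hO : IsOpen O) {α : Ordinal.{u}} (hα : Order.IsSuccLimit α) (h : iterDeriv ε K α ⊆ O) :
    ∃ β < α, iterDeriv ε K β ⊆ O := by
  replace h : ⋂ β : {β // β < α}, iterDeriv ε K β ⊆ O := by
    rwa [Set.iInter_subtype, ← iterDeriv_limit _ _ hα]
  have : Nonempty {β // β < α} := ⟨⟨0, hα.bot_lt⟩⟩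
  obtain ⟨⟨β, hβ⟩, hb⟩ := exists_subset_nhds_of_isCompact'
    (V := fun β : {β // β < α} => iterDeriv ε K β)
    (fun β γ => ⟨max β γ, iterDeriv_antitone _ _ (le_max_left _ _),
      iterDeriv_antitone _ _ (le_max_right _ _)⟩)
    (fun β => hK.of_isClosed_subset (isClosed_iterDeriv _ hK.isClosed _) (iterDeriv_subset _ _ _))
    (fun β => isClosed_iterDeriv _ hK.isClosed _)
    (U := O) (fun f hf => hO.mem_nhds (h hf))
  exact ⟨β, hβ, hb⟩

theorem indexEps_le_iff {K : Set (WeakDual 𝕜 X)} {ε : ℝ} {α : Ordinal.{u}} :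
    indexEps K ε ≤ α ↔ iterDeriv ε K α = ∅ := by
  refine ⟨fun h => ?_, fun h => sInf_le ⟨α, h, rfl⟩⟩
  -- The infimum of the empty set would be `⊤`; for a nonempty set it is attained, the order being a
  -- well-order.
  have hne : {a : WithTop Ordinal.{u} | ∃ α : Ordinal.{u}, iterDeriv ε K α = ∅ ∧ a = α}.Nonempty := by
    by_contra hne
    rw [Set.not_nonempty_iff_eq_empty] at hne
    unfold indexEps at h
    rw [hne, sInf_empty] at h
    exact absurd (top_le_iff.1 h) (WithTop.coe_ne_top)
  obtain ⟨β, hβ, hb⟩ := csInf_mem hne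
  change indexEps K ε = β at hb
  rw [hb, WithTop.coe_le_coe] at h
  exact Set.subset_eq_empty (iterDeriv_antitone ε K h) hβ

theorem index_le_iff {K : Set (WeakDual 𝕜 X)} {α : Ordinal.{u}} :
    index K ≤ α ↔ ∀ ε : ℝ, 0 < ε → iterDeriv ε K α = ∅ := by
  simp only [index, iSup_le_iff, Subtype.forall, indexEps_le_iff]

end Basics

/-! ### The set `A* B_{Y*}` -/

section DualBall

variable {𝕜 : Type*} [RCLike 𝕜] {X : Type u} [NormedAddCommGroup X] [NormedSpace 𝕜 X]
  {Y : Type v} [NormedAddCommGroup Y] [NormedSpace 𝕜 Y]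

theorem dualBallImage_eq_image (A : X →L[𝕜] Y) : dualBallImage A =
    (fun g : WeakDual 𝕜 Y => StrongDual.toWeakDual ((WeakDual.toStrongDual g).comp A)) ''
      (WeakDual.toStrongDual ⁻¹' Metric.closedBall 0 1) := by
  ext f
  constructor
  · rintro ⟨g, hg, rfl⟩
    exact ⟨StrongDual.toWeakDual g, by simpa using hg, rfl⟩
  · rintro ⟨g, hg, rfl⟩
    exact ⟨WeakDual.toStrongDual g, by simpa using hg, rfl⟩

theorem continuous_toWeakDual_comp (A : X →L[𝕜] Y) : Continuous
    (fun g : WeakDual 𝕜 Y => StrongDual.toWeakDual ((WeakDual.toStrongDual g).comp A)) :=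
  WeakDual.continuous_of_continuous_eval fun x => WeakDual.eval_continuous (A x)

theorem isCompact_dualBallImage (A : X →L[𝕜] Y) : IsCompact (dualBallImage A) := by
  rw [dualBallImage_eq_image]
  exact (WeakDual.isCompact_closedBall 0 1).image (continuous_toWeakDual_comp A)

theorem zero_mem_dualBallImage (A : X →L[𝕜] Y) : (0 : WeakDual 𝕜 X) ∈ dualBallImage A :=
  ⟨0, by simp, by simp⟩

theorem norm_le_of_mem_dualBallImage {A : X →L[𝕜] Y} {f : WeakDual 𝕜 X}
    (hf : f ∈ dualBallImage A) : ‖WeakDual.toStrongDual f‖ ≤ ‖A‖ := by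
  obtain ⟨g, hg, rfl⟩ := hf
  calc ‖g.comp A‖ ≤ ‖g‖ * ‖A‖ := g.opNorm_comp_le A
    _ ≤ 1 * ‖A‖ := by gcongr
    _ = ‖A‖ := one_mul _

/-- Absolute convexity, in the three-term form needed for the self-similarity argument. -/
theorem smul_add_smul_add_smul_mem_dualBallImage {A : X →L[𝕜] Y} {f g h : WeakDual 𝕜 X}
    (hf : f ∈ dualBallImage A) (hg : g ∈ dualBallImage A) (hh : h ∈ dualBallImage A) {a b c : 𝕜}
    (habc : ‖a‖ + ‖b‖ + ‖c‖ ≤ 1) : a • f + b • g + c • h ∈ dualBallImage A := by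
  obtain ⟨f', hf', rfl⟩ := hf
  obtain ⟨g', hg', rfl⟩ := hg
  obtain ⟨h', hh', rfl⟩ := hh
  refine ⟨a • f' + b • g' + c • h', ?_, rfl⟩
  calc ‖a • f' + b • g' + c • h'‖ ≤ ‖a • f'‖ + ‖b • g'‖ + ‖c • h'‖ := norm_add₃_le
    _ = ‖a‖ * ‖f'‖ + ‖b‖ * ‖g'‖ + ‖c‖ * ‖h'‖ := by rw [norm_smul, norm_smul, norm_smul]
    _ ≤ ‖a‖ * 1 + ‖b‖ * 1 + ‖c‖ * 1 := by gcongr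
    _ ≤ 1 := by simpa using habc

end DualBall

end Szlenk
namespace Szlenk

/-! ### A natural sum of ordinals -/

section NatSum

open Ordinal

/-- The natural (Hessenberg) sum, the least operation strictly increasing in both arguments. -/
noncomputable def natSum (a b : Ordinal.{u}) : Ordinal.{u} :=
  max (⨆ x : Set.Iio a, Order.succ (natSum x.1 b)) (⨆ x : Set.Iio b, Order.succ (natSum a x.1))
termination_by (a, b)
decreasing_by all_goals (have := Set.mem_Iio.1 x.2; simp [Prod.lex_def, this])

theorem natSum_lt_left {a a' : Ordinal.{u}} (h : a' < a) (b : Ordinal.{u}) :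
    natSum a' b < natSum a b := by
  conv_rhs => rw [natSum]
  refine Order.succ_le_iff.1 (le_max_of_le_left ?_)
  exact le_ciSup (f := fun x : Set.Iio a => Order.succ (natSum x.1 b)) bddAbove_of_small ⟨a', h⟩

theorem natSum_lt_right (a : Ordinal.{u}) {b b' : Ordinal.{u}} (h : b' < b) :
    natSum a b' < natSum a b := by
  conv_rhs => rw [natSum]
  refine Order.succ_le_iff.1 (le_max_of_le_right ?_)
  exact le_ciSup (f := fun x : Set.Iio b => Order.succ (natSum a x.1)) bddAbove_of_small ⟨b', h⟩

theorem natSum_le_natSum {a a' b b' : Ordinal.{u}} (h : a' ≤ a) (h' : b' ≤ b) :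
    natSum a' b' ≤ natSum a b := by
  have h1 : natSum a' b' ≤ natSum a b' := by
    rcases h.eq_or_lt with rfl | h
    · exact le_rfl
    · exact (natSum_lt_left h _).le
  refine h1.trans ?_
  rcases h'.eq_or_lt with rfl | h
  · exact le_rfl
  · exact (natSum_lt_right _ h).le

theorem natSum_le {a b c : Ordinal.{u}} (h : ∀ x < a, natSum x b < c)
    (h' : ∀ x < b, natSum a x < c) : natSum a b ≤ c := by
  rw [natSum]
  exact max_le (Ordinal.iSup_le fun x => Order.succ_le_iff.2 (h x.1 x.2))
    (Ordinal.iSup_le fun x => Order.succ_le_iff.2 (h' x.1 x.2))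

/-- Rigidity from strict monotonicity: if no summand grows and the sum does not drop, nothing has
changed. This is how equal sums of ranks become equal ranks. -/
theorem eq_of_natSum_eq {a a' b b' : Ordinal.{u}} (h : a' ≤ a) (h' : b' ≤ b)
    (heq : natSum a b ≤ natSum a' b') : a' = a ∧ b' = b := by
  constructor
  · by_contra hne
    exact absurd (heq.trans (natSum_le_natSum le_rfl h'))
      (natSum_lt_left (lt_of_le_of_ne h hne) b).not_ge
  · by_contra hne
    exact absurd (heq.trans (natSum_le_natSum h le_rfl))
      (natSum_lt_right a (lt_of_le_of_ne h' hne)).not_ge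

theorem exists_natCast_mul_add {ζ a : Ordinal.{u}} (h : a < ω ^ (ζ + 1)) :
    ∃ (n : ℕ) (x : Ordinal.{u}), x < ω ^ ζ ∧ a = ω ^ ζ * n + x := by
  rw [opow_add, opow_one] at h
  obtain ⟨n, hn⟩ := lt_omega0.1 ((lt_mul_iff_div_lt (omega_opow_pos ζ).ne').1 h)
  exact ⟨n, a % ω ^ ζ, mod_lt _ (omega_opow_pos ζ).ne', by rw [← hn, div_add_mod]⟩

/-- Lowering one argument either lowers its ω^ζ-digit, which no sum of remainders can compensate
since `ih` keeps it below ω^ζ, or keeps the digit and lowers the remainder. -/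
theorem natSum_mul_add_le {ζ : Ordinal.{u}} (ih : ∀ a < ω ^ ζ, ∀ b < ω ^ ζ, natSum a b < ω ^ ζ)
    (a b : Ordinal.{u}) : ∀ (n m : ℕ) (x y : Ordinal.{u}), x < ω ^ ζ → y < ω ^ ζ →
      a = ω ^ ζ * n + x → b = ω ^ ζ * m + y →
      natSum a b ≤ ω ^ ζ * ((n + m : ℕ) : Ordinal.{u}) + natSum x y := by
  have hstep : ∀ (n : ℕ) (x a' : Ordinal.{u}), x < ω ^ ζ → a' < ω ^ ζ * n + x →
      ∃ (n' : ℕ) (x' : Ordinal.{u}), x' < ω ^ ζ ∧ a' = ω ^ ζ * n' + x' ∧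
        (n' < n ∨ n' = n ∧ x' < x) := by
    intro n x a' hx h
    have h1 : a' < ω ^ (ζ + 1) := by
      refine h.trans ?_
      have : ω ^ ζ * n + x < ω ^ ζ * ((n + 1 : ℕ) : Ordinal.{u}) := by
        rw [Nat.cast_succ, mul_add_one]; gcongr
      refine this.trans_le ?_
      rw [opow_add, opow_one]
      gcongr
      exact (natCast_lt_omega0 _).le
    obtain ⟨n', x', hx', rfl⟩ := exists_natCast_mul_add h1
    refine ⟨n', x', hx', rfl, ?_⟩
    rcases lt_trichotomy n' n with h2 | h2 | h2
    · exact Or.inl h2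
    · subst h2
      exact Or.inr ⟨rfl, by simpa using h⟩
    · exfalso
      have : ω ^ ζ * ((n + 1 : ℕ) : Ordinal.{u}) ≤ ω ^ ζ * n' := by
        gcongr
        exact h2
      rw [Nat.cast_succ, mul_add_one] at this
      exact absurd (h.trans ((by gcongr : ω ^ ζ * n + x < ω ^ ζ * n + ω ^ ζ).trans_le this))
        (by simp)
  have hlt : ∀ (k l : ℕ) (u w : Ordinal.{u}), u < ω ^ ζ → k < l →
      ω ^ ζ * k + u < ω ^ ζ * l + w := by
    intro k l u w hu hkl
    calc ω ^ ζ * k + u < ω ^ ζ * k + ω ^ ζ := by gcongr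
      _ = ω ^ ζ * ((k + 1 : ℕ) : Ordinal.{u}) := by rw [Nat.cast_succ, mul_add_one]
      _ ≤ ω ^ ζ * l := by gcongr; exact hkl
      _ ≤ ω ^ ζ * l + w := le_self_add
  induction a using WellFoundedLT.induction generalizing b with
  | ind a iha =>
  induction b using WellFoundedLT.induction with
  | ind b ihb =>
  intro n m x y hx hy ha hb
  refine natSum_le (fun a' ha' => ?_) fun b' hb' => ?_
  · obtain ⟨n', x', hx', he, hc⟩ := hstep n x a' hx (ha ▸ ha')
    refine (iha a' ha' b n' m x' y hx' hy he hb).trans_lt ?_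
    rcases hc with hc | ⟨rfl, hc⟩
    · exact hlt _ _ _ _ (ih _ hx' _ hy) (by omega)
    · gcongr
      exact natSum_lt_left hc _
  · obtain ⟨m', y', hy', he, hc⟩ := hstep m y b' hy (hb ▸ hb')
    refine (ihb b' hb' n m' x y' hx hy' ha he).trans_lt ?_
    rcases hc with hc | ⟨rfl, hc⟩
    · exact hlt _ _ _ _ (ih _ hx _ hy') (by omega)
    · gcongr
      exact natSum_lt_right _ hc

/-- The reason why powers of ω are the right unit: finitely many coordinates, each lasting less than
ω^ζ, together still last less than ω^ζ. The successor case is the digit estimate above; at a limit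
both arguments lie below a smaller power. -/
theorem natSum_lt_omega0_opow (ζ : Ordinal.{u}) :
    ∀ a < ω ^ ζ, ∀ b < ω ^ ζ, natSum a b < ω ^ ζ := by
  induction ζ using Ordinal.limitRecOn with
  | zero =>
    intro a ha b hb
    rw [opow_zero, Order.lt_one_iff] at *
    subst ha hb
    exact le_antisymm (natSum_le (by simp) (by simp)) zero_le
  | add_one ζ ih =>
    intro a ha b hb
    obtain ⟨n, x, hx, hax⟩ := exists_natCast_mul_add ha
    obtain ⟨m, y, hy, hby⟩ := exists_natCast_mul_add hb
    refine (natSum_mul_add_le ih a b n m x y hx hy hax hby).trans_lt ?_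
    calc ω ^ ζ * ((n + m : ℕ) : Ordinal.{u}) + natSum x y
        < ω ^ ζ * ((n + m : ℕ) : Ordinal.{u}) + ω ^ ζ := by gcongr; exact ih _ hx _ hy
      _ = ω ^ ζ * ((n + m + 1 : ℕ) : Ordinal.{u}) := by rw [Nat.cast_succ (n + m), mul_add_one]
      _ < ω ^ (ζ + 1) := by
        rw [opow_add, opow_one]
        exact (mul_lt_mul_iff_right₀ (omega_opow_pos ζ)).2 (natCast_lt_omega0 _)
  | limit ζ hζ ih =>
    intro a ha b hb
    obtain ⟨η, hη, ha⟩ := (lt_opow_of_isSuccLimit omega0_ne_zero hζ).1 ha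
    obtain ⟨θ, hθ, hb⟩ := (lt_opow_of_isSuccLimit omega0_ne_zero hζ).1 hb
    have hm : max η θ < ζ := max_lt hη hθ
    refine (ih _ hm a (ha.trans_le ?_) b (hb.trans_le ?_)).trans ?_
    · exact opow_le_opow_right omega0_pos (le_max_left _ _)
    · exact opow_le_opow_right omega0_pos (le_max_right _ _)
    · exact (opow_lt_opow_iff_right one_lt_omega0).2 hm

/-- The natural sum of a list of ordinals. -/
noncomputable def listNatSum (l : List Ordinal.{u}) : Ordinal.{u} := l.foldr natSum 0

theorem listNatSum_lt_omega0_opow {ζ : Ordinal.{u}} {l : List Ordinal.{u}}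
    (h : ∀ a ∈ l, a < ω ^ ζ) : listNatSum l < ω ^ ζ := by
  induction l with
  | nil => exact omega_opow_pos ζ
  | cons a l ih =>
    exact natSum_lt_omega0_opow ζ _ (h a (by simp)) _ (ih fun b hb => h b (by simp [hb]))

theorem listNatSum_map_le {ι : Type*} {a b : ι → Ordinal.{u}} (l : List ι)
    (h : ∀ i ∈ l, a i ≤ b i) : listNatSum (l.map a) ≤ listNatSum (l.map b) := by
  induction l with
  | nil => exact le_rfl
  | cons i l ih =>
    exact natSum_le_natSum (h i (by simp)) (ih fun j hj => h j (by simp [hj]))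

theorem eq_of_listNatSum_map_le {ι : Type*} {a b : ι → Ordinal.{u}} (l : List ι)
    (h : ∀ i ∈ l, a i ≤ b i) (hle : listNatSum (l.map b) ≤ listNatSum (l.map a)) :
    ∀ i ∈ l, a i = b i := by
  induction l with
  | nil => simp
  | cons i l ih =>
    have h1 : ∀ j ∈ l, a j ≤ b j := fun j hj => h j (by simp [hj])
    obtain ⟨h2, h3⟩ := eq_of_natSum_eq (h i (by simp)) (listNatSum_map_le l h1) hle
    intro j hj
    rcases List.mem_cons.1 hj with rfl | hj
    · exact h2
    · exact ih h1 h3.ge j hj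

end NatSum

/-! ### Derivations of subsets of a finite product -/

section Product

open Ordinal

variable {𝕜 : Type*} [RCLike 𝕜] {X : Type u} [NormedAddCommGroup X] [NormedSpace 𝕜 X]

/-- The least `β` such that `f ∉ s_ε^{β+1}(S)`. -/
noncomputable def rank (ε : ℝ) (S : Set (WeakDual 𝕜 X)) (f : WeakDual 𝕜 X) : Ordinal.{u} :=
  sInf {β | f ∉ iterDeriv ε S (β + 1)}

/-- A point of `S` leaves the derived sets at a successor stage, because limit stages are
intersections; so there is a last derived set containing it, indexed by its rank. A point outside
`S` has rank 0. -/
theorem rank_spec {ε : ℝ} {S : Set (WeakDual 𝕜 X)} {f : WeakDual 𝕜 X} {α : Ordinal.{u}}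
    (hα : 0 < α) (h : f ∉ iterDeriv ε S α) :
    rank ε S f < α ∧ f ∉ iterDeriv ε S (rank ε S f + 1) ∧
      (f ∈ S → f ∈ iterDeriv ε S (rank ε S f)) := by
  obtain ⟨β, hβ, hf, hmem⟩ : ∃ β < α, f ∉ iterDeriv ε S (β + 1) ∧
      (f ∈ S → f ∈ iterDeriv ε S β) := by
    induction α using Ordinal.limitRecOn with
    | zero => exact absurd hα (lt_irrefl _)
    | add_one β ih =>
      by_cases hb : f ∈ iterDeriv ε S β
      · exact ⟨β, Order.lt_add_one_iff.2 le_rfl, h, fun _ => hb⟩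
      · rcases eq_zero_or_pos β with rfl | h0
        · refine ⟨0, by simp, h, fun hS => absurd (by simpa using hS) hb⟩
        · obtain ⟨γ, hγ, h1⟩ := ih h0 hb
          exact ⟨γ, hγ.trans (Order.lt_add_one_iff.2 le_rfl), h1⟩
    | limit α hl ih =>
      rw [iterDeriv_limit _ _ hl] at h
      simp only [Set.mem_iInter, not_forall] at h
      obtain ⟨β, hβ, hb⟩ := h
      rcases eq_zero_or_pos β with rfl | h0
      · refine ⟨0, hα, fun hc => hb (iterDeriv_antitone _ _ zero_le hc), fun hS => ?_⟩
        simpa using hS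
      · obtain ⟨γ, hγ, h1⟩ := ih β hβ h0 hb
        exact ⟨γ, hγ.trans hβ, h1⟩
  refine ⟨(csInf_le' hf).trans_lt hβ, csInf_mem (s := {β | f ∉ iterDeriv ε S (β + 1)}) ⟨β, hf⟩,
    fun hS => iterDeriv_antitone _ _ (csInf_le' hf) (hmem hS)⟩

theorem rank_le {ε : ℝ} {S : Set (WeakDual 𝕜 X)} {f : WeakDual 𝕜 X} {α : Ordinal.{u}}
    (h : f ∉ iterDeriv ε S (α + 1)) : rank ε S f ≤ α := csInf_le' h

/-- If the coordinates of the members of `L` have rank below `ω^ζ` with respect to `S_i`, and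
the distances in `L` are controlled by those coordinates which lie in the sets `S_i`, then
`s_ε^{ω^ζ}(L) = ∅`. -/
theorem iterDeriv_omega0_opow_eq_empty {ι : Type*} {Z : ι → Type u}
    [∀ i, NormedAddCommGroup (Z i)] [∀ i, NormedSpace 𝕜 (Z i)] (F : Finset ι)
    {π : ∀ i, WeakDual 𝕜 X → WeakDual 𝕜 (Z i)} (hπ : ∀ i, Continuous (π i))
    {S : ∀ i, Set (WeakDual 𝕜 (Z i))} (hS : ∀ i, IsClosed (S i)) {δ : ι → ℝ}
    (hδ : ∀ i ∈ F, 0 ≤ δ i)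
    {ε : ℝ} (hε : 0 ≤ ε) {ζ : Ordinal.{u}} {L : Set (WeakDual 𝕜 X)}
    (hL : ∀ h ∈ L, ∀ i ∈ F, π i h ∉ iterDeriv (δ i) (S i) (ω ^ ζ))
    (hdist : ∀ h ∈ L, ∀ h' ∈ L,
      (∀ i ∈ F, π i h ∈ S i → π i h' ∈ S i →
        ‖WeakDual.toStrongDual (π i h - π i h')‖ ≤ δ i) →
      ‖WeakDual.toStrongDual (h - h')‖ ≤ ε / 2) :
    iterDeriv ε L (ω ^ ζ) = ∅ := by
  set r : WeakDual 𝕜 X → ι → Ordinal.{u} := fun h i => rank (δ i) (S i) (π i h)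
  have hr : ∀ h ∈ L, ∀ i ∈ F, _ := fun h hh i hi => rank_spec (omega_opow_pos ζ) (hL h hh i hi)
  have main : ∀ α : Ordinal.{u}, ∀ h ∈ iterDeriv ε L α, α ≤ listNatSum (F.toList.map (r h)) := by
    intro α
    induction α using Ordinal.limitRecOn with
    | zero => exact fun _ _ => zero_le
    | add_one α ih =>
      intro h hh
      rw [iterDeriv_add_one] at hh
      have hhL : h ∈ L := iterDeriv_subset _ _ _ hh.1
      -- Suppose the sum of the ranks at `h` is exactly α. Near `h` ranks cannot increase, and by
      -- `ih` their sum cannot drop below α on the α-th derived set, so they are constant there.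
      -- Nearby points then lie with `h` in pieces of diameter at most `δ i`, and the derived set
      -- has diameter at most ε near `h`.
      refine Order.add_one_le_of_lt (lt_of_le_of_ne (ih h hh.1) fun heq => ?_)
      have h1 : ∀ i ∈ F, ∃ V ∈ 𝓝 (π i h), ∀ f ∈ V, f ∉ iterDeriv (δ i) (S i) (r h i + 1) ∧
          (f ∈ iterDeriv (δ i) (S i) (r h i) → π i h ∈ S i →
            ‖WeakDual.toStrongDual (f - π i h)‖ ≤ δ i) := by
        intro i hi
        obtain ⟨-, hn, hm⟩ := hr h hhL i hi
        have hop := (isClosed_iterDeriv (δ i) (hS i) (r h i + 1)).isOpen_compl.mem_nhds hn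
        by_cases hhS : π i h ∈ S i
        · rw [iterDeriv_add_one] at hn
          obtain ⟨V, hV, hd⟩ := exists_nhds_of_notMem_deriv (hδ i hi) (hm hhS) hn
          exact ⟨_, inter_mem hop hV, fun f hf => ⟨hf.1, fun hf' _ =>
            hd f ⟨hf.2, hf'⟩ _ ⟨mem_of_mem_nhds hV, hm hhS⟩⟩⟩
        · exact ⟨_, hop, fun f hf => ⟨hf, fun _ h => absurd h hhS⟩⟩
      choose! V hV hVp using h1
      have hW : (⋂ i ∈ F, π i ⁻¹' V i) ∈ 𝓝 h :=
        (Filter.biInter_finset_mem F).2 fun i hi => (hπ i).continuousAt (hV i hi)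
      have hclose : ∀ g ∈ (⋂ i ∈ F, π i ⁻¹' V i) ∩ iterDeriv ε L α,
          ‖WeakDual.toStrongDual (g - h)‖ ≤ ε / 2 := by
        rintro g ⟨hg, hgα⟩
        have hgL : g ∈ L := iterDeriv_subset _ _ _ hgα
        simp only [Set.mem_iInter, Set.mem_preimage] at hg
        have hle : ∀ i ∈ F.toList, r g i ≤ r h i := fun i hi => by
          rw [Finset.mem_toList] at hi
          exact rank_le ((hVp i hi _ (hg i hi)).1)
        have heq' := eq_of_listNatSum_map_le _ hle (heq.symm.trans_le (ih g hgα))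
        refine hdist g hgL h hhL fun i hi hgS hhS => ?_
        refine (hVp i hi _ (hg i hi)).2 ?_ hhS
        rw [← heq' i (Finset.mem_toList.2 hi)]
        exact (hr g hgL i hi).2.2 hgS
      obtain ⟨-, hlarge⟩ := (mem_deriv_iff hε).1 hh
      obtain ⟨g, hg, g', hg', hlt⟩ := hlarge _ hW
      refine absurd hlt (not_lt.2 ?_)
      have : g - g' = (g - h) - (g' - h) := by abel
      rw [this, map_sub]
      refine (norm_sub_le _ _).trans ?_
      linarith [hclose g hg, hclose g' hg']
    | limit α hα ih =>
      intro h hh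
      rw [iterDeriv_limit _ _ hα] at hh
      simp only [Set.mem_iInter] at hh
      exact hα.le_iff_forall_le.2 fun β hβ => ih β hβ h (hh β hβ)
  refine Set.eq_empty_of_forall_notMem fun h hh => ?_
  refine absurd (main _ h hh) (not_le.2 (listNatSum_lt_omega0_opow fun a ha => ?_))
  obtain ⟨i, hi, rfl⟩ := List.mem_map.1 ha
  exact (hr h (iterDeriv_subset _ _ _ hh) i (Finset.mem_toList.1 hi)).1

end Product

end Szlenk
namespace Szlenk

/-! ### Diagonal sums of the sets `A_l* B_{Y_l*}` -/

section ScaledBall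

variable {𝕜 : Type*} [RCLike 𝕜] {X : Type u} [NormedAddCommGroup X] [NormedSpace 𝕜 X]
  {Y : Type v} [NormedAddCommGroup Y] [NormedSpace 𝕜 Y]

/-- `t A* B_{Y*}`. -/
def scaledDualBall (A : X →L[𝕜] Y) (t : ℝ) : Set (WeakDual 𝕜 X) :=
  {f | ∃ g : StrongDual 𝕜 Y, ‖g‖ ≤ t ∧ f = StrongDual.toWeakDual (g.comp A)}

theorem isClosed_scaledDualBall (A : X →L[𝕜] Y) (t : ℝ) : IsClosed (scaledDualBall A t) := by
  have : scaledDualBall A t =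
    (fun g : WeakDual 𝕜 Y => StrongDual.toWeakDual ((WeakDual.toStrongDual g).comp A)) ''
      (WeakDual.toStrongDual ⁻¹' Metric.closedBall 0 t) := by
    ext f
    constructor
    · rintro ⟨g, hg, rfl⟩
      exact ⟨StrongDual.toWeakDual g, by simpa using hg, rfl⟩
    · rintro ⟨g, hg, rfl⟩
      exact ⟨WeakDual.toStrongDual g, by simpa using hg, rfl⟩
  rw [this]
  exact ((WeakDual.isCompact_closedBall 0 t).image (continuous_toWeakDual_comp A)).isClosed

theorem iterDeriv_scaledDualBall_eq_empty {A : X →L[𝕜] Y} {δ t : ℝ} (hδ : 0 ≤ δ) (ht : 0 < t)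
    {α : Ordinal.{u}} (h : iterDeriv δ (dualBallImage A) α = ∅) :
    iterDeriv (t * δ) (scaledDualBall A t) α = ∅ := by
  refine Set.eq_empty_of_forall_notMem fun f hf => ?_
  have ht' : ‖((t⁻¹ : ℝ) : 𝕜)‖ = t⁻¹ := by rw [RCLike.norm_ofReal, abs_of_pos (by positivity)]
  have := map_mem_iterDeriv (L := dualBallImage A) (T := fun f => ((t⁻¹ : ℝ) : 𝕜) • f)
    (inv_pos.2 ht) (by positivity : 0 ≤ t * δ) (continuous_const_smul _) ?_ ?_ α hf
  · rw [inv_mul_cancel_left₀ ht.ne', h] at this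
    exact this
  · rintro f ⟨g, hg, rfl⟩
    refine ⟨((t⁻¹ : ℝ) : 𝕜) • g, ?_, rfl⟩
    rw [norm_smul, ht', inv_mul_le_one₀ ht]
    exact hg
  · intro f _ g _
    rw [← smul_sub, map_smul, norm_smul, ht']

/-- The norm is weak* lower semicontinuous, and the representatives of norm at most `‖g₀‖` form a
weak*-compact set. For a minimal representative, membership in `scaledDualBall A t` amounts to its
norm being at most `t`. -/
theorem exists_minimal_norm_comp_eq (A : X →L[𝕜] Y) (g₀ : StrongDual 𝕜 Y) :
    ∃ g : StrongDual 𝕜 Y, g.comp A = g₀.comp A ∧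
      ∀ g' : StrongDual 𝕜 Y, g'.comp A = g₀.comp A → ‖g‖ ≤ ‖g'‖ := by
  have hlsc : LowerSemicontinuous fun g : WeakDual 𝕜 Y => ‖WeakDual.toStrongDual g‖ := by
    rw [lowerSemicontinuous_iff_isClosed_preimage]
    intro t
    convert! WeakDual.isClosed_closedBall (𝕜 := 𝕜) (E := Y) 0 t using 1
    ext g
    simp
  set S : Set (WeakDual 𝕜 Y) := (WeakDual.toStrongDual ⁻¹' Metric.closedBall 0 ‖g₀‖) ∩
    (fun g : WeakDual 𝕜 Y => StrongDual.toWeakDual ((WeakDual.toStrongDual g).comp A)) ⁻¹'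
      {StrongDual.toWeakDual (g₀.comp A)}
  have hS : IsCompact S := (WeakDual.isCompact_closedBall 0 ‖g₀‖).inter_right
    (isClosed_singleton.preimage (continuous_toWeakDual_comp A))
  have hne : S.Nonempty := ⟨StrongDual.toWeakDual g₀, by simp [S]⟩
  obtain ⟨g, hg, hmin⟩ := (hlsc.lowerSemicontinuousOn S).exists_isMinOn hne hS
  have hg1 : ‖WeakDual.toStrongDual g‖ ≤ ‖g₀‖ := by simpa using hg.1
  refine ⟨WeakDual.toStrongDual g, StrongDual.toWeakDual.injective hg.2, fun g' hg' => ?_⟩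
  rcases le_total ‖g₀‖ ‖g'‖ with h | h
  · exact hg1.trans h
  · exact hmin (a := StrongDual.toWeakDual g') ⟨by simpa using h, by simp [hg']⟩

end ScaledBall

/-! ### Derivations of ℓ_q-sums of the sets A_l* B -/

section SumSet

open Ordinal

variable {𝕜 : Type*} [RCLike 𝕜] {Λ : Type*}
  {X : Λ → Type u} [∀ l, NormedAddCommGroup (X l)] [∀ l, NormedSpace 𝕜 (X l)]
  {Y : Λ → Type v} [∀ l, NormedAddCommGroup (Y l)] [∀ l, NormedSpace 𝕜 (Y l)]
  {E : Type u} [NormedAddCommGroup E] [NormedSpace 𝕜 E]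

/-- The coordinate of a functional on a direct sum with embeddings `e l`. -/
noncomputable def coord (e : ∀ l, X l →L[𝕜] E) (l : Λ) (f : WeakDual 𝕜 E) : WeakDual 𝕜 (X l) :=
  StrongDual.toWeakDual ((WeakDual.toStrongDual f).comp (e l))

theorem continuous_coord (e : ∀ l, X l →L[𝕜] E) (l : Λ) : Continuous (coord e l) :=
  continuous_toWeakDual_comp (e l)

/-- The functionals whose coordinates are of the form `A_l* g_l` with `∑ ‖g_l‖^q ≤ C`. -/
def sumSet (e : ∀ l, X l →L[𝕜] E) (A : ∀ l, X l →L[𝕜] Y l) (q C : ℝ) : Set (WeakDual 𝕜 E) :=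
  {f | ∃ g : ∀ l, StrongDual 𝕜 (Y l), (∀ l, coord e l f = StrongDual.toWeakDual ((g l).comp (A l))) ∧
    ∀ F : Finset Λ, ∑ l ∈ F, ‖g l‖ ^ q ≤ C}

/-- The norm of a functional is at most the `ℓ_q`-norm of the norms of its coordinates. -/
def UpperEstimate (e : ∀ l, X l →L[𝕜] E) (q : ℝ) : Prop :=
  ∀ (f : WeakDual 𝕜 E) (C : ℝ), 0 ≤ C →
    (∀ F : Finset Λ, ∑ l ∈ F, ‖WeakDual.toStrongDual (coord e l f)‖ ^ q ≤ C ^ q) →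
    ‖WeakDual.toStrongDual f‖ ≤ C

variable {e : ∀ l, X l →L[𝕜] E} {A : ∀ l, X l →L[𝕜] Y l} {q : ℝ}

theorem coord_sub (l : Λ) (f g : WeakDual 𝕜 E) : coord e l (f - g) = coord e l f - coord e l g :=
  rfl

theorem coord_smul (l : Λ) (c : 𝕜) (f : WeakDual 𝕜 E) : coord e l (c • f) = c • coord e l f :=
  rfl

theorem add_rpow_le_two_rpow_mul {x y q : ℝ} (hx : 0 ≤ x) (hy : 0 ≤ y) (hq : 0 ≤ q) :
    (x + y) ^ q ≤ 2 ^ q * (x ^ q + y ^ q) := by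
  calc (x + y) ^ q ≤ (2 * max x y) ^ q := by
        apply Real.rpow_le_rpow (by positivity) _ hq
        linarith [le_max_left x y, le_max_right x y]
    _ = 2 ^ q * max x y ^ q := Real.mul_rpow (by norm_num) (by positivity)
    _ ≤ 2 ^ q * (x ^ q + y ^ q) := by
        gcongr
        rcases max_choice x y with h | h <;> rw [h]
        · linarith [Real.rpow_nonneg hy q]
        · linarith [Real.rpow_nonneg hx q]

theorem norm_coord_sub_rpow_le {R : ℝ} (hR : ∀ l, ‖A l‖ ≤ R) (hq : 0 ≤ q) {l : Λ}
    {f f' : WeakDual 𝕜 E} {g g' : StrongDual 𝕜 (Y l)}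
    (hg : coord e l f = StrongDual.toWeakDual (g.comp (A l)))
    (hg' : coord e l f' = StrongDual.toWeakDual (g'.comp (A l))) :
    ‖WeakDual.toStrongDual (coord e l (f - f'))‖ ^ q ≤ (2 * R) ^ q * (‖g‖ ^ q + ‖g'‖ ^ q) := by
  have hR0 : 0 ≤ R := (norm_nonneg _).trans (hR l)
  have h : ‖WeakDual.toStrongDual (coord e l (f - f'))‖ ≤ R * (‖g‖ + ‖g'‖) := by
    rw [coord_sub, hg, hg', map_sub]
    refine (norm_sub_le _ _).trans ?_
    have h1 : ‖g.comp (A l)‖ ≤ R * ‖g‖ := by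
      rw [mul_comm]; exact (g.opNorm_comp_le (A l)).trans (by gcongr; exact hR l)
    have h2 : ‖g'.comp (A l)‖ ≤ R * ‖g'‖ := by
      rw [mul_comm]; exact (g'.opNorm_comp_le (A l)).trans (by gcongr; exact hR l)
    rw [mul_add]
    exact add_le_add h1 h2
  calc _ ≤ (R * (‖g‖ + ‖g'‖)) ^ q := Real.rpow_le_rpow (norm_nonneg _) h hq
    _ = R ^ q * (‖g‖ + ‖g'‖) ^ q := Real.mul_rpow hR0 (by positivity)
    _ ≤ R ^ q * (2 ^ q * (‖g‖ ^ q + ‖g'‖ ^ q)) := by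
        gcongr
        exact add_rpow_le_two_rpow_mul (norm_nonneg _) (norm_nonneg _) hq
    _ = _ := by rw [Real.mul_rpow (by norm_num) hR0]; ring

/-- If `f` is in `sumSet e A q 1` but not in `sumSet e A q (1 - c)`, finitely many coordinates
witness this in a stable way. -/
theorem exists_lower_bounds (hq : 1 ≤ q) {c : ℝ} (hc : c < 1) {f : WeakDual 𝕜 E}
    (hf : f ∈ sumSet e A q 1) (hf' : f ∉ sumSet e A q (1 - c)) :
    ∃ (F : Finset Λ) (a : Λ → ℝ), (∀ l ∈ F, 0 < a l) ∧ ∑ l ∈ F, a l ^ q = 1 - c ∧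
      ∀ l ∈ F, coord e l f ∉ scaledDualBall (A l) (a l) := by
  classical
  obtain ⟨g₀, hg₀, -⟩ := hf
  choose g hg hmin using fun l => exists_minimal_norm_comp_eq (A l) (g₀ l)
  have hF : ∃ F : Finset Λ, 1 - c < ∑ l ∈ F, ‖g l‖ ^ q := by
    by_contra! h
    exact hf' ⟨g, fun l => by rw [hg, hg₀], h⟩
  obtain ⟨F, hF⟩ := hF
  have hq0 : q ≠ 0 := (zero_lt_one.trans_le hq).ne'
  set S := ∑ l ∈ F, ‖g l‖ ^ q
  have hS : 0 < S := by linarith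
  have hr0 : 0 < (1 - c) / S := by
    have : 0 < 1 - c := by linarith
    positivity
  have hθ1 : ((1 - c) / S) ^ q⁻¹ < 1 :=
    Real.rpow_lt_one hr0.le ((div_lt_one hS).2 hF) (by positivity)
  have hθ0 : 0 < ((1 - c) / S) ^ q⁻¹ := by positivity
  -- One common factor below 1 makes the sum exactly 1 - c and each bound strictly smaller than the
  -- minimal norm `‖g l‖`. Coordinates of norm 0 are dropped to keep the bounds positive.
  refine ⟨F.filter (fun l => 0 < ‖g l‖), fun l => ((1 - c) / S) ^ q⁻¹ * ‖g l‖, ?_, ?_, ?_⟩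
  · intro l hl
    have := (Finset.mem_filter.1 hl).2
    positivity
  · rw [Finset.sum_filter_of_ne]
    · simp_rw [Real.mul_rpow hθ0.le (norm_nonneg _), ← Real.rpow_mul hr0.le, inv_mul_cancel₀ hq0,
        Real.rpow_one, ← Finset.mul_sum]
      exact div_mul_cancel₀ _ hS.ne'
    · intro l _ hne
      refine lt_of_le_of_ne (norm_nonneg _) fun h => hne ?_
      simp only [← h, mul_zero, Real.zero_rpow hq0]
  · rintro l hl ⟨g', hg', heq⟩
    have hpos := (Finset.mem_filter.1 hl).2
    rw [hg₀] at heq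
    have h1 := hmin l g' (StrongDual.toWeakDual.injective heq).symm
    have : ((1 - c) / S) ^ q⁻¹ * ‖g l‖ < 1 * ‖g l‖ := by gcongr
    linarith

/-- The bounds `a` already use mass 1 - c out of a total of at most 1, so `n` has at most c to spend
in excess of `a`. -/
theorem sum_rpow_le_add [DecidableEq Λ] {c : ℝ} {F : Finset Λ} {a n : Λ → ℝ} (hq : 0 ≤ q)
    (ha : ∀ l ∈ F, 0 < a l)
    (hsum : ∑ l ∈ F, a l ^ q = 1 - c) (hn : ∀ l ∈ F, a l ≤ n l)
    (hn1 : ∀ G : Finset Λ, ∑ l ∈ G, n l ^ q ≤ 1) (O : Finset Λ) :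
    ∑ l ∈ O, n l ^ q ≤ c + ∑ l ∈ F ∩ O, a l ^ q := by
  have h1 := hn1 (O ∪ F)
  rw [← Finset.union_sdiff_self_eq_union, Finset.sum_union Finset.disjoint_sdiff] at h1
  have h2 : ∑ l ∈ F \ O, a l ^ q ≤ ∑ l ∈ F \ O, n l ^ q :=
    Finset.sum_le_sum fun l hl => Real.rpow_le_rpow (ha l (Finset.sdiff_subset hl)).le
      (hn l (Finset.sdiff_subset hl)) hq
  have h3 := Finset.sum_inter_add_sum_sdiff F O (fun l => a l ^ q)
  linarith

/-- Where n ≥ 2a the excess n^q - a^q is at least a^q, since 2^q ≥ 2, and the total excess is at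
most c. -/
theorem sum_rpow_filter_le [DecidableEq Λ] {c : ℝ} {F : Finset Λ} {a n : Λ → ℝ} (hq : 1 ≤ q)
    (ha : ∀ l ∈ F, 0 < a l)
    (hsum : ∑ l ∈ F, a l ^ q = 1 - c) (hn : ∀ l ∈ F, a l ≤ n l)
    (hn1 : ∀ G : Finset Λ, ∑ l ∈ G, n l ^ q ≤ 1) {G : Finset Λ} (hGF : G ⊆ F)
    (hG : ∀ l ∈ G, 2 * a l ≤ n l) : ∑ l ∈ G, a l ^ q ≤ c := by
  have h1 := sum_rpow_le_add (by linarith) ha hsum hn hn1 G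
  rw [Finset.inter_eq_right.2 hGF] at h1
  have h2 : ∑ l ∈ G, 2 * a l ^ q ≤ ∑ l ∈ G, n l ^ q := by
    refine Finset.sum_le_sum fun l hl => ?_
    have hal := (ha l (hGF hl)).le
    calc 2 * a l ^ q ≤ 2 ^ q * a l ^ q := by
          gcongr
          simpa using Real.rpow_le_rpow_of_exponent_le (x := 2) (by norm_num) hq
      _ = (2 * a l) ^ q := (Real.mul_rpow (by norm_num) hal).symm
      _ ≤ n l ^ q := Real.rpow_le_rpow (by positivity) (hG l hl) (by linarith)
  rw [← Finset.mul_sum] at h2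
  linarith

theorem sum_union_le [DecidableEq Λ] {s t : Finset Λ} {w : Λ → ℝ} (h : ∀ l ∈ s ∩ t, 0 ≤ w l) :
    ∑ l ∈ s ∪ t, w l ≤ ∑ l ∈ s, w l + ∑ l ∈ t, w l := by
  rw [← Finset.sum_union_inter]
  exact le_add_of_nonneg_right (Finset.sum_nonneg h)

/-- Near a point outside `sumSet e A q (1 - c)`, boundedly many `ω^ζ`-fold derivations of
`sumSet e A q 1` exhaust the set. -/
theorem iterDeriv_sumSet_inter_eq_empty (hq : 1 ≤ q) (he : UpperEstimate e q) {R : ℝ} (hR0 : 0 ≤ R)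
    (hR : ∀ l, ‖A l‖ ≤ R) {ε c : ℝ} (hε : 0 < ε) (hc : 0 < c)
    (hcε : (2 * R) ^ q * (8 * c) ≤ (ε / 2) ^ q / 2) {ζ : Ordinal.{u}} {m : ℕ}
    (hm : ∀ l, iterDeriv (ε / 8) (dualBallImage (A l)) (ω ^ ζ * m) = ∅)
    {F : Finset Λ} {a : Λ → ℝ} (ha : ∀ l ∈ F, 0 < a l) (hsum : ∑ l ∈ F, a l ^ q = 1 - c)
    {M : ℕ} (hM : m < M * c) :
    iterDeriv ε (sumSet e A q 1 ∩ {h | ∀ l ∈ F, coord e l h ∉ scaledDualBall (A l) (a l)})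
      (ω ^ ζ * M) = ∅ := by
  classical
  have hq0 : 0 ≤ q := by linarith
  set V := {h : WeakDual 𝕜 E | ∀ l ∈ F, coord e l h ∉ scaledDualBall (A l) (a l)} with hV
  -- Balls of radius 2a_l are used because a coordinate outside such a ball carries excess mass, and
  -- the weight of those coordinates is at most c. Rescaling the scale ε/8 of `hm` by 2a_l gives δ_l
  -- = a_l ε/4.
  set δ : Λ → ℝ := fun l => 2 * a l * (ε / 8) with hδ
  set S : ∀ l, ℕ → Set (WeakDual 𝕜 (X l)) := fun l j => iterDeriv (δ l) (scaledDualBall (A l) (2 * a l)) (ω ^ ζ * j)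
    with hSdef
  have hSanti : ∀ l, Antitone (S l) := fun l i j hij =>
    iterDeriv_antitone _ _ (by gcongr)
  have hScl : ∀ l j, IsClosed (S l j) := fun l j =>
    isClosed_iterDeriv _ (isClosed_scaledDualBall _ _) _
  have hSm : ∀ l ∈ F, S l m = ∅ := fun l hl =>
    iterDeriv_scaledDualBall_eq_empty (by positivity) (by linarith [ha l hl]) (hm l)
  -- The number of ω^ζ-blocks after which the l-th coordinate is gone; it is 0 when the coordinate
  -- lies outside the ball of radius 2a_l.
  set k : Λ → WeakDual 𝕜 E → ℕ := fun l h => sInf {j | coord e l h ∉ S l j} with hk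
  have hkm : ∀ l ∈ F, ∀ h, m ∈ {j | coord e l h ∉ S l j} := fun l hl h => by
    change _ ∉ S l m
    rw [hSm l hl]
    exact Set.notMem_empty _
  have hk1 : ∀ l ∈ F, ∀ h, coord e l h ∉ S l (k l h) := fun l hl h =>
    Nat.sInf_mem (s := {j | coord e l h ∉ S l j}) ⟨m, hkm l hl h⟩
  have hk2 : ∀ l ∈ F, ∀ h, k l h ≤ m := fun l hl h => Nat.sInf_le (hkm l hl h)
  have hk3 : ∀ l h j, coord e l h ∉ S l j → k l h ≤ j := fun l h j hj => Nat.sInf_le hj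
  -- The potential is at most m, and at least jc on whatever survives j blocks; since m < Mc,
  -- nothing survives M blocks.
  set Φ : WeakDual 𝕜 E → ℝ := fun h => ∑ l ∈ F, a l ^ q * k l h with hΦ
  have hapos : ∀ l ∈ F, 0 ≤ a l ^ q := fun l hl => Real.rpow_nonneg (ha l hl).le _
  have hΦm : ∀ h, Φ h ≤ m := by
    intro h
    calc Φ h ≤ ∑ l ∈ F, a l ^ q * m := Finset.sum_le_sum fun l hl => by
          have := hk2 l hl h
          have := hapos l hl
          gcongr
      _ = (1 - c) * m := by rw [← Finset.sum_mul, hsum]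
      _ ≤ 1 * m := by gcongr; linarith
      _ = m := one_mul _
  have hrep : ∀ h ∈ sumSet e A q 1 ∩ V, ∃ g : ∀ l, StrongDual 𝕜 (Y l),
      (∀ l, coord e l h = StrongDual.toWeakDual ((g l).comp (A l))) ∧
      (∀ F : Finset Λ, ∑ l ∈ F, ‖g l‖ ^ q ≤ 1) ∧ ∀ l ∈ F, a l ≤ ‖g l‖ := by
    rintro h ⟨⟨g, hg, hg1⟩, hhV⟩
    refine ⟨g, hg, hg1, fun l hl => ?_⟩
    by_contra! hlt
    exact hhV l hl ⟨g l, hlt.le, hg l⟩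
  have main : ∀ j : ℕ, ∀ h ∈ iterDeriv ε (sumSet e A q 1 ∩ V) (ω ^ ζ * j), j * c ≤ Φ h := by
    intro j
    induction j with
    | zero =>
      intro h _
      simp only [Nat.cast_zero, zero_mul]
      exact Finset.sum_nonneg fun l hl => mul_nonneg (hapos l hl) (Nat.cast_nonneg _)
    | succ j ih =>
      intro h₀ hh₀
      by_contra! hlt
      rw [iterDeriv_mul_natCast_add_one] at hh₀
      set L := iterDeriv ε (sumSet e A q 1 ∩ V) (ω ^ ζ * j)
      -- On this neighbourhood of `h₀` no count exceeds its value at `h₀`.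
      set U : Set (WeakDual 𝕜 E) := ⋂ l ∈ F, coord e l ⁻¹' (S l (k l h₀))ᶜ with hU
      have hUo : IsOpen U := isOpen_biInter_finset fun l _ =>
        (hScl l _).isOpen_compl.preimage (continuous_coord e l)
      have hUmem : ∀ h ∈ U, ∀ l ∈ F, coord e l h ∉ S l (k l h₀) := fun h hh l hl => by
        simpa using Set.mem_iInter₂.1 hh l hl
      have hh₀U : h₀ ∈ U := Set.mem_iInter₂.2 fun l hl => hk1 l hl h₀
      have hmem := iterDeriv_inter_subset ε L hUo (ω ^ ζ) ⟨hh₀, hh₀U⟩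
      -- The potential is at least jc on `L` and below (j+1)c at `h₀`, so counts drop only on
      -- coordinates of total weight at most c.
      have hGsum : ∀ h ∈ L ∩ U, ∑ l ∈ F with k l h < k l h₀, a l ^ q ≤ c := by
        intro h hh
        have h1 : ∑ l ∈ F with k l h < k l h₀, a l ^ q ≤ Φ h₀ - Φ h := by
          rw [hΦ, ← Finset.sum_sub_distrib, Finset.sum_filter]
          refine Finset.sum_le_sum fun l hl => ?_
          have hp := hapos l hl
          have hkk := hk3 l h _ (hUmem h hh.2 l hl)
          split_ifs with hlt'
          · have : (k l h : ℝ) + 1 ≤ k l h₀ := by exact_mod_cast hlt'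
            nlinarith
          · have : (k l h : ℝ) ≤ k l h₀ := by exact_mod_cast hkk
            nlinarith
        have h2 := ih h hh.1
        push_cast at hlt
        linarith
      -- Let k > 0 be the count at `h₀`. On `U` the coordinate avoids `S l k`, which is the ω^ζ-th
      -- derived set of `S l (k - 1)`. The finite product lemma therefore empties `L ∩ U` within one
      -- block, contradicting the survival of `h₀`.
      have hempty := iterDeriv_omega0_opow_eq_empty (F.filter fun l => 0 < k l h₀)
        (π := fun l => coord e l) (fun l => continuous_coord e l)
        (S := fun l => S l (k l h₀ - 1)) (fun l => hScl l _) (δ := δ)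
        (fun l hl => by
          have := ha l (Finset.mem_filter.1 hl).1
          positivity) hε.le (ζ := ζ) (L := L ∩ U) ?_ ?_
      · rw [hempty] at hmem
        exact hmem
      · intro h hh l hl
        obtain ⟨hlF, hl0⟩ := Finset.mem_filter.1 hl
        have := hUmem h hh.2 l hlF
        rw [← Nat.sub_add_cancel hl0] at this
        simp only [hSdef, Nat.succ_eq_add_one, zero_add] at this ⊢
        rwa [iterDeriv_mul_natCast_add_one] at this
      · intro h hh h' hh' hclose
        obtain ⟨g, hg, hg1, hga⟩ := hrep h (iterDeriv_subset _ _ _ hh.1)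
        obtain ⟨g', hg', hg1', hga'⟩ := hrep h' (iterDeriv_subset _ _ _ hh'.1)
        refine he _ _ (by positivity) fun G => ?_
        set good : Λ → Prop := fun l => l ∈ F ∧ 0 < k l h₀ ∧ coord e l h ∈ S l (k l h₀ - 1) ∧
          coord e l h' ∈ S l (k l h₀ - 1)
        rw [← Finset.sum_filter_add_sum_filter_not G good]
        have hgood : ∑ l ∈ G with good l,
            ‖WeakDual.toStrongDual (coord e l (h - h'))‖ ^ q ≤ (ε / 2) ^ q / 2 := by
          calc _ ≤ ∑ l ∈ G with good l, (δ l) ^ q := by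
                refine Finset.sum_le_sum fun l hl => ?_
                obtain ⟨-, hlF, hl0, h1, h2⟩ := Finset.mem_filter.1 hl
                exact Real.rpow_le_rpow (norm_nonneg _)
                  (hclose l (Finset.mem_filter.2 ⟨hlF, hl0⟩) h1 h2) hq0
            _ ≤ ∑ l ∈ F, (δ l) ^ q := by
                refine Finset.sum_le_sum_of_subset_of_nonneg
                  (fun l hl => (Finset.mem_filter.1 hl).2.1) fun l hl _ => ?_
                have := ha l hl
                positivity
            _ = ∑ l ∈ F, a l ^ q * (ε / 4) ^ q := by
                refine Finset.sum_congr rfl fun l hl => ?_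
                rw [← Real.mul_rpow (ha l hl).le (by positivity)]
                congr 1
                simp only [hδ]
                ring
            _ = (1 - c) * (ε / 4) ^ q := by rw [← Finset.sum_mul, hsum]
            _ ≤ 1 * (ε / 4) ^ q := by gcongr; linarith
            _ = (ε / 2) ^ q / 2 ^ q := by
                rw [one_mul, ← Real.div_rpow (by positivity) (by norm_num)]
                congr 1
                ring
            _ ≤ (ε / 2) ^ q / 2 := by
                gcongr
                simpa using Real.rpow_le_rpow_of_exponent_le (x := 2) (by norm_num) hq
        set O := G.filter fun l => ¬ good l with hO
        have hzero : ∑ l ∈ F with k l h₀ = 0, a l ^ q ≤ c := by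
          refine sum_rpow_filter_le hq ha hsum hga hg1 (Finset.filter_subset _ _) fun l hl => ?_
          obtain ⟨hlF, hl0⟩ := Finset.mem_filter.1 hl
          by_contra! hlt'
          have := hUmem h hh.2 l hlF
          rw [hl0] at this
          simp only [hSdef, Nat.cast_zero, mul_zero, iterDeriv_zero] at this
          exact this ⟨g l, hlt'.le, hg l⟩
        -- Three exceptional families, each of weight at most c: count 0 at `h₀`, count dropped at
        -- `h`, count dropped at `h'`.
        have hFO : ∑ l ∈ F ∩ O, a l ^ q ≤ 3 * c := by
          have hsub : F ∩ O ⊆ (F.filter fun l => k l h₀ = 0) ∪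
              ((F.filter fun l => k l h < k l h₀) ∪ (F.filter fun l => k l h' < k l h₀)) := by
            intro l hl
            obtain ⟨hlF, hlO⟩ := Finset.mem_inter.1 hl
            have hng := (Finset.mem_filter.1 hlO).2
            simp only [Finset.mem_union, Finset.mem_filter, hlF, true_and]
            by_contra! hcon
            refine hng ⟨hlF, Nat.pos_of_ne_zero hcon.1, ?_, ?_⟩
            · by_contra hn
              have := hk3 l h _ hn
              omega
            · by_contra hn
              have := hk3 l h' _ hn
              omega
          have hnn : ∀ l ∈ F, 0 ≤ a l ^ q := hapos
          calc ∑ l ∈ F ∩ O, a l ^ q ≤ ∑ l ∈ (F.filter fun l => k l h₀ = 0) ∪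
              ((F.filter fun l => k l h < k l h₀) ∪ (F.filter fun l => k l h' < k l h₀)), a l ^ q :=
                Finset.sum_le_sum_of_subset_of_nonneg hsub fun l hl _ => hnn l (by
                  simp only [Finset.mem_union, Finset.mem_filter] at hl
                  tauto)
            _ ≤ ∑ l ∈ F with k l h₀ = 0, a l ^ q + ∑ l ∈ (F.filter fun l => k l h < k l h₀) ∪
                (F.filter fun l => k l h' < k l h₀), a l ^ q :=
                sum_union_le fun l hl => hnn l (by
                  simp only [Finset.mem_union, Finset.mem_inter, Finset.mem_filter] at hl
                  tauto)
            _ ≤ ∑ l ∈ F with k l h₀ = 0, a l ^ q + (∑ l ∈ F with k l h < k l h₀, a l ^ q +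
                ∑ l ∈ F with k l h' < k l h₀, a l ^ q) := by
                gcongr
                exact sum_union_le fun l hl => hnn l (by
                  simp only [Finset.mem_inter, Finset.mem_filter] at hl
                  tauto)
            _ ≤ 3 * c := by linarith [hGsum h hh, hGsum h' hh']
        -- Off the good coordinates each of the two functionals has mass at most c + 3c, whence the
        -- 8c in `hcε`.
        have hbad : ∑ l ∈ O, ‖WeakDual.toStrongDual (coord e l (h - h'))‖ ^ q ≤
            (ε / 2) ^ q / 2 := by
          calc _ ≤ ∑ l ∈ O, (2 * R) ^ q * (‖g l‖ ^ q + ‖g' l‖ ^ q) :=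
                Finset.sum_le_sum fun l _ => norm_coord_sub_rpow_le hR hq0 (hg l) (hg' l)
            _ = (2 * R) ^ q * (∑ l ∈ O, ‖g l‖ ^ q + ∑ l ∈ O, ‖g' l‖ ^ q) := by
                rw [← Finset.mul_sum, Finset.sum_add_distrib]
            _ ≤ (2 * R) ^ q * (8 * c) := by
                gcongr
                linarith [sum_rpow_le_add hq0 ha hsum hga hg1 O,
                  sum_rpow_le_add hq0 ha hsum hga' hg1' O]
            _ ≤ _ := hcε
        linarith
  refine Set.eq_empty_of_forall_notMem fun h hh => ?_
  linarith [main M h hh, hΦm h]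

/-- The witnesses from `exists_lower_bounds` define a weak*-open set, and derivations are local: a
point outside the smaller sum cannot survive M blocks. -/
theorem iterDeriv_sumSet_subset (hq : 1 ≤ q) (he : UpperEstimate e q) {R : ℝ} (hR0 : 0 ≤ R)
    (hR : ∀ l, ‖A l‖ ≤ R) {ε c : ℝ} (hε : 0 < ε) (hc : 0 < c) (hc1 : c < 1)
    (hcε : (2 * R) ^ q * (8 * c) ≤ (ε / 2) ^ q / 2) {ζ : Ordinal.{u}} {m : ℕ}
    (hm : ∀ l, iterDeriv (ε / 8) (dualBallImage (A l)) (ω ^ ζ * m) = ∅)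
    {M : ℕ} (hM : m < M * c) :
    iterDeriv ε (sumSet e A q 1) (ω ^ ζ * M) ⊆ sumSet e A q (1 - c) := by
  intro f hf
  by_contra hf'
  obtain ⟨F, a, ha, hsum, hV⟩ := exists_lower_bounds hq hc1 (iterDeriv_subset _ _ _ hf) hf'
  have hopen : IsOpen {h : WeakDual 𝕜 E | ∀ l ∈ F, coord e l h ∉ scaledDualBall (A l) (a l)} := by
    have : {h : WeakDual 𝕜 E | ∀ l ∈ F, coord e l h ∉ scaledDualBall (A l) (a l)} =
        ⋂ l ∈ F, coord e l ⁻¹' (scaledDualBall (A l) (a l))ᶜ := by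
      ext h
      simp
    rw [this]
    exact isOpen_biInter_finset fun l _ =>
      (isClosed_scaledDualBall _ _).isOpen_compl.preimage (continuous_coord e l)
  have := iterDeriv_inter_subset ε _ hopen _ ⟨hf, hV⟩
  rw [iterDeriv_sumSet_inter_eq_empty hq he hR0 hR hε hc hcε hm ha hsum hM] at this
  exact this

theorem smul_mem_sumSet {C t : ℝ} (ht : 0 ≤ t) {f : WeakDual 𝕜 E}
    (hf : f ∈ sumSet e A q C) : ((t : ℝ) : 𝕜) • f ∈ sumSet e A q (t ^ q * C) := by
  obtain ⟨g, hg, hg1⟩ := hf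
  refine ⟨fun l => ((t : ℝ) : 𝕜) • g l, fun l => ?_, fun F => ?_⟩
  · rw [coord_smul, hg]
    rfl
  · simp_rw [norm_smul, RCLike.norm_ofReal, abs_of_nonneg ht, Real.mul_rpow ht (norm_nonneg _),
      ← Finset.mul_sum]
    gcongr
    exact hg1 F

/-- If boundedly many `ω^ζ`-fold `ε/8`-derivations exhaust all the sets `A_l* B_{Y_l*}`, then
finitely many `ω^ζ`-fold `ε`-derivations exhaust their `ℓ_q`-sum. -/
theorem exists_iterDeriv_sumSet_eq_empty (hq : 1 ≤ q) (he : UpperEstimate e q) {R : ℝ}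
    (hR0 : 0 ≤ R) (hR : ∀ l, ‖A l‖ ≤ R) {ε : ℝ} (hε : 0 < ε) {ζ : Ordinal.{u}} {m : ℕ}
    (hm : ∀ l, iterDeriv (ε / 8) (dualBallImage (A l)) (ω ^ ζ * m) = ∅) :
    ∃ M : ℕ, iterDeriv ε (sumSet e A q 1) (ω ^ ζ * M) = ∅ := by
  have hq0 : q ≠ 0 := (zero_lt_one.trans_le hq).ne'
  obtain ⟨c, hc, hc1, hcε⟩ : ∃ c : ℝ, 0 < c ∧ c < 1 ∧ (2 * R) ^ q * (8 * c) ≤ (ε / 2) ^ q / 2 := by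
    have hB : 0 < (ε / 2) ^ q / 2 := by positivity
    have hA : 0 ≤ (2 * R) ^ q := by positivity
    refine ⟨min (1 / 2) ((ε / 2) ^ q / 2 / (8 * ((2 * R) ^ q + 1))), by positivity,
      (min_le_left _ _).trans_lt (by norm_num), ?_⟩
    calc (2 * R) ^ q * (8 * min (1 / 2) ((ε / 2) ^ q / 2 / (8 * ((2 * R) ^ q + 1))))
        ≤ ((2 * R) ^ q + 1) * (8 * ((ε / 2) ^ q / 2 / (8 * ((2 * R) ^ q + 1)))) := by
          gcongr
          · linarith
          · exact min_le_right _ _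
      _ = (ε / 2) ^ q / 2 := by field_simp
  obtain ⟨M, hM⟩ := exists_nat_gt ((m : ℝ) / c)
  rw [div_lt_iff₀ hc] at hM
  have hstep := iterDeriv_sumSet_subset hq he hR0 hR hε hc hc1 hcε hm hM
  have h1c : 0 < 1 - c := by linarith
  -- Dividing by s, where s^q = (1 - c)^j, returns to the unit sum. As s ≤ 1, distances do not
  -- decrease, so survivors of ε-derivations are carried to survivors of ε-derivations and `hstep`
  -- applies again.
  have hiter : ∀ j : ℕ, iterDeriv ε (sumSet e A q 1) (ω ^ ζ * ((M * j : ℕ) : Ordinal.{u})) ⊆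
      sumSet e A q ((1 - c) ^ j) := by
    intro j
    induction j with
    | zero => simp
    | succ j ih =>
      rw [Nat.mul_succ, Nat.cast_add, mul_add, iterDeriv_add]
      set s : ℝ := ((1 - c) ^ j) ^ q⁻¹ with hs
      have hs0 : 0 < s := by positivity
      have hs1 : s ≤ 1 := Real.rpow_le_one (by positivity) (pow_le_one₀ h1c.le (by linarith))
        (by positivity)
      have hsq : s ^ q = (1 - c) ^ j := by
        rw [hs, ← Real.rpow_mul (by positivity), inv_mul_cancel₀ hq0, Real.rpow_one]
      have hsn : ‖((s⁻¹ : ℝ) : 𝕜)‖ = s⁻¹ := by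
        rw [RCLike.norm_ofReal, abs_of_pos (by positivity)]
      refine (iterDeriv_mono le_rfl ih _).trans fun f hf => ?_
      have h2 := map_mem_iterDeriv (L := sumSet e A q 1) (T := fun f => ((s⁻¹ : ℝ) : 𝕜) • f)
        (inv_pos.2 hs0) hε.le (continuous_const_smul _) ?_ ?_ _ hf
      · have h3 := hstep (iterDeriv_mono (ε' := ε) ?_ subset_rfl _ h2)
        · have h4 := smul_mem_sumSet hs0.le h3
          rw [smul_smul, ← RCLike.ofReal_mul, mul_inv_cancel₀ hs0.ne', RCLike.ofReal_one, one_smul,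
            hsq, ← pow_succ] at h4
          exact h4
        · exact le_mul_of_one_le_left hε.le ((one_le_inv₀ hs0).2 hs1)
      · intro f hf
        have := smul_mem_sumSet (inv_pos.2 hs0).le hf
        rwa [Real.inv_rpow hs0.le, hsq, inv_mul_cancel₀ (by positivity)] at this
      · intro f _ g _
        rw [← smul_sub, map_smul, norm_smul, hsn]
  obtain ⟨j, hj⟩ : ∃ j : ℕ, (2 * R) ^ q * (2 * (1 - c) ^ j) ≤ ε ^ q := by
    have : Tendsto (fun j : ℕ => (2 * R) ^ q * (2 * (1 - c) ^ j)) atTop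
        (𝓝 ((2 * R) ^ q * (2 * 0))) :=
      ((tendsto_pow_atTop_nhds_zero_of_lt_one h1c.le (by linarith)).const_mul _).const_mul _
    rw [mul_zero, mul_zero] at this
    exact (this.eventually_le_const (by positivity)).exists
  -- For this j the shrunken sum has norm diameter at most ε, so one more derivation empties it; a
  -- further block provides it because ω^ζ ≥ 1.
  refine ⟨M * j + 1, Set.eq_empty_of_forall_notMem fun f hf => ?_⟩
  rw [Nat.cast_succ, mul_add_one] at hf
  have hf1 := iterDeriv_antitone _ _
    (add_le_add_right (Order.one_le_iff_pos.2 (omega_opow_pos ζ)) _) hf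
  rw [iterDeriv_add_one, mem_deriv_iff hε.le] at hf1
  obtain ⟨g, hg, g', hg', hlt⟩ := hf1.2 Set.univ univ_mem
  obtain ⟨u, hu, hu1⟩ := hiter j hg.2
  obtain ⟨u', hu', hu1'⟩ := hiter j hg'.2
  refine absurd hlt (not_lt.2 (he _ _ hε.le fun F => ?_))
  calc _ ≤ ∑ l ∈ F, (2 * R) ^ q * (‖u l‖ ^ q + ‖u' l‖ ^ q) :=
        Finset.sum_le_sum fun l _ => norm_coord_sub_rpow_le hR (by linarith) (hu l) (hu' l)
    _ = (2 * R) ^ q * (∑ l ∈ F, ‖u l‖ ^ q + ∑ l ∈ F, ‖u' l‖ ^ q) := by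
        rw [← Finset.mul_sum, Finset.sum_add_distrib]
    _ ≤ (2 * R) ^ q * (2 * (1 - c) ^ j) := by
        gcongr
        linarith [hu1 F, hu1' F]
    _ ≤ ε ^ q := hj

end SumSet

end Szlenk
namespace Szlenk

/-! ### Direct sums -/

section DualNorm

variable {𝕜 : Type*} [RCLike 𝕜] {X : Type*} [NormedAddCommGroup X] [NormedSpace 𝕜 X]

theorem exists_lt_re_apply_of_lt_norm (f : StrongDual 𝕜 X) {t : ℝ} (ht : t < ‖f‖) :
    ∃ x : X, ‖x‖ ≤ 1 ∧ t < RCLike.re (f x) := by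
  obtain ⟨x, hx, hlt⟩ := f.exists_lt_apply_of_lt_opNorm ht
  obtain ⟨c, hc, hcx⟩ := RCLike.exists_norm_eq_mul_self (f x)
  refine ⟨c • x, by rw [norm_smul, hc, one_mul]; exact hx.le, ?_⟩
  rw [map_smul, smul_eq_mul, ← hcx, RCLike.ofReal_re]
  exact hlt

end DualNorm

section Embedding

variable (𝕜 : Type*) [RCLike 𝕜] {ι : Type u} (X : ι → Type v) [∀ i, NormedAddCommGroup (X i)]
  [∀ i, NormedSpace 𝕜 (X i)] (p : Exponent)

open Classical in
/-- The embedding of a summand. -/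
noncomputable def incl (i : ι) : X i →L[𝕜] directSum 𝕜 X p :=
  (lp.singleContinuousLinearMap 𝕜 X p.norm i).codRestrict (directSum 𝕜 X p) fun x _ => by
    refine tendsto_const_nhds.congr' ?_
    filter_upwards [(Set.finite_singleton i).compl_mem_cofinite] with j hj
    have hj' : j ≠ i := hj
    simp [hj']

/-- The coordinate projections. -/
noncomputable def proj (i : ι) : directSum 𝕜 X p →L[𝕜] X i :=
  (lp.evalCLM 𝕜 X p.norm i).comp (directSum 𝕜 X p).subtypeL

variable {𝕜 X p}

theorem Exponent.norm_pos (p : Exponent) : 0 < p.norm := zero_lt_one.trans_le Fact.out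

open Classical in
theorem coe_incl (i : ι) (x : X i) : (incl 𝕜 X p i x).1 = lp.single p.norm i x := rfl

theorem norm_incl (i : ι) (x : X i) : ‖incl 𝕜 X p i x‖ = ‖x‖ := by
  classical
  exact lp.norm_single p.norm_pos i x

theorem proj_apply (i : ι) (x : directSum 𝕜 X p) : proj 𝕜 X p i x = x.1 i := rfl

theorem norm_proj_apply_le (i : ι) (x : directSum 𝕜 X p) : ‖proj 𝕜 X p i x‖ ≤ ‖x‖ :=
  lp.norm_apply_le_norm p.norm_pos.ne' x.1 i

theorem proj_incl (i : ι) (x : X i) : proj 𝕜 X p i (incl 𝕜 X p i x) = x := by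
  classical
  rw [proj_apply, coe_incl, lp.single_apply_self]

open Classical in
theorem coe_sum_incl (F : Finset ι) (x : ∀ i, X i) :
    (∑ i ∈ F, incl 𝕜 X p i (x i)).1 = ∑ i ∈ F, lp.single p.norm i (x i) := by
  rw [← Submodule.subtype_apply, map_sum]
  rfl

open Classical in
theorem coe_sum_incl_apply (F : Finset ι) (x : ∀ i, X i) (j : ι) :
    (∑ i ∈ F, incl 𝕜 X p i (x i)).1 j = if j ∈ F then x j else 0 := by
  rw [coe_sum_incl, lp.coeFn_sum, Finset.sum_apply]
  simp only [lp.coeFn_single, Finset.sum_pi_single]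

theorem norm_le_of_norm_eq_top (hp : p.norm = ∞) {x : directSum 𝕜 X p} {C : ℝ} (hC : 0 ≤ C)
    (h : ∀ i, ‖x.1 i‖ ≤ C) : ‖x‖ ≤ C := by
  change ‖x.1‖ ≤ C
  generalize x.1 = y at h ⊢
  generalize p.norm = q at y hp h
  subst hp
  exact lp.norm_le_of_forall_le hC h

/-- Here p < ∞ matters: finitely supported families are dense, so a functional on the direct sum is
determined by its coordinates. -/
theorem hasSum_incl {X : ι → Type u} [∀ i, NormedAddCommGroup (X i)] [∀ i, NormedSpace 𝕜 (X i)]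
    (hp : p.1 < ∞) (x : directSum 𝕜 X p) :
    HasSum (fun i => incl 𝕜 X p i (x.1 i)) x := by
  classical
  by_cases h0 : p.1 = 0
  · have hpt : p.norm = ∞ := by simp [Exponent.norm, h0]
    rw [HasSum, SummationFilter.unconditional_filter, Metric.tendsto_atTop]
    intro η hη
    have hfin : {i | ¬ ‖x.1 i‖ < η / 2}.Finite :=
      (tendsto_norm_zero hp x).eventually_lt_const (half_pos hη)
    refine ⟨hfin.toFinset, fun F hF => lt_of_le_of_lt ?_ (half_lt_self hη)⟩
    rw [dist_eq_norm]
    refine norm_le_of_norm_eq_top hpt (half_pos hη).le fun j => ?_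
    change ‖(∑ i ∈ F, incl 𝕜 X p i (x.1 i)).1 j - x.1 j‖ ≤ _
    rw [coe_sum_incl_apply]
    split_ifs with hj
    · simpa using (half_pos hη).le
    · rw [zero_sub, norm_neg]
      by_contra! hlt
      exact hj (hF (hfin.mem_toFinset.2 (not_lt.2 hlt.le)))
  · have hpt : p.norm ≠ ∞ := by simpa [Exponent.norm, h0] using hp.ne
    have hind : Topology.IsInducing (directSum 𝕜 X p).subtype := Topology.IsInducing.subtypeVal
    rw [← hind.hasSum_iff]
    exact lp.hasSum_single hpt x.1

theorem sum_rpow_le_norm_rpow_of_exponent_le {r : Exponent} (hr : r.norm ≠ ∞)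
    (hpr : p.norm ≤ r.norm) (x : directSum 𝕜 X p) (F : Finset ι) :
    ∑ i ∈ F, ‖x.1 i‖ ^ r.norm.toReal ≤ ‖x‖ ^ r.norm.toReal := by
  have hpt : p.norm ≠ ∞ := ne_top_of_le_ne_top hr hpr
  have hp0 : 0 < p.norm.toReal := ENNReal.toReal_pos p.norm_pos.ne' hpt
  have hle : p.norm.toReal ≤ r.norm.toReal := ENNReal.toReal_mono hr hpr
  calc ∑ i ∈ F, ‖x.1 i‖ ^ r.norm.toReal
      ≤ ∑ i ∈ F, ‖x.1‖ ^ (r.norm.toReal - p.norm.toReal) * ‖x.1 i‖ ^ p.norm.toReal := by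
        refine Finset.sum_le_sum fun i _ => ?_
        calc ‖x.1 i‖ ^ r.norm.toReal
            = ‖x.1 i‖ ^ (r.norm.toReal - p.norm.toReal) * ‖x.1 i‖ ^ p.norm.toReal := by
              rw [← Real.rpow_add_of_nonneg (norm_nonneg _) (sub_nonneg.2 hle) hp0.le,
                sub_add_cancel]
          _ ≤ _ := by
              gcongr
              exact lp.norm_apply_le_norm p.norm_pos.ne' x.1 i
    _ = ‖x.1‖ ^ (r.norm.toReal - p.norm.toReal) * ∑ i ∈ F, ‖x.1 i‖ ^ p.norm.toReal := by
        rw [Finset.mul_sum]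
    _ ≤ ‖x.1‖ ^ (r.norm.toReal - p.norm.toReal) * ‖x.1‖ ^ p.norm.toReal := by
        gcongr
        exact lp.sum_rpow_le_norm_rpow hp0 x.1 F
    _ = ‖x.1‖ ^ r.norm.toReal := by
        rw [← Real.rpow_add_of_nonneg (norm_nonneg _) (sub_nonneg.2 hle) hp0.le, sub_add_cancel]

/-- The exponent conjugate to `r`. -/
noncomputable def Exponent.conj (r : Exponent) : ℝ :=
  if r.norm = ∞ then 1 else r.norm.toReal.conjExponent

theorem Exponent.conj_of_top {r : Exponent} (h : r.norm = ∞) : r.conj = 1 := if_pos h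

theorem Exponent.holderConjugate {r : Exponent} (h : r.norm ≠ ∞) (h1 : 1 < r.norm) :
    r.norm.toReal.HolderConjugate r.conj := by
  rw [Exponent.conj, if_neg h]
  refine Real.HolderConjugate.conjExponent ?_
  rw [← ENNReal.toReal_one]
  exact (ENNReal.toReal_lt_toReal (by simp) h).2 h1

theorem Exponent.one_le_conj {r : Exponent} (h1 : 1 < r.norm) : 1 ≤ r.conj := by
  by_cases h : r.norm = ∞
  · rw [conj_of_top h]
  · exact (Exponent.holderConjugate h h1).symm.lt.le

theorem Admissible.exponent_lt_top {p r : Exponent} (h : Admissible p r) : p.1 < ∞ := by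
  rcases h with h | h <;> tauto

theorem Admissible.one_lt_norm {p r : Exponent} (h : Admissible p r) : 1 < r.norm := by
  rcases h with ⟨h, -⟩ | ⟨h1, h2, h3, -⟩
  · simp [Exponent.norm, h]
  · have h0 : r.1 ≠ 0 := (zero_lt_one.trans_le (h1.trans h2)).ne'
    simpa [Exponent.norm, h0] using h3

theorem Admissible.norm_le_norm {p r : Exponent} (h : Admissible p r) : p.norm ≤ r.norm := by
  rcases h with ⟨hr, -⟩ | ⟨hp, hpr, -, -⟩
  · simp [Exponent.norm, hr]
  · have h0 : p.1 ≠ 0 := (zero_lt_one.trans_le hp).ne'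
    have h0' : r.1 ≠ 0 := (zero_lt_one.trans_le (hp.trans hpr)).ne'
    simpa [Exponent.norm, h0, h0'] using hpr

end Embedding

/-! ### Comparison of D* B with the coordinate sets -/

section DiagOp

variable {𝕜 : Type*} [RCLike 𝕜] {Λ : Type u}
  {X : Λ → Type u} [∀ l, NormedAddCommGroup (X l)] [∀ l, NormedSpace 𝕜 (X l)]
  {Y : Λ → Type v} [∀ l, NormedAddCommGroup (Y l)] [∀ l, NormedSpace 𝕜 (Y l)]
  {p r : Exponent}

/-- Hölder's inequality for r and its conjugate on finite partial sums, together with ‖x‖_r ≤ ‖x‖_p.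
The exponent comes from the target space, because that is where the coordinates of D* g are
controlled. -/
theorem upperEstimate_incl (h : Admissible p r) :
    UpperEstimate (fun l => incl 𝕜 X p l) r.conj := by
  intro f C hC hF
  refine (WeakDual.toStrongDual f).opNorm_le_bound hC fun x => ?_
  have hlim := ((hasSum_incl h.exponent_lt_top x).mapL (WeakDual.toStrongDual f)).norm
  refine le_of_tendsto hlim (Eventually.of_forall fun F => ?_)
  set φ : Λ → ℝ := fun l => ‖WeakDual.toStrongDual (coord (fun l => incl 𝕜 X p l) l f)‖ with hφ
  have hφ0 : ∀ l, 0 ≤ φ l := fun l => norm_nonneg _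
  have h1 : ‖∑ l ∈ F, WeakDual.toStrongDual f (incl 𝕜 X p l (x.1 l))‖ ≤
      ∑ l ∈ F, φ l * ‖x.1 l‖ :=
    norm_sum_le_of_le _ fun l _ =>
      (WeakDual.toStrongDual (coord (fun l => incl 𝕜 X p l) l f)).le_opNorm (x.1 l)
  refine h1.trans ?_
  by_cases hr : r.norm = ∞
  · have h2 := hF F
    rw [Exponent.conj_of_top hr] at h2
    simp only [Real.rpow_one] at h2
    calc ∑ l ∈ F, φ l * ‖x.1 l‖ ≤ ∑ l ∈ F, φ l * ‖x‖ := by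
          refine Finset.sum_le_sum fun l _ => ?_
          gcongr
          exact norm_proj_apply_le l x
      _ = (∑ l ∈ F, φ l) * ‖x‖ := by rw [Finset.sum_mul]
      _ ≤ C * ‖x‖ := by gcongr
  · have hconj := (Exponent.holderConjugate hr h.one_lt_norm).symm
    refine (Real.inner_le_Lp_mul_Lq_of_nonneg F hconj (fun l _ => hφ0 l)
      fun l _ => norm_nonneg _).trans ?_
    have hq := hconj.pos
    have hr0 := hconj.symm.pos
    have e1 : (∑ l ∈ F, φ l ^ r.conj) ^ (1 / r.conj) ≤ C := by
      rw [one_div, Real.rpow_inv_le_iff_of_pos (Finset.sum_nonneg fun l _ =>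
        Real.rpow_nonneg (hφ0 l) _) hC hq]
      exact hF F
    have e2 : (∑ l ∈ F, ‖x.1 l‖ ^ r.norm.toReal) ^ (1 / r.norm.toReal) ≤ ‖x‖ := by
      rw [one_div, Real.rpow_inv_le_iff_of_pos (Finset.sum_nonneg fun l _ =>
        Real.rpow_nonneg (norm_nonneg _) _) (norm_nonneg _) hr0]
      exact sum_rpow_le_norm_rpow_of_exponent_le hr h.norm_le_norm x F
    gcongr

/-- The functional is tested on a finite combination of vectors almost norming its coordinates; the
error η then tends to 0. -/
theorem sum_mul_norm_comp_incl_le {g : StrongDual 𝕜 (directSum 𝕜 Y r)} (hg : ‖g‖ ≤ 1)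
    {c : Λ → ℝ} (hc : ∀ l, 0 ≤ c l) {F : Finset Λ} {B : ℝ}
    (hB : ∀ y : ∀ l, Y l, (∀ l, ‖y l‖ ≤ c l) → ‖∑ l ∈ F, incl 𝕜 Y r l (y l)‖ ≤ B) :
    ∑ l ∈ F, c l * ‖g.comp (incl 𝕜 Y r l)‖ ≤ B := by
  have key : ∀ η > 0, ∑ l ∈ F, c l * (‖g.comp (incl 𝕜 Y r l)‖ - η) ≤ B := by
    intro η hη
    choose y hy hlt using fun l => exists_lt_re_apply_of_lt_norm (g.comp (incl 𝕜 Y r l))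
      (sub_lt_self _ hη)
    have hcn : ∀ l, ‖((c l : ℝ) : 𝕜)‖ = c l := fun l => by
      rw [RCLike.norm_ofReal, abs_of_nonneg (hc l)]
    have h1 := hB (fun l => ((c l : ℝ) : 𝕜) • y l) fun l => by
      rw [norm_smul, hcn]
      exact mul_le_of_le_one_right (hc l) (hy l)
    calc ∑ l ∈ F, c l * (‖g.comp (incl 𝕜 Y r l)‖ - η)
        ≤ ∑ l ∈ F, c l * RCLike.re (g.comp (incl 𝕜 Y r l) (y l)) := by
          refine Finset.sum_le_sum fun l _ => ?_
          exact mul_le_mul_of_nonneg_left (hlt l).le (hc l)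
      _ = RCLike.re (g (∑ l ∈ F, incl 𝕜 Y r l (((c l : ℝ) : 𝕜) • y l))) := by
          simp only [map_sum, map_smul, smul_eq_mul, RCLike.re_ofReal_mul]
          rfl
      _ ≤ ‖g (∑ l ∈ F, incl 𝕜 Y r l (((c l : ℝ) : 𝕜) • y l))‖ := RCLike.re_le_norm _
      _ ≤ 1 * ‖∑ l ∈ F, incl 𝕜 Y r l (((c l : ℝ) : 𝕜) • y l)‖ := g.le_of_opNorm_le hg _
      _ ≤ B := by rwa [one_mul]
  have hlim : Tendsto (fun η : ℝ => ∑ l ∈ F, c l * (‖g.comp (incl 𝕜 Y r l)‖ - η)) (𝓝[>] 0)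
      (𝓝 (∑ l ∈ F, c l * (‖g.comp (incl 𝕜 Y r l)‖ - 0))) := by
    refine Tendsto.mono_left ?_ nhdsWithin_le_nhds
    exact (by fun_prop : Continuous fun η : ℝ =>
      ∑ l ∈ F, c l * (‖g.comp (incl 𝕜 Y r l)‖ - η)).tendsto 0
  simp only [sub_zero] at hlim
  exact le_of_tendsto hlim (eventually_mem_nhdsWithin.mono fun η hη => key η hη)

/-- Only finitely supported vectors are tested, so a singular part of `g`, possible for r = ∞, plays
no role. -/
theorem sum_norm_comp_incl_rpow_le (hr1 : 1 < r.norm) {g : StrongDual 𝕜 (directSum 𝕜 Y r)}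
    (hg : ‖g‖ ≤ 1) (F : Finset Λ) : ∑ l ∈ F, ‖g.comp (incl 𝕜 Y r l)‖ ^ r.conj ≤ 1 := by
  classical
  by_cases hr : r.norm = ∞
  · have := sum_mul_norm_comp_incl_le hg (c := fun _ => 1) (fun _ => zero_le_one) (F := F) (B := 1)
      fun y hy => norm_le_of_norm_eq_top hr zero_le_one fun j => by
        rw [coe_sum_incl_apply]
        split_ifs
        · exact hy j
        · simp
    simpa [Exponent.conj_of_top hr] using this
  · have hconj := Exponent.holderConjugate hr hr1
    have hr0 := hconj.pos
    -- The extremal weights in Hölder's inequality: they turn the previous lemma into S ≤ S^(1/r),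
    -- which is impossible if S > 1.
    set c : Λ → ℝ := fun l => ‖g.comp (incl 𝕜 Y r l)‖ ^ (r.conj - 1) with hc
    have hcr : ∀ l, c l ^ r.norm.toReal = ‖g.comp (incl 𝕜 Y r l)‖ ^ r.conj := fun l => by
      rw [hc, ← Real.rpow_mul (norm_nonneg _)]
      congr 1
      have := hconj.symm.sub_one_mul_conj
      linarith
    have hcm : ∀ l, c l * ‖g.comp (incl 𝕜 Y r l)‖ = ‖g.comp (incl 𝕜 Y r l)‖ ^ r.conj := fun l => by
      have := Real.rpow_add_of_nonneg (norm_nonneg (g.comp (incl 𝕜 Y r l)))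
        (sub_nonneg.2 hconj.symm.lt.le) zero_le_one
      rw [Real.rpow_one, sub_add_cancel] at this
      exact this.symm
    set S := ∑ l ∈ F, ‖g.comp (incl 𝕜 Y r l)‖ ^ r.conj with hS
    have hS0 : 0 ≤ S := Finset.sum_nonneg fun l _ => Real.rpow_nonneg (norm_nonneg _) _
    have := sum_mul_norm_comp_incl_le hg (c := c) (fun l => Real.rpow_nonneg (norm_nonneg _) _)
      (F := F) (B := S ^ r.norm.toReal⁻¹) fun y hy => by
        rw [Real.le_rpow_inv_iff_of_pos (norm_nonneg _) hS0 hr0]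
        change ‖(∑ l ∈ F, incl 𝕜 Y r l (y l)).1‖ ^ _ ≤ _
        rw [coe_sum_incl, lp.norm_sum_single hr0, hS]
        refine Finset.sum_le_sum fun l _ => ?_
        rw [← hcr]
        exact Real.rpow_le_rpow (norm_nonneg _) (hy l) hr0.le
    simp only [hcm] at this
    rw [← hS] at this
    by_contra! hlt
    have h2 : S ^ r.norm.toReal⁻¹ < S ^ (1 : ℝ) :=
      Real.rpow_lt_rpow_of_exponent_lt hlt (inv_lt_one_of_one_lt₀ hconj.lt)
    rw [Real.rpow_one] at h2
    linarith

variable (A : ∀ l, X l →L[𝕜] Y l) (hA : ∃ R, ∀ l, ‖A l‖ ≤ R) (h : Admissible p r)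

theorem diagOp_incl (l : Λ) (x : X l) :
    diagOp A hA h (incl 𝕜 X p l x) = incl 𝕜 Y r l (A l x) := by
  classical
  ext j
  change A j ((incl 𝕜 X p l x).1 j) = (incl 𝕜 Y r l (A l x)).1 j
  rw [coe_incl, coe_incl, lp.coeFn_single, lp.coeFn_single]
  by_cases hj : j = l
  · subst hj
    simp
  · simp [hj]

theorem dualBallImage_diagOp_subset :
    dualBallImage (diagOp A hA h) ⊆ sumSet (fun l => incl 𝕜 X p l) A r.conj 1 := by
  rintro f ⟨g, hg, rfl⟩
  refine ⟨fun l => g.comp (incl 𝕜 Y r l), fun l => ?_,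
    fun F => sum_norm_comp_incl_rpow_le h.one_lt_norm hg F⟩
  refine DFunLike.ext _ _ fun x => ?_
  exact congrArg g (diagOp_incl A hA h l x)

/-- Composition with the l-th projection maps A_l* B into D* B, since projecting commutes with the
diagonal operator. It does not shrink distances, because the isometric inclusion is a right inverse
of the projection. -/
theorem iterDeriv_eq_empty_of_diagOp {ε : ℝ} (hε : 0 ≤ ε) {α : Ordinal.{u}}
    (hα : iterDeriv ε (dualBallImage (diagOp A hA h)) α = ∅) (l : Λ) :
    iterDeriv ε (dualBallImage (A l)) α = ∅ := by
  refine Set.eq_empty_of_forall_notMem fun f hf => ?_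
  have := map_mem_iterDeriv (L := dualBallImage (diagOp A hA h))
    (T := fun f => StrongDual.toWeakDual ((WeakDual.toStrongDual f).comp (proj 𝕜 X p l)))
    zero_lt_one hε (continuous_toWeakDual_comp _) ?_ ?_ α hf
  · rw [one_mul, hα] at this
    exact this
  · rintro f ⟨g, hg, rfl⟩
    refine ⟨g.comp (proj 𝕜 Y r l), ?_, rfl⟩
    refine ContinuousLinearMap.opNorm_le_bound _ zero_le_one fun y => ?_
    exact (g.le_of_opNorm_le hg _).trans (by gcongr; exact norm_proj_apply_le l y)
  · intro f _ g _
    rw [one_mul]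
    refine ContinuousLinearMap.opNorm_le_bound (WeakDual.toStrongDual (f - g))
      (ContinuousLinearMap.opNorm_nonneg _) fun x => ?_
    have := (WeakDual.toStrongDual (StrongDual.toWeakDual
      ((WeakDual.toStrongDual f).comp (proj 𝕜 X p l)) - StrongDual.toWeakDual
      ((WeakDual.toStrongDual g).comp (proj 𝕜 X p l)))).le_opNorm (incl 𝕜 X p l x)
    rw [norm_incl] at this
    convert! this using 2
    change f x - g x = f (proj 𝕜 X p l (incl 𝕜 X p l x)) - g (proj 𝕜 X p l (incl 𝕜 X p l x))
    rw [proj_incl]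

open Ordinal in
theorem exists_iterDeriv_diagOp_eq_empty {ε : ℝ} (hε : 0 < ε) {ζ : Ordinal.{u}} {m : ℕ}
    (hm : ∀ l, iterDeriv (ε / 8) (dualBallImage (A l)) (ω ^ ζ * m) = ∅) :
    ∃ M : ℕ, iterDeriv ε (dualBallImage (diagOp A hA h)) (ω ^ ζ * M) = ∅ := by
  obtain ⟨R, hR⟩ := id hA
  obtain ⟨M, hM⟩ := exists_iterDeriv_sumSet_eq_empty (Exponent.one_le_conj h.one_lt_norm)
    (upperEstimate_incl (𝕜 := 𝕜) (X := X) h) (le_max_right R 0)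
    (fun l => (hR l).trans (le_max_left R 0)) hε hm
  exact ⟨M, Set.subset_eq_empty (iterDeriv_mono le_rfl (dualBallImage_diagOp_subset A hA h) _) hM⟩

end DiagOp

/-! ### Self-similarity and the jump from ω^ξ to ω^(ξ+1) -/

section LowerBound

open Ordinal

variable {𝕜 : Type*} [RCLike 𝕜] {X : Type u} [NormedAddCommGroup X] [NormedSpace 𝕜 X]
  {Y : Type v} [NormedAddCommGroup Y] [NormedSpace 𝕜 Y]

/-- The dual ball contains affine copies of itself, a quarter of its size, placed so that a
prescribed survivor `k` of α derivations lands at f/2. Iterating inside s^(ω^ξ n), each further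
halving of the scale buys ω^ξ more derivations. -/
theorem smul_mem_iterDeriv_dualBallImage {A : X →L[𝕜] Y} {ε : ℝ} (hε : 0 < ε) {ξ : Ordinal.{u}}
    (hξ : Order.IsSuccLimit (ω ^ ξ))
    (hne : ∀ α < ω ^ ξ, (iterDeriv ε (dualBallImage A) α).Nonempty) (n : ℕ) :
    ∀ f ∈ dualBallImage A, (((1 / 2) ^ n : ℝ) : 𝕜) • f ∈
      iterDeriv ((1 / 2) ^ (n + 1) * ε) (dualBallImage A) (ω ^ ξ * n) := by
  induction n with
  | zero => simp
  | succ n ih =>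
    intro f hf
    rw [iterDeriv_mul_natCast_add_one, iterDeriv_limit _ _ hξ]
    simp only [Set.mem_iInter]
    intro α hα
    obtain ⟨k, hk⟩ := hne α hα
    set s : ℝ := (1 / 2) ^ n with hs
    have hs0 : 0 < s := by positivity
    -- The map g ↦ s(f/2 - k/4 + g/4) stays in s · A* B, multiplies distances by s/4 and sends `k`
    -- to (s/2) f.
    have hmem : ∀ g ∈ dualBallImage A, ((s : ℝ) : 𝕜) •
        (((1 / 2 : ℝ) : 𝕜) • f + ((-(1 / 4) : ℝ) : 𝕜) • k + ((1 / 4 : ℝ) : 𝕜) • g) ∈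
        iterDeriv ((1 / 2) ^ (n + 1 + 1) * ε) (dualBallImage A) (ω ^ ξ * n) := by
      intro g hg
      refine iterDeriv_mono ?_ subset_rfl _ (ih _ (smul_add_smul_add_smul_mem_dualBallImage hf
        (iterDeriv_subset _ _ _ hk) hg ?_))
      · gcongr ?_ * ε
        rw [pow_succ _ (n + 1)]
        have : (0 : ℝ) < (1 / 2) ^ (n + 1) := by positivity
        linarith
      · rw [RCLike.norm_ofReal, RCLike.norm_ofReal, RCLike.norm_ofReal]
        norm_num [abs_of_pos]
    have hn1 : ∀ t : ℝ, 0 < t → ‖((t : ℝ) : 𝕜)‖ = t := fun t ht => by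
      rw [RCLike.norm_ofReal, abs_of_pos ht]
    have := map_mem_iterDeriv
      (T := fun g => ((s : ℝ) : 𝕜) •
        (((1 / 2 : ℝ) : 𝕜) • f + ((-(1 / 4) : ℝ) : 𝕜) • k + ((1 / 4 : ℝ) : 𝕜) • g))
      (c := s * (1 / 4)) (by positivity) hε.le
      ((continuous_const_smul _).comp (continuous_const.add (continuous_const_smul _))) hmem ?_ α hk
    · have e1 : s * (1 / 4) * ε = (1 / 2) ^ (n + 1 + 1) * ε := by
        rw [hs, pow_succ, pow_succ]; ring
      have e2 : (((1 / 2) ^ (n + 1) : ℝ) : 𝕜) • f = ((s : ℝ) : 𝕜) •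
          (((1 / 2 : ℝ) : 𝕜) • f + ((-(1 / 4) : ℝ) : 𝕜) • k + ((1 / 4 : ℝ) : 𝕜) • k) := by
        rw [pow_succ, ← hs]
        push_cast
        module
      rw [e2, ← e1]
      rwa [← e1] at this
    · intro g _ g' _
      rw [← smul_sub, add_sub_add_left_eq_sub, ← smul_sub, map_smul, map_smul, norm_smul, norm_smul,
        hn1 s hs0, hn1 (1 / 4) (by norm_num), mul_assoc]

/-- For every n the point 0 survives ω^ξ n derivations at a suitable scale, and ω^(ξ+1) is the
supremum of the ω^ξ n. -/
theorem omega0_opow_add_one_le_opIndex {A : X →L[𝕜] Y} {ε : ℝ} (hε : 0 < ε) {ξ : Ordinal.{u}}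
    (hξ : Order.IsSuccLimit (ω ^ ξ))
    (hne : ∀ α < ω ^ ξ, (iterDeriv ε (dualBallImage A) α).Nonempty) :
    ((ω ^ (ξ + 1) : Ordinal.{u}) : WithTop Ordinal.{u}) ≤ opIndex A := by
  by_contra! hlt
  obtain ⟨β, hβ, hβlt⟩ := WithTop.lt_iff_exists_coe.1 hlt
  rw [WithTop.coe_lt_coe, opow_add, opow_one, lt_mul_iff_of_isSuccLimit isSuccLimit_omega0] at hβlt
  obtain ⟨c, hc, hβc⟩ := hβlt
  obtain ⟨n, rfl⟩ := lt_omega0.1 hc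
  have h1 := index_le_iff.1 (hβ.le) ((1 / 2) ^ (n + 1) * ε) (by positivity)
  have h2 := smul_mem_iterDeriv_dualBallImage hε hξ hne n 0 (zero_mem_dualBallImage A)
  have h3 := iterDeriv_antitone _ _ hβc.le h2
  rw [h1] at h3
  exact h3

end LowerBound

end Szlenk
namespace Szlenk

/-! ### Structure of the trees -/

section Trees

open Ordinal

theorem treeOne_zero : treeOne (0 : Ordinal.{u}) = {[0]} := by
  unfold treeOne; rw [limitRecOn_zero]

theorem mem_treeOne_add_one {ζ : Ordinal.{u}} {l : List Ordinal.{u}} :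
    l ∈ treeOne (ζ + 1) ↔ ∃ n : ℕ, l ∈ tree ζ (n + 1) := by
  have : treeOne (ζ + 1) = {l | ∃ n : ℕ, 1 ≤ n ∧ l ∈ stack ζ (treeOne ζ) n} := by
    conv_lhs => unfold treeOne
    rw [limitRecOn_add_one]
    rfl
  rw [this]
  constructor
  · rintro ⟨n, hn, hl⟩
    obtain ⟨n, rfl⟩ := Nat.exists_eq_add_of_le' hn
    exact ⟨n, hl⟩
  · rintro ⟨n, hl⟩
    exact ⟨n + 1, by omega, hl⟩

theorem mem_treeOne_limit {ξ : Ordinal.{u}} (hξ : Order.IsSuccLimit ξ) {l : List Ordinal.{u}} :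
    l ∈ treeOne ξ ↔ ∃ ζ < ξ, ∃ t ∈ treeOne (ζ + 1), l = shift (ω ^ ζ) t := by
  conv_lhs => unfold treeOne
  rw [limitRecOn_limit _ _ _ _ hξ]
  simp only [← Order.succ_eq_add_one]
  constructor
  · rintro ⟨ζ, hζ, t, ht, rfl⟩
    exact ⟨ζ, hζ, t, ht, rfl⟩
  · rintro ⟨ζ, hζ, t, ht, rfl⟩
    exact ⟨ζ, hζ, t, ht, rfl⟩

theorem mem_tree_succ {ζ : Ordinal.{u}} {n : ℕ} {l : List Ordinal.{u}} :
    l ∈ tree ζ (n + 1) ↔ (∃ t ∈ treeOne ζ, l = shift (ω ^ ζ * n) t) ∨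
      ∃ t ∈ maxNodes (treeOne ζ), ∃ s ∈ tree ζ n, l = shift (ω ^ ζ * n) t ++ s := Iff.rfl

theorem treeOne_nonempty (ζ : Ordinal.{u}) : (treeOne ζ).Nonempty := by
  induction ζ using Ordinal.limitRecOn with
  | zero => exact ⟨[0], by simp [treeOne_zero]⟩
  | add_one ζ ih =>
    obtain ⟨t, ht⟩ := ih
    exact ⟨_, mem_treeOne_add_one.2 ⟨0, mem_tree_succ.2 (Or.inl ⟨t, ht, rfl⟩)⟩⟩
  | limit ξ hξ ih =>
    obtain ⟨t, ht⟩ := ih (0 + 1) (by simpa using one_lt_of_isSuccLimit hξ)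
    exact ⟨_, (mem_treeOne_limit hξ).2 ⟨0, hξ.bot_lt, t, ht, rfl⟩⟩

theorem shift_injective (β : Ordinal.{u}) : Function.Injective (shift β) :=
  List.map_injective_iff.2 fun a b h => by simpa using h

theorem shift_prefix_shift_iff {β : Ordinal.{u}} {s t : List Ordinal.{u}} :
    shift β s <+: shift β t ↔ s <+: t := by
  constructor
  · intro h
    obtain ⟨r, hr, he⟩ := List.prefix_map_iff.1 h
    rwa [shift_injective β he]
  · exact fun h => h.map _

theorem prefix_of_prefix_shift {β : Ordinal.{u}} {s t : List Ordinal.{u}} (h : s <+: shift β t) :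
    ∃ r, r <+: t ∧ s = shift β r := List.prefix_map_iff.1 h

/-- The maximal members of `Γ_{ζ,n}` for `n ≥ 1`, described recursively; for `n = 0` only the
empty sequence. -/
def branches (ζ : Ordinal.{u}) : ℕ → Set (List Ordinal.{u})
  | 0 => {[]}
  | n + 1 => {l | ∃ t ∈ maxNodes (treeOne ζ), ∃ s ∈ branches ζ n, l = shift (ω ^ ζ * n) t ++ s}

/-- A node is maximal exactly when every block is present and maximal; a missing block can be
appended because Γ_{ζ,1} is nonempty. -/
theorem branches_add_one_eq (ζ : Ordinal.{u}) (n : ℕ) :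
    branches ζ (n + 1) = maxNodes (tree ζ (n + 1)) := by
  induction n with
  | zero =>
    ext l
    constructor
    · rintro ⟨t, ht, s, hs, rfl⟩
      obtain rfl : s = [] := hs
      rw [List.append_nil]
      refine ⟨Or.inl ⟨t, ht.1, rfl⟩, ?_⟩
      rintro v (⟨t', ht', rfl⟩ | ⟨_, _, _, hs, _⟩) hv
      · rw [ht.2 t' ht' (shift_prefix_shift_iff.1 hv)]
      · exact hs.elim
    · rintro ⟨⟨t, ht, rfl⟩ | ⟨_, _, _, hs, _⟩, hmax⟩
      · refine ⟨t, ⟨ht, fun t' ht' hp => ?_⟩, [], rfl, by simp⟩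
        exact shift_injective _ (hmax _ (Or.inl ⟨t', ht', rfl⟩) (shift_prefix_shift_iff.2 hp))
      · exact hs.elim
  | succ n ih =>
    ext l
    constructor
    · rintro ⟨t, ht, s, hs, rfl⟩
      rw [ih] at hs
      refine ⟨Or.inr ⟨t, ht, s, hs.1, rfl⟩, ?_⟩
      rintro v (⟨t', ht', rfl⟩ | ⟨t', ht', s', hs', rfl⟩) hv
      · have h1 := ht.2 t' ht' (shift_prefix_shift_iff.1 ((List.prefix_append _ _).trans hv))
        subst h1
        exact (hv.eq_of_length_le (by simp)).symm
      · have htt : t = t' := by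
          rcases List.prefix_or_prefix_of_prefix ((List.prefix_append _ _).trans hv)
            (List.prefix_append (shift (ω ^ ζ * ((n + 1 : ℕ) : Ordinal.{u})) t') s') with h | h
          · exact (ht.2 t' ht'.1 (shift_prefix_shift_iff.1 h)).symm
          · exact ht'.2 t ht.1 (shift_prefix_shift_iff.1 h)
        subst htt
        rw [hs.2 s' hs' ((List.prefix_append_right_inj _).1 hv)]
    · rintro ⟨⟨t, ht, rfl⟩ | ⟨t, ht, s, hs, rfl⟩, hmax⟩
      · exfalso
        by_cases htm : t ∈ maxNodes (treeOne ζ)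
        · obtain ⟨u, hu⟩ := treeOne_nonempty ζ
          have := hmax _ (Or.inr ⟨t, htm, _, mem_tree_succ.2 (Or.inl ⟨u, hu, rfl⟩), rfl⟩)
            (List.prefix_append _ _)
          have hne := (treeOne_ok ζ u hu).1
          simp [shift, hne] at this
        · refine htm ⟨ht, fun t' ht' hp => ?_⟩
          exact shift_injective _ (hmax _ (Or.inl ⟨t', ht', rfl⟩) (shift_prefix_shift_iff.2 hp))
      · refine ⟨t, ht, s, ?_, rfl⟩
        rw [ih]
        refine ⟨hs, fun s' hs' hp => ?_⟩
        have := hmax _ (Or.inr ⟨t, ht, s', hs', rfl⟩) ((List.prefix_append_right_inj _).2 hp)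
        exact List.append_cancel_left this

theorem headD_eq_of_prefix {s t : List Ordinal.{u}} (hs : s ≠ []) (h : s <+: t) :
    s.headD 0 = t.headD 0 := by
  obtain ⟨r, rfl⟩ := h
  cases s with
  | nil => exact absurd rfl hs
  | cons a s => rfl

/-- The first entry of a node of Γ_{ζ,n+1} lies in [ω^ζ n, ω^ζ (n+1)). Hence the union defining
Γ_{ζ+1,1} is disjoint and extending a node cannot change its component. -/
theorem eq_of_mem_tree_of_headD_eq {ζ : Ordinal.{u}} {n m : ℕ} {s t : List Ordinal.{u}}
    (hs : s ∈ tree ζ (n + 1)) (ht : t ∈ tree ζ (m + 1)) (h : s.headD 0 = t.headD 0) : n = m := by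
  have key : ∀ {n m : ℕ} {s t : List Ordinal.{u}}, s ∈ tree ζ (n + 1) → t ∈ tree ζ (m + 1) →
      s.headD 0 = t.headD 0 → n ≤ m := by
    intro n m s t hs ht h
    have h1 := (stack_ok (treeOne_ok ζ) n s hs).2.2
    obtain ⟨h2, h3, -⟩ := stack_ok (treeOne_ok ζ) m t ht
    have h4 : t.headD 0 < ω ^ ζ * ((m + 1 : ℕ) : Ordinal.{u}) := by
      cases t with
      | nil => exact absurd rfl h2
      | cons a t => exact h3 a (by simp)
    rw [h] at h1
    have h5 := h1.trans_lt h4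
    rw [mul_lt_mul_iff_right₀ (omega_opow_pos ζ)] at h5
    exact Nat.lt_succ_iff.1 (by exact_mod_cast h5)
  exact le_antisymm (key hs ht h) (key ht hs h.symm)

/-- The analogue at limits: the first entry reveals which component of the union a node belongs to.
-/
theorem headD_shift_opow {ζ : Ordinal.{u}} {t : List Ordinal.{u}} (ht : t ∈ treeOne (ζ + 1)) :
    log ω ((shift (ω ^ ζ) t).headD 0) = ζ := by
  obtain ⟨a, b⟩ := treeOne_ok _ t ht
  cases t with
  | nil => exact absurd rfl a
  | cons x t =>
    have := b x (by simp)
    have hp : (shift (ω ^ ζ) (x :: t)).headD 0 = ω ^ ζ + x := by simp [shift]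
    rw [hp]
    have hlt : ω ^ ζ + x < ω ^ (ζ + 1) := isPrincipal_add_omega0_opow _
      ((opow_lt_opow_iff_right one_lt_omega0).2 (Order.lt_add_one_iff.2 le_rfl)) this
    apply le_antisymm
    · rw [← Order.lt_add_one_iff]
      exact (lt_opow_iff_log_lt one_lt_omega0 (by simp)).1 hlt
    · exact (opow_le_iff_le_log one_lt_omega0 (by simp)).1 le_self_add

theorem mem_maxNodes_treeOne_add_one {ζ : Ordinal.{u}} {t : List Ordinal.{u}} :
    t ∈ maxNodes (treeOne (ζ + 1)) ↔ ∃ n, t ∈ branches ζ (n + 1) := by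
  simp only [branches_add_one_eq]
  constructor
  · rintro ⟨ht, hmax⟩
    obtain ⟨n, hn⟩ := mem_treeOne_add_one.1 ht
    exact ⟨n, hn, fun s hs => hmax s (mem_treeOne_add_one.2 ⟨n, hs⟩)⟩
  · rintro ⟨n, hn, hmax⟩
    refine ⟨mem_treeOne_add_one.2 ⟨n, hn⟩, fun s hs hp => hmax s ?_ hp⟩
    obtain ⟨m, hm⟩ := mem_treeOne_add_one.1 hs
    rwa [eq_of_mem_tree_of_headD_eq hn hm
      (headD_eq_of_prefix (stack_ok (treeOne_ok ζ) n t hn).1 hp)]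

theorem mem_maxNodes_treeOne_limit {ξ : Ordinal.{u}} (hξ : Order.IsSuccLimit ξ)
    {l : List Ordinal.{u}} : l ∈ maxNodes (treeOne ξ) ↔
      ∃ ζ < ξ, ∃ t ∈ maxNodes (treeOne (ζ + 1)), l = shift (ω ^ ζ) t := by
  constructor
  · rintro ⟨hl, hmax⟩
    obtain ⟨ζ, hζ, t, ht, rfl⟩ := (mem_treeOne_limit hξ).1 hl
    refine ⟨ζ, hζ, t, ⟨ht, fun s hs hp => ?_⟩, rfl⟩
    exact shift_injective _ (hmax _ ((mem_treeOne_limit hξ).2 ⟨ζ, hζ, s, hs, rfl⟩)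
      (shift_prefix_shift_iff.2 hp))
  · rintro ⟨ζ, hζ, t, ht, rfl⟩
    refine ⟨(mem_treeOne_limit hξ).2 ⟨ζ, hζ, t, ht.1, rfl⟩, fun s hs hp => ?_⟩
    obtain ⟨ζ', -, t', ht', rfl⟩ := (mem_treeOne_limit hξ).1 hs
    have hne : shift (ω ^ ζ) t ≠ [] := by simpa [shift] using (treeOne_ok _ t ht.1).1
    have h1 := headD_shift_opow ht.1
    rw [headD_eq_of_prefix hne hp, headD_shift_opow ht'] at h1
    subst h1
    rw [ht.2 t' ht' (shift_prefix_shift_iff.1 hp)]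

/-- The case of one block is a hypothesis, so that the induction on ζ can feed in its induction
hypothesis; `pairwise_of_mem_tree_of` and `prefixSum_coeff_of` are shaped in the same way. -/
theorem mem_tree_of_prefix_of {ζ : Ordinal.{u}}
    (h : ∀ s ∈ treeOne ζ, ∀ r, r ≠ [] → r <+: s → r ∈ treeOne ζ) (n : ℕ) :
    ∀ s ∈ tree ζ n, ∀ r, r ≠ [] → r <+: s → r ∈ tree ζ n := by
  induction n with
  | zero => exact fun s hs => hs.elim
  | succ n ih =>
    rintro s (⟨t, ht, rfl⟩ | ⟨t, ht, u, hu, rfl⟩) r hr hrs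
    · obtain ⟨r, hr', rfl⟩ := prefix_of_prefix_shift hrs
      exact Or.inl ⟨r, h t ht r (by simpa [shift] using hr) hr', rfl⟩
    · rcases List.prefix_or_prefix_of_prefix hrs (List.prefix_append _ _) with h1 | ⟨w, rfl⟩
      · obtain ⟨r, hr', rfl⟩ := prefix_of_prefix_shift h1
        exact Or.inl ⟨r, h t ht.1 r (by simpa [shift] using hr) hr', rfl⟩
      · by_cases hw : w = []
        · subst hw
          rw [List.append_nil]
          exact Or.inl ⟨t, ht.1, rfl⟩
        · exact Or.inr ⟨t, ht, w, ih u hu w hw ((List.prefix_append_right_inj _).1 hrs), rfl⟩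

theorem mem_treeOne_of_prefix (ζ : Ordinal.{u}) :
    ∀ s ∈ treeOne ζ, ∀ r, r ≠ [] → r <+: s → r ∈ treeOne ζ := by
  induction ζ using Ordinal.limitRecOn with
  | zero =>
    intro s hs r hr hp
    rw [treeOne_zero] at hs ⊢
    obtain rfl : s = [0] := hs
    refine hp.eq_of_length_le ?_
    exact Nat.succ_le_of_lt (List.length_pos_iff.2 hr)
  | add_one ζ ih =>
    intro s hs r hr hp
    obtain ⟨n, hn⟩ := mem_treeOne_add_one.1 hs
    exact mem_treeOne_add_one.2 ⟨n, mem_tree_of_prefix_of ih _ s hn r hr hp⟩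
  | limit ξ hξ ih =>
    intro s hs r hr hp
    obtain ⟨ζ, hζ, t, ht, rfl⟩ := (mem_treeOne_limit hξ).1 hs
    obtain ⟨r, hr', rfl⟩ := prefix_of_prefix_shift hp
    exact (mem_treeOne_limit hξ).2 ⟨ζ, hζ, r,
      ih _ (hξ.add_one_lt hζ) t ht r (by simpa [shift] using hr) hr', rfl⟩

theorem mem_tree_of_prefix {ζ : Ordinal.{u}} {n : ℕ} {s r : List Ordinal.{u}} (hs : s ∈ tree ζ n)
    (hr : r ≠ []) (h : r <+: s) : r ∈ tree ζ n :=
  mem_tree_of_prefix_of (mem_treeOne_of_prefix ζ) n s hs r hr h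

theorem pairwise_shift {β : Ordinal.{u}} {t : List Ordinal.{u}} (h : t.Pairwise (· > ·)) :
    (shift β t).Pairwise (· > ·) :=
  h.map _ fun a b hab => by simpa using hab

theorem pairwise_of_mem_tree_of {ζ : Ordinal.{u}} (h : ∀ s ∈ treeOne ζ, s.Pairwise (· > ·))
    (n : ℕ) : ∀ s ∈ tree ζ n, s.Pairwise (· > ·) := by
  induction n with
  | zero => exact fun s hs => hs.elim
  | succ n ih =>
    rintro s (⟨t, ht, rfl⟩ | ⟨t, ht, u, hu, rfl⟩)
    · exact pairwise_shift (h t ht)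
    · refine List.pairwise_append.2 ⟨pairwise_shift (h t ht.1), ih u hu, fun a ha b hb => ?_⟩
      obtain ⟨a, -, rfl⟩ := List.mem_map.1 ha
      cases n with
      | zero => exact hu.elim
      | succ n => exact ((stack_ok (treeOne_ok ζ) n u hu).2.1 b hb).trans_le le_self_add

/-- The members of the trees are strictly decreasing sequences of ordinals. -/
theorem pairwise_of_mem_treeOne (ζ : Ordinal.{u}) : ∀ s ∈ treeOne ζ, s.Pairwise (· > ·) := by
  induction ζ using Ordinal.limitRecOn with
  | zero =>
    intro s hs
    rw [treeOne_zero] at hs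
    obtain rfl : s = [0] := hs
    simp
  | add_one ζ ih =>
    intro s hs
    obtain ⟨n, hn⟩ := mem_treeOne_add_one.1 hs
    exact pairwise_of_mem_tree_of ih _ s hn
  | limit ξ hξ ih =>
    intro s hs
    obtain ⟨ζ, hζ, t, ht, rfl⟩ := (mem_treeOne_limit hξ).1 hs
    exact pairwise_shift (ih _ (hξ.add_one_lt hζ) t ht)

/-- `∑_{∅ < s ≤ l} w(s)`. -/
noncomputable def prefixSum (w : List Ordinal.{u} → ℝ) (l : List Ordinal.{u}) : ℝ :=
  ∑ k ∈ Finset.range l.length, w (l.take (k + 1))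

theorem prefixSum_congr {w w' : List Ordinal.{u} → ℝ} {l : List Ordinal.{u}}
    (h : ∀ s, s ≠ [] → s <+: l → w s = w' s) : prefixSum w l = prefixSum w' l := by
  refine Finset.sum_congr rfl fun k hk => h _ ?_ (List.take_prefix _ _)
  rw [Finset.mem_range] at hk
  intro h0
  simp only [List.take_eq_nil_iff, Nat.succ_ne_zero, false_or] at h0
  simp [h0] at hk

theorem prefixSum_append (w : List Ordinal.{u} → ℝ) (a b : List Ordinal.{u}) :
    prefixSum w (a ++ b) = prefixSum w a + prefixSum (fun s => w (a ++ s)) b := by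
  unfold prefixSum
  rw [List.length_append, Finset.sum_range_add]
  congr 1
  · refine Finset.sum_congr rfl fun k hk => ?_
    rw [List.take_append_of_le_length (by simpa using Finset.mem_range.1 hk)]
  · refine Finset.sum_congr rfl fun k _ => ?_
    rw [add_assoc, List.take_length_add_append]

theorem prefixSum_shift (w : List Ordinal.{u} → ℝ) (β : Ordinal.{u}) (l : List Ordinal.{u}) :
    prefixSum w (shift β l) = prefixSum (fun s => w (shift β s)) l := by
  simp [prefixSum, shift, List.map_take]

theorem prefixSum_coeff_of {ζ : Ordinal.{u}}
    (h : ∀ t ∈ maxNodes (treeOne ζ), prefixSum (coeffOne ζ) t = 1) (n : ℕ) :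
    ∀ l ∈ branches ζ n, prefixSum (coeff ζ) l = n := by
  induction n with
  | zero =>
    intro l hl
    obtain rfl : l = [] := hl
    simp [prefixSum]
  | succ n ih =>
    rintro l ⟨t, ht, s, hs, rfl⟩
    rw [prefixSum_append, prefixSum_shift, prefixSum_congr (w' := coeffOne ζ), h t ht,
      prefixSum_congr (w' := coeff ζ), ih s hs]
    · push_cast
      ring
    · intro r hr hp
      refine coeff_append ht.1 (mem_tree_of_prefix ?_ hr hp)
      cases n with
      | zero =>
        obtain rfl : s = [] := hs
        exact absurd (List.prefix_nil.1 hp) hr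
      | succ n =>
        rw [branches_add_one_eq] at hs
        exact hs.1
    · intro r hr hp
      exact coeff_shift (mem_treeOne_of_prefix ζ t ht.1 r hr hp) _

/-- The coefficients along a maximal branch of `Γ_{ζ,1}` add up to `1`. -/
theorem prefixSum_coeffOne (ζ : Ordinal.{u}) :
    ∀ t ∈ maxNodes (treeOne ζ), prefixSum (coeffOne ζ) t = 1 := by
  induction ζ using Ordinal.limitRecOn with
  | zero =>
    intro t ht
    have := ht.1
    rw [treeOne_zero] at this
    obtain rfl : t = [0] := this
    simp [prefixSum, coeffOne_zero]
  | add_one ζ ih =>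
    intro t ht
    obtain ⟨n, hn⟩ := mem_maxNodes_treeOne_add_one.1 ht
    have hn' := hn
    rw [branches_add_one_eq] at hn'
    rw [prefixSum_congr (w' := fun s => coeff ζ s / ((n + 1 : ℕ) : ℝ))]
    · have := prefixSum_coeff_of ih (n + 1) t hn
      unfold prefixSum at this ⊢
      rw [← Finset.sum_div, this, _root_.div_self]
      exact_mod_cast Nat.succ_ne_zero n
    · exact fun s hs hp => coeffOne_succ (mem_tree_of_prefix hn'.1 hs hp)
  | limit ξ hξ ih =>
    intro l hl
    obtain ⟨ζ, hζ, t, ht, rfl⟩ := (mem_maxNodes_treeOne_limit hξ).1 hl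
    rw [prefixSum_shift, prefixSum_congr (w' := coeffOne (ζ + 1)), ih _ (hξ.add_one_lt hζ) t ht]
    exact fun s hs hp => coeffOne_limit hξ hζ (mem_treeOne_of_prefix _ t ht.1 s hs hp)

theorem prefixSum_coeff {ζ : Ordinal.{u}} {n : ℕ} {l : List Ordinal.{u}} (hl : l ∈ branches ζ n) :
    prefixSum (coeff ζ) l = n := prefixSum_coeff_of (prefixSum_coeffOne ζ) n l hl

theorem coeffOne_nonneg (ζ : Ordinal.{u}) (s : List Ordinal.{u}) : 0 ≤ coeffOne ζ s := by
  induction ζ using Ordinal.limitRecOn generalizing s with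
  | zero => unfold coeffOne; rw [limitRecOn_zero]; exact zero_le_one
  | add_one ζ ih =>
    unfold coeffOne
    rw [limitRecOn_add_one]
    exact div_nonneg (ih _) (Nat.cast_nonneg _)
  | limit ξ hξ ih =>
    unfold coeffOne
    rw [limitRecOn_limit _ _ _ _ hξ]
    split_ifs with h
    · exact ih _ h _
    · exact le_rfl

theorem coeff_nonneg (ζ : Ordinal.{u}) (s : List Ordinal.{u}) : 0 ≤ coeff ζ s :=
  coeffOne_nonneg _ _

end Trees

end Szlenk
namespace Szlenk

/-! ### Upper estimates for `θ_{ζ,n}` -/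

section WeightedSums

variable {𝕜 : Type*} [RCLike 𝕜] {X : Type u} [NormedAddCommGroup X] [NormedSpace 𝕜 X] {D : Type u}

/-- `β + t` for sequences of pairs. -/
def shiftPairs (β : Ordinal.{u}) (t : List (Ordinal.{u} × D)) : List (Ordinal.{u} × D) :=
  t.map fun a => (β + a.1, a.2)

@[simp]
theorem map_fst_shiftPairs (β : Ordinal.{u}) (t : List (Ordinal.{u} × D)) :
    (shiftPairs β t).map Prod.fst = shift β (t.map Prod.fst) := by
  simp [shiftPairs, shift]

theorem shiftPairs_append (β : Ordinal.{u}) (s t : List (Ordinal.{u} × D)) :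
    shiftPairs β (s ++ t) = shiftPairs β s ++ shiftPairs β t := List.map_append

variable (𝕜) in
/-- `∑_{∅ < s ≤ t} w(s) x_s`, where `w` only depends on the first coordinates. -/
noncomputable def weightedSum (w : List Ordinal.{u} → ℝ) (x : List (Ordinal.{u} × D) → X)
    (t : List (Ordinal.{u} × D)) : X :=
  ∑ k ∈ Finset.range t.length, ((w ((t.take (k + 1)).map Prod.fst) : ℝ) : 𝕜) • x (t.take (k + 1))

theorem take_ne_nil {α : Type*} {t : List α} {k : ℕ} (hk : k ∈ Finset.range t.length) :
    t.take (k + 1) ≠ [] := by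
  intro h0
  simp only [List.take_eq_nil_iff, Nat.succ_ne_zero, false_or] at h0
  simp [h0] at hk

theorem weightedSum_congr {w w' : List Ordinal.{u} → ℝ} (x : List (Ordinal.{u} × D) → X)
    {t : List (Ordinal.{u} × D)} (h : ∀ s, s ≠ [] → s <+: t.map Prod.fst → w s = w' s) :
    weightedSum 𝕜 w x t = weightedSum 𝕜 w' x t := by
  refine Finset.sum_congr rfl fun k hk => ?_
  rw [h _ (by simpa using take_ne_nil hk) ((List.take_prefix _ _).map _)]

theorem weightedSum_append (w : List Ordinal.{u} → ℝ) (x : List (Ordinal.{u} × D) → X)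
    (a b : List (Ordinal.{u} × D)) :
    weightedSum 𝕜 w x (a ++ b) = weightedSum 𝕜 w x a +
      weightedSum 𝕜 (fun s => w (a.map Prod.fst ++ s)) (fun s => x (a ++ s)) b := by
  unfold weightedSum
  rw [List.length_append, Finset.sum_range_add]
  congr 1
  · refine Finset.sum_congr rfl fun k hk => ?_
    rw [List.take_append_of_le_length (by simpa using Finset.mem_range.1 hk)]
  · refine Finset.sum_congr rfl fun k _ => ?_
    rw [add_assoc, List.take_length_add_append, List.map_append]

theorem weightedSum_shiftPairs (w : List Ordinal.{u} → ℝ) (x : List (Ordinal.{u} × D) → X)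
    (β : Ordinal.{u}) (t : List (Ordinal.{u} × D)) :
    weightedSum 𝕜 w x (shiftPairs β t) =
      weightedSum 𝕜 (fun s => w (shift β s)) (fun s => x (shiftPairs β s)) t := by
  simp [weightedSum, shiftPairs, shift, List.map_take, Function.comp_def]

theorem prefixSum_map_fst (w : List Ordinal.{u} → ℝ) (t : List (Ordinal.{u} × D)) :
    prefixSum w (t.map Prod.fst) =
      ∑ k ∈ Finset.range t.length, w ((t.take (k + 1)).map Prod.fst) := by
  simp [prefixSum, List.map_take]

theorem norm_weightedSum_le {w : List Ordinal.{u} → ℝ} (hw : ∀ s, 0 ≤ w s)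
    {x : List (Ordinal.{u} × D) → X} {t : List (Ordinal.{u} × D)}
    (hx : ∀ s, s ≠ [] → s <+: t → ‖x s‖ ≤ 1) :
    ‖weightedSum 𝕜 w x t‖ ≤ prefixSum w (t.map Prod.fst) := by
  rw [prefixSum_map_fst]
  refine norm_sum_le_of_le _ fun k hk => ?_
  rw [norm_smul, RCLike.norm_ofReal, abs_of_nonneg (hw _)]
  exact mul_le_of_le_one_right (hw _) (hx _ (take_ne_nil hk) (List.take_prefix _ _))

theorem le_re_apply_weightedSum {w : List Ordinal.{u} → ℝ} (hw : ∀ s, 0 ≤ w s)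
    {x : List (Ordinal.{u} × D) → X} {t : List (Ordinal.{u} × D)} {f : WeakDual 𝕜 X} {c : ℝ}
    (hx : ∀ s, s ≠ [] → s <+: t → c ≤ RCLike.re (f (x s))) :
    prefixSum w (t.map Prod.fst) * c ≤ RCLike.re (f (weightedSum 𝕜 w x t)) := by
  rw [prefixSum_map_fst, weightedSum, map_sum, map_sum, Finset.sum_mul]
  refine Finset.sum_le_sum fun k hk => ?_
  rw [map_smul, smul_eq_mul, RCLike.re_ofReal_mul]
  exact mul_le_mul_of_nonneg_left (hx _ (take_ne_nil hk) (List.take_prefix _ _)) (hw _)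

theorem re_apply_le {R : ℝ} {f : WeakDual 𝕜 X} (hf : ‖WeakDual.toStrongDual f‖ ≤ R) (z : X) :
    RCLike.re (f z) ≤ R * ‖z‖ :=
  (RCLike.re_le_norm _).trans ((WeakDual.toStrongDual f).le_of_opNorm_le hf z)

end WeightedSums

/-! ### Choosing branches on which most functionals are small -/

section UpperTheta

open Ordinal

variable {𝕜 : Type*} [RCLike 𝕜] {X : Type u} [NormedAddCommGroup X] [NormedSpace 𝕜 X]
  {D : Type u} [Preorder D]

variable (𝕜) in
/-- A weakly null family in the unit ball, indexed by sequences of pairs whose first coordinates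
form a sequence in `T`. -/
structure NullFamily (T : Set (List Ordinal.{u})) (x : List (Ordinal.{u} × D) → X) : Prop where
  tendsto : ∀ (t : List (Ordinal.{u} × D)) (ζ : Ordinal.{u}), t.map Prod.fst ++ [ζ] ∈ T →
    ∀ f : StrongDual 𝕜 X, Tendsto (fun a : D => f (x (t ++ [(ζ, a)]))) atTop (𝓝 0)
  norm_le : ∀ t : List (Ordinal.{u} × D), t.map Prod.fst ∈ T → ‖x t‖ ≤ 1

theorem NullFamily.comp_shiftPairs {T T' : Set (List Ordinal.{u})}
    {x : List (Ordinal.{u} × D) → X} (hx : NullFamily 𝕜 T x) {β : Ordinal.{u}}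
    (h : ∀ t ∈ T', shift β t ∈ T) : NullFamily 𝕜 T' fun s => x (shiftPairs β s) where
  tendsto t ζ ht f := by
    simp only [shiftPairs_append]
    refine hx.tendsto (shiftPairs β t) (β + ζ) ?_ f
    simpa [shift] using h _ ht
  norm_le t ht := hx.norm_le _ (by simpa using h _ ht)

theorem NullFamily.comp_append {T T' : Set (List Ordinal.{u})}
    {x : List (Ordinal.{u} × D) → X} (hx : NullFamily 𝕜 T x) {l : List (Ordinal.{u} × D)}
    (h : ∀ t ∈ T', l.map Prod.fst ++ t ∈ T) : NullFamily 𝕜 T' fun s => x (l ++ s) where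
  tendsto t ζ ht f := by
    simp only [← List.append_assoc]
    refine hx.tendsto (l ++ t) ζ ?_ f
    simpa using h _ ht
  norm_le t ht := hx.norm_le _ (by simpa using h _ ht)

theorem NullFamily.mono {T T' : Set (List Ordinal.{u})}
    {x : List (Ordinal.{u} × D) → X} (hx : NullFamily 𝕜 T x) (h : T' ⊆ T) : NullFamily 𝕜 T' x :=
  ⟨fun t ζ ht => hx.tendsto t ζ (h ht), fun t ht => hx.norm_le t (h ht)⟩

variable (𝕜 X D) in
/-- For finitely many bounded weak*-compact sets `L_i` and open sets `O_i ⊇ s_{δ₀}^{ω^ζ}(L_i)`,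
every weakly null family on `Γ_{ζ,1}.D` has a maximal branch whose weighted sum is almost dominated
by `δ₀` on all the sets `L_i \ O_i`. -/
def BlockProperty (δ₀ R : ℝ) (ζ : Ordinal.{u}) : Prop :=
  ∀ δ > δ₀, ∀ (ι : Type) [Finite ι] (L O : ι → Set (WeakDual 𝕜 X)),
    (∀ i, IsCompact (L i)) → (∀ i, IsOpen (O i)) →
    (∀ i, ∀ f ∈ L i, ‖WeakDual.toStrongDual f‖ ≤ R) →
    (∀ i, iterDeriv δ₀ (L i) (ω ^ ζ) ⊆ O i) →
    ∀ x : List (Ordinal.{u} × D) → X, NullFamily 𝕜 (treeOne ζ) x →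
      ∃ t : List (Ordinal.{u} × D), t.map Prod.fst ∈ maxNodes (treeOne ζ) ∧
        ∀ i, ∀ f ∈ L i, f ∉ O i → RCLike.re (f (weightedSum 𝕜 (coeffOne ζ) x t)) < δ

/-- A functional may cost R on a block where it is not below δ, but at most `J i` times. The block
vector z is chosen below δ on the (J_i - 1)-fold ω^ζ-derived set of `L i` outside `O i`; that
derived set thus lies in `O i` together with {Re f(z) < δ}, and the functionals outside this open
set continue with budget J_i - 1. -/
theorem BlockProperty.exists_branch {δ₀ R : ℝ} (hδ₀ : 0 ≤ δ₀) {ζ : Ordinal.{u}}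
    (h : BlockProperty 𝕜 X D δ₀ R ζ) {δ : ℝ} (hδ : δ₀ < δ) (n : ℕ) :
    ∀ (ι : Type) [Finite ι] (L O : ι → Set (WeakDual 𝕜 X)) (J : ι → ℕ),
      (∀ i, IsCompact (L i)) → (∀ i, IsOpen (O i)) →
      (∀ i, ∀ f ∈ L i, ‖WeakDual.toStrongDual f‖ ≤ R) →
      (∀ i, iterDeriv δ₀ (L i) (ω ^ ζ * J i) ⊆ O i) →
      ∀ x : List (Ordinal.{u} × D) → X, NullFamily 𝕜 (tree ζ n) x →
        ∃ t : List (Ordinal.{u} × D), t.map Prod.fst ∈ branches ζ n ∧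
          ∀ i, ∀ f ∈ L i, f ∉ O i →
            RCLike.re (f (weightedSum 𝕜 (coeff ζ) x t)) ≤ J i * R + n * δ := by
  induction n with
  | zero =>
    intro ι _ L O J hL hO hR hLO x hx
    refine ⟨[], rfl, fun i f hf _ => ?_⟩
    have hR0 : 0 ≤ R := (norm_nonneg _).trans (hR i f hf)
    simp only [weightedSum, List.length_nil, Finset.range_zero, Finset.sum_empty, map_zero]
    simpa using mul_nonneg (Nat.cast_nonneg _) hR0
  | succ n ih =>
    intro ι _ L O J hL hO hR hLO x hx
    have hder : ∀ i, iterDeriv δ₀ (iterDeriv δ₀ (L i) (ω ^ ζ * ((J i - 1 : ℕ) : Ordinal.{u})))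
        (ω ^ ζ) ⊆ O i := by
      intro i
      rw [← iterDeriv_mul_natCast_add_one]
      refine (iterDeriv_antitone _ _ ?_).trans (hLO i)
      gcongr
      omega
    obtain ⟨t, ht, htδ⟩ := h δ hδ ι
      (fun i => iterDeriv δ₀ (L i) (ω ^ ζ * ((J i - 1 : ℕ) : Ordinal.{u}))) O
      (fun i => (hL i).of_isClosed_subset (isClosed_iterDeriv _ (hL i).isClosed _)
        (iterDeriv_subset _ _ _)) hO (fun i f hf => hR i f (iterDeriv_subset _ _ _ hf)) hder
      (fun s => x (shiftPairs (ω ^ ζ * n) s))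
      (hx.comp_shiftPairs fun s hs => mem_tree_succ.2 (Or.inl ⟨s, hs, rfl⟩))
    set z := weightedSum 𝕜 (coeffOne ζ) (fun s => x (shiftPairs (ω ^ ζ * n) s)) t with hz
    have hzn : ‖z‖ ≤ 1 := by
      rw [← prefixSum_coeffOne ζ _ ht]
      refine norm_weightedSum_le (coeffOne_nonneg ζ) fun s hs hp => hx.norm_le _ ?_
      rw [map_fst_shiftPairs]
      exact Or.inl ⟨_, mem_treeOne_of_prefix ζ _ ht.1 _ (by simpa using hs) (hp.map _), rfl⟩
    have hopen : IsOpen {f : WeakDual 𝕜 X | RCLike.re (f z) < δ} :=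
      isOpen_lt (RCLike.continuous_re.comp (WeakDual.eval_continuous z)) continuous_const
    -- Each set is used twice: with its old budget for functionals small on z, and with budget
    -- reduced by one and a larger open set for the others. This doubling is why finite families are
    -- carried along.
    obtain ⟨s, hs, hsδ⟩ := ih (ι ⊕ ι) (Sum.elim L L)
      (Sum.elim O fun i => O i ∪ {f | RCLike.re (f z) < δ}) (Sum.elim J fun i => J i - 1)
      (by rintro (i | i) <;> exact hL i)
      (by
        rintro (i | i)
        · exact hO i
        · exact (hO i).union hopen)
      (by rintro (i | i) <;> exact hR i)
      (by
        rintro (i | i)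
        · exact hLO i
        · intro f hf
          by_cases hfO : f ∈ O i
          · exact Or.inl hfO
          · exact Or.inr (htδ i f hf hfO))
      (fun s => x (shiftPairs (ω ^ ζ * n) t ++ s))
      (hx.comp_append fun s hs => mem_tree_succ.2 (Or.inr ⟨_, ht, s, hs, by simp⟩))
    refine ⟨shiftPairs (ω ^ ζ * n) t ++ s, ⟨_, ht, _, hs, by simp⟩, ?_⟩
    have hsum : weightedSum 𝕜 (coeff ζ) x (shiftPairs (ω ^ ζ * n) t ++ s) =
        z + weightedSum 𝕜 (coeff ζ) (fun s => x (shiftPairs (ω ^ ζ * n) t ++ s)) s := by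
      rw [weightedSum_append, weightedSum_shiftPairs]
      congr 1
      · exact weightedSum_congr _ fun r hr hp =>
          coeff_shift (mem_treeOne_of_prefix ζ _ ht.1 r hr hp) _
      · refine weightedSum_congr _ fun r hr hp => ?_
        rw [map_fst_shiftPairs]
        refine coeff_append ht.1 (mem_tree_of_prefix (s := s.map Prod.fst) ?_ hr hp)
        cases n with
        | zero =>
          have hs' : s.map Prod.fst = [] := hs
          rw [hs'] at hp
          exact absurd (List.prefix_nil.1 hp) hr
        | succ n =>
          rw [branches_add_one_eq] at hs
          exact hs.1
    intro i f hf hfO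
    rw [hsum, map_add, map_add]
    push_cast
    by_cases hfz : RCLike.re (f z) < δ
    · have := hsδ (Sum.inl i) f hf hfO
      simp only [Sum.elim_inl] at this
      linarith
    · have h1 := hsδ (Sum.inr i) f hf (by
        rintro (h | h)
        · exact hfO h
        · exact hfz h)
      simp only [Sum.elim_inr] at h1
      -- With budget 0 all of `L i` would lie in `O i`; so the truncated subtraction is a genuine
      -- one.
      have hJ : 1 ≤ J i := by
        by_contra! h0
        have h2 := hLO i
        rw [Nat.lt_one_iff.1 h0, Nat.cast_zero, mul_zero, iterDeriv_zero] at h2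
        exact hfO (h2 hf)
      rw [Nat.cast_sub hJ, Nat.cast_one] at h1
      have hR0 : 0 ≤ R := (norm_nonneg _).trans (hR i f hf)
      have h2 := (re_apply_le (hR i f hf) z).trans (mul_le_of_le_one_right hR0 hzn)
      linarith

theorem isSuccLimit_omega0_opow {ξ : Ordinal.{u}} (hξ : ξ ≠ 0) : Order.IsSuccLimit (ω ^ ξ) :=
  isSuccLimit_opow_left isSuccLimit_omega0 hξ

/-- For ζ = 0, a point y of the compact set L \ O has a neighbourhood where functionals of L differ
from y by at most δ₀ in norm, y tends to 0 along the family, and finitely many such neighbourhoods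
suffice. At successors, compactness bounds the number of costly blocks and averaging makes their
cost negligible. At limits, compactness reaches the open sets at some ω^ζ with ζ < ξ, and Γ_{ξ,1}
contains a shifted copy of Γ_{ζ+1,1}. -/
theorem blockProperty [IsDirectedOrder D] [Nonempty D] {δ₀ R : ℝ} (hδ₀ : 0 ≤ δ₀)
    (ζ : Ordinal.{u}) : BlockProperty 𝕜 X D δ₀ R ζ := by
  induction ζ using Ordinal.limitRecOn with
  | zero =>
    intro δ hδ ι _ L O hL hO hR hLO x hx
    have key : ∀ i, ∀ᶠ a : D in atTop, ∀ f ∈ L i \ O i, RCLike.re (f (x [(0, a)])) < δ := by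
      intro i
      have hcomp : IsCompact (L i \ O i) := (hL i).diff (hO i)
      have : ∀ᶠ a : D in atTop, ∀ f ∈ (L i \ O i) ∩ L i, RCLike.re (f (x [(0, a)])) < δ := by
        refine hcomp.induction_on
          (p := fun S => ∀ᶠ a : D in atTop, ∀ f ∈ S ∩ L i, RCLike.re (f (x [(0, a)])) < δ)
          (by simp) (fun S T hST hT => ?_) (fun S T hS hT => ?_) fun y hy => ?_
        · filter_upwards [hT] with a ha f hf using ha f ⟨hST hf.1, hf.2⟩
        · filter_upwards [hS, hT] with a ha hb f hf
          rcases hf.1 with h | h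
          · exact ha f ⟨h, hf.2⟩
          · exact hb f ⟨h, hf.2⟩
        · have hny : y ∉ deriv δ₀ (L i) := fun hd => hy.2 (hLO i (by
            rw [opow_zero, ← zero_add (1 : Ordinal.{u}), iterDeriv_add_one, iterDeriv_zero]
            exact hd))
          obtain ⟨V, hV, hVd⟩ := exists_nhds_of_notMem_deriv hδ₀ hy.1 hny
          refine ⟨V, mem_nhdsWithin_of_mem_nhds hV, ?_⟩
          have hlim := hx.tendsto [] 0 (by simp [treeOne_zero]) (WeakDual.toStrongDual y)
          have hre : Tendsto (fun a : D => RCLike.re (y (x ([] ++ [(0, a)])))) atTop (𝓝 0) := by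
            simpa [Function.comp_def] using (RCLike.continuous_re.tendsto _).comp hlim
          filter_upwards [hre.eventually_lt_const (sub_pos.2 hδ)] with a ha f hf
          have h1 := hVd f hf y ⟨mem_of_mem_nhds hV, hy.1⟩
          have h2 := re_apply_le h1 (x [(0, a)])
          have h3 : ‖x [(0, a)]‖ ≤ 1 := hx.norm_le _ (by simp [treeOne_zero])
          have h4 : RCLike.re ((f - y) (x [(0, a)])) =
              RCLike.re (f (x [(0, a)])) - RCLike.re (y (x [(0, a)])) := by
            rw [← map_sub]
            rfl
          have h5 := mul_le_of_le_one_right hδ₀ h3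
          simp only [List.nil_append] at ha
          linarith
      filter_upwards [this] with a ha f hf using ha f ⟨hf, hf.1⟩
    obtain ⟨a, ha⟩ := (eventually_all.2 key).exists
    refine ⟨[(0, a)], ?_, fun i f hf hfO => ?_⟩
    · rw [treeOne_zero]
      refine ⟨by simp, fun s hs _ => ?_⟩
      simpa using hs
    · have : weightedSum 𝕜 (coeffOne 0) x [(0, a)] = x [(0, a)] := by
        simp [weightedSum, coeffOne_zero]
      rw [this]
      exact ha i f ⟨hf, hfO⟩
  | add_one ζ ih =>
    intro δ hδ ι _ L O hL hO hR hLO x hx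
    cases nonempty_fintype ι
    have hlim : Order.IsSuccLimit (ω ^ (ζ + 1)) := isSuccLimit_omega0_opow (by simp)
    have h1 : ∀ i, ∃ j : ℕ, iterDeriv δ₀ (L i) (ω ^ ζ * j) ⊆ O i := by
      intro i
      obtain ⟨β, hβ, hb⟩ := exists_iterDeriv_subset_of_limit (hL i) (hO i) hlim (hLO i)
      rw [opow_add, opow_one, lt_mul_iff_of_isSuccLimit isSuccLimit_omega0] at hβ
      obtain ⟨c, hc, hβc⟩ := hβ
      obtain ⟨j, rfl⟩ := lt_omega0.1 hc
      exact ⟨j, (iterDeriv_antitone _ _ hβc.le).trans hb⟩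
    choose J hJ using h1
    set j := Finset.univ.sup J
    have hj : ∀ i, iterDeriv δ₀ (L i) (ω ^ ζ * j) ⊆ O i := fun i => by
      refine (iterDeriv_antitone _ _ ?_).trans (hJ i)
      gcongr
      exact Finset.le_sup (Finset.mem_univ i)
    obtain ⟨δ', hδ', hδ'δ⟩ := exists_between hδ
    -- With so many blocks, the at most j costly ones add less than δ - δ' to the average.
    obtain ⟨n, hn⟩ := exists_nat_gt (j * R / (δ - δ'))
    rw [div_lt_iff₀ (sub_pos.2 hδ'δ)] at hn
    obtain ⟨t, ht, htb⟩ := ih.exists_branch hδ₀ hδ' (n + 1) ι L O (fun _ => j) hL hO hR hj x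
      (hx.mono fun l hl => mem_treeOne_add_one.2 ⟨n, hl⟩)
    refine ⟨t, mem_maxNodes_treeOne_add_one.2 ⟨n, ht⟩, fun i f hf hfO => ?_⟩
    have hn0 : (0 : ℝ) < n + 1 := by positivity
    have ht' := ht
    rw [branches_add_one_eq] at ht'
    have hsum : weightedSum 𝕜 (coeffOne (ζ + 1)) x t =
        (((n + 1 : ℝ)⁻¹ : ℝ) : 𝕜) • weightedSum 𝕜 (coeff ζ) x t := by
      rw [weightedSum_congr (w' := fun s => coeff ζ s / ((n + 1 : ℕ) : ℝ))
        _ fun s hs hp => coeffOne_succ (mem_tree_of_prefix ht'.1 hs hp)]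
      unfold weightedSum
      rw [Finset.smul_sum]
      refine Finset.sum_congr rfl fun k _ => ?_
      rw [smul_smul, ← RCLike.ofReal_mul]
      congr 2
      push_cast
      rw [div_eq_inv_mul]
    rw [hsum, map_smul, _root_.smul_eq_mul, RCLike.re_ofReal_mul, inv_mul_lt_iff₀ hn0]
    refine (htb i f hf hfO).trans_lt ?_
    push_cast
    nlinarith
  | limit ξ hξ ih =>
    intro δ hδ ι _ L O hL hO hR hLO x hx
    cases nonempty_fintype ι
    have hlim : Order.IsSuccLimit (ω ^ ξ) := isSuccLimit_omega0_opow hξ.ne_bot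
    have h1 : ∀ i, ∃ ζ < ξ, iterDeriv δ₀ (L i) (ω ^ ζ) ⊆ O i := by
      intro i
      obtain ⟨β, hβ, hb⟩ := exists_iterDeriv_subset_of_limit (hL i) (hO i) hlim (hLO i)
      obtain ⟨ζ, hζ, hβζ⟩ := (lt_opow_of_isSuccLimit omega0_ne_zero hξ).1 hβ
      exact ⟨ζ, hζ, (iterDeriv_antitone _ _ hβζ.le).trans hb⟩
    choose Z hZ hZO using h1
    set ζ := Finset.univ.sup Z
    have hζ : ζ < ξ := (Finset.sup_lt_iff hξ.bot_lt).2 fun i _ => hZ i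
    have hζO : ∀ i, iterDeriv δ₀ (L i) (ω ^ (ζ + 1)) ⊆ O i := fun i => by
      refine (iterDeriv_antitone _ _ (opow_le_opow_right omega0_pos ?_)).trans (hZO i)
      exact (Finset.le_sup (f := Z) (Finset.mem_univ i)).trans le_self_add
    obtain ⟨t, ht, htb⟩ := ih (ζ + 1) (hξ.add_one_lt hζ) δ hδ ι L O hL hO hR hζO
      (fun s => x (shiftPairs (ω ^ ζ) s))
      (hx.comp_shiftPairs fun s hs => (mem_treeOne_limit hξ).2 ⟨ζ, hζ, s, hs, rfl⟩)
    refine ⟨shiftPairs (ω ^ ζ) t, ?_, fun i f hf hfO => ?_⟩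
    · rw [map_fst_shiftPairs]
      exact (mem_maxNodes_treeOne_limit hξ).2 ⟨ζ, hζ, _, ht, rfl⟩
    · rw [weightedSum_shiftPairs, weightedSum_congr (w' := coeffOne (ζ + 1)) _ fun s hs hp =>
        coeffOne_limit hξ hζ (mem_treeOne_of_prefix _ _ ht.1 s hs hp)]
      exact htb i f hf hfO

end UpperTheta

/-! ### The upper bound for θ_{ζ,n} -/

section Theta

open Ordinal

variable {𝕜 : Type*} [RCLike 𝕜] {X : Type u} [NormedAddCommGroup X] [NormedSpace 𝕜 X]
  {Y : Type v} [NormedAddCommGroup Y] [NormedSpace 𝕜 Y]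

theorem bddAbove_re_image_dualBallImage (A : X →L[𝕜] Y) (x : X) :
    BddAbove ((fun f : WeakDual 𝕜 X => RCLike.re (f x)) '' dualBallImage A) := by
  refine ⟨‖A‖ * ‖x‖, ?_⟩
  rintro _ ⟨f, hf, rfl⟩
  exact re_apply_le (norm_le_of_mem_dualBallImage hf) x

theorem re_apply_le_supportFun {A : X →L[𝕜] Y} {f : WeakDual 𝕜 X} (hf : f ∈ dualBallImage A)
    (x : X) : RCLike.re (f x) ≤ supportFun (dualBallImage A) x :=
  le_csSup (bddAbove_re_image_dualBallImage A x) ⟨f, hf, rfl⟩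

theorem supportFun_le {A : X →L[𝕜] Y} {x : X} {c : ℝ}
    (h : ∀ f ∈ dualBallImage A, RCLike.re (f x) ≤ c) : supportFun (dualBallImage A) x ≤ c := by
  refine csSup_le (Set.Nonempty.image _ ⟨0, zero_mem_dualBallImage A⟩) ?_
  rintro _ ⟨f, hf, rfl⟩
  exact h f hf

theorem supportFun_nonneg (A : X →L[𝕜] Y) (x : X) : 0 ≤ supportFun (dualBallImage A) x := by
  have h := re_apply_le_supportFun (zero_mem_dualBallImage A) x
  have h0 : (0 : WeakDual 𝕜 X) x = 0 := rfl
  rwa [h0, map_zero] at h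

theorem mem_maxNodes_treeD_iff {D : Type u} [Nonempty D] {ζ : Ordinal.{u}} {n : ℕ}
    {t : List (Ordinal.{u} × D)} :
    t ∈ maxNodes (treeD ζ n D) ↔ t.map Prod.fst ∈ maxNodes (tree ζ n) := by
  constructor
  · rintro ⟨ht, hmax⟩
    refine ⟨ht, ?_⟩
    rintro s hs ⟨r, rfl⟩
    obtain ⟨d⟩ := ‹Nonempty D›
    have hmap : (t ++ r.map fun ζ => (ζ, d)).map Prod.fst = t.map Prod.fst ++ r := by
      simp [Function.comp_def]
    have := hmax (t ++ r.map fun ζ => (ζ, d)) (by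
      change _ ∈ tree ζ n
      rwa [hmap]) (List.prefix_append _ _)
    rw [← hmap, this]
  · rintro ⟨ht, hmax⟩
    refine ⟨ht, fun s hs hp => ?_⟩
    have := congrArg List.length (hmax _ hs (hp.map _))
    simp only [List.length_map] at this
    exact (hp.eq_of_length this.symm).symm

theorem opTheta_nonneg (ζ : Ordinal.{u}) (n : ℕ) (A : X →L[𝕜] Y) : 0 ≤ opTheta ζ n A :=
  Real.sInf_nonneg fun _ h => h.1.le

/-- A bound for `Sz(A, δ₀)` gives a bound for `θ_{ζ,n}(A)`. -/
theorem opTheta_le {A : X →L[𝕜] Y} {R δ₀ δ η : ℝ} (hA : ‖A‖ ≤ R) (hδ₀ : 0 ≤ δ₀) (hδ : δ₀ < δ)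
    {ζ : Ordinal.{u}} {m n : ℕ} (hm : iterDeriv δ₀ (dualBallImage A) (ω ^ ζ * m) = ∅)
    (hη : 0 < η) (hn : m * R + (n + 1) * δ ≤ (n + 1) * η) : opTheta ζ (n + 1) A ≤ η := by
  refine csInf_le ⟨0, fun _ h => h.1.le⟩ ⟨hη, fun D _ _ _ x hx hx1 => ?_⟩
  have hnull : NullFamily 𝕜 (tree ζ (n + 1)) x :=
    ⟨fun t ζ' ht => hx t ζ' fun a => by
      change _ ∈ tree _ _
      simpa using ht, hx1⟩
  obtain ⟨t, ht, htb⟩ := (blockProperty (𝕜 := 𝕜) (X := X) (D := D) (R := R) hδ₀ ζ).exists_branch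
    hδ₀ hδ (n + 1)
    Unit (fun _ => dualBallImage A) (fun _ => ∅) (fun _ => m) (fun _ => isCompact_dualBallImage A)
    (fun _ => isOpen_empty) (fun _ f hf => (norm_le_of_mem_dualBallImage hf).trans hA)
    (fun _ => hm.subset) x hnull
  rw [branches_add_one_eq, ← mem_maxNodes_treeD_iff] at ht
  refine (ciInf_le ⟨0, ?_⟩ ⟨t, ht⟩).trans (supportFun_le fun f hf => ?_)
  · rintro _ ⟨s, rfl⟩
    exact supportFun_nonneg A _
  · have hn0 : (0 : ℝ) < n + 1 := by positivity
    have h1 := htb () f hf (Set.notMem_empty f)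
    have h2 : (1 / ((n + 1 : ℕ) : 𝕜)) = (((n + 1 : ℝ)⁻¹ : ℝ) : 𝕜) := by
      push_cast
      rw [one_div]
    rw [map_smul, _root_.smul_eq_mul, h2, RCLike.re_ofReal_mul, inv_mul_le_iff₀ hn0]
    refine le_trans h1 (le_trans (le_of_eq ?_) hn)
    push_cast
    ring

end Theta

end Szlenk
namespace Szlenk

/-! ### Lower estimates for `θ_{ζ,n}` -/

section WeakNeighborhoods

variable {𝕜 : Type*} [RCLike 𝕜] {X : Type u} [NormedAddCommGroup X] [NormedSpace 𝕜 X]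

/-- Functionals z of L at distance more than ε/2 from y accumulate at y. With x_z almost norming z -
y, the half-difference (x_z - x_u)/2 for z, u far along an ultrafilter is nearly annihilated by
finitely many prescribed functionals, while z still takes on it a real part of about ε/4. -/
theorem exists_mem_and_lt_re {ε : ℝ} (hε : 0 < ε) {L : Set (WeakDual 𝕜 X)} {y : WeakDual 𝕜 X}
    (hy : y ∈ deriv ε L) {U : Set (WeakDual 𝕜 X)} (hU : U ∈ 𝓝 y) (F : Finset (StrongDual 𝕜 X))
    {η : ℝ} (hη : 0 < η) :
    ∃ z ∈ L ∩ U, ∃ x : X, ‖x‖ ≤ 1 ∧ (∀ f ∈ F, ‖f x‖ < η) ∧ ε / 5 < RCLike.re (z x) := by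
  classical
  set S : Set (WeakDual 𝕜 X) := {z | z ∈ L ∧ ε / 2 < ‖WeakDual.toStrongDual (z - y)‖}
  have hne : (𝓝 y ⊓ 𝓟 S).NeBot := by
    change ClusterPt y (𝓟 S)
    rw [← mem_closure_iff_clusterPt, mem_closure_iff_nhds]
    intro V hV
    obtain ⟨g, hg, h, hh, hlt⟩ := ((mem_deriv_iff hε.le).1 hy).2 V hV
    by_contra hcon
    have key : ∀ k ∈ V ∩ L, ‖WeakDual.toStrongDual (k - y)‖ ≤ ε / 2 := fun k hk => by
      by_contra! hk'
      exact hcon ⟨k, hk.1, hk.2, hk'⟩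
    have h1 : g - h = (g - y) - (h - y) := by abel
    rw [h1, map_sub] at hlt
    have := norm_sub_le (WeakDual.toStrongDual (g - y)) (WeakDual.toStrongDual (h - y))
    linarith [key g hg, key h hh]
  set 𝒰 : Ultrafilter (WeakDual 𝕜 X) := Ultrafilter.of (𝓝 y ⊓ 𝓟 S)
  have h𝒰 : (𝒰 : Filter (WeakDual 𝕜 X)) ≤ 𝓝 y ⊓ 𝓟 S := Ultrafilter.of_le _
  have h𝒰y : (𝒰 : Filter (WeakDual 𝕜 X)) ≤ 𝓝 y := h𝒰.trans inf_le_left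
  have h𝒰S : S ∈ 𝒰 := h𝒰.trans inf_le_right (mem_principal_self S)
  have hx : ∀ z ∈ S, ∃ x : X, ‖x‖ ≤ 1 ∧ ε / 2 < RCLike.re (WeakDual.toStrongDual (z - y) x) :=
    fun z hz => exists_lt_re_apply_of_lt_norm _ hz.2
  choose! x hx1 hx2 using hx
  -- Adding y to the prescribed functionals makes y small on the final vector too.
  set G : Finset (StrongDual 𝕜 X) := insert (WeakDual.toStrongDual y) F
  set T : WeakDual 𝕜 X → (G → 𝕜) := fun z f => f.1 (x z)
  obtain ⟨q, hq⟩ : ∃ q, Tendsto T 𝒰 (𝓝 q) := by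
    have hmem : T ⁻¹' Metric.closedBall 0 (∑ f ∈ G, ‖f‖) ∈ 𝒰 := by
      filter_upwards [h𝒰S] with z hz
      rw [Set.mem_preimage, mem_closedBall_zero_iff,
        pi_norm_le_iff_of_nonneg (Finset.sum_nonneg fun f _ => norm_nonneg f)]
      intro f
      calc ‖f.1 (x z)‖ ≤ ‖f.1‖ * ‖x z‖ := f.1.le_opNorm _
        _ ≤ ‖f.1‖ * 1 := by gcongr; exact hx1 z hz
        _ ≤ ∑ f ∈ G, ‖f‖ := by
          rw [mul_one]
          exact Finset.single_le_sum (f := fun f : StrongDual 𝕜 X => ‖f‖)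
            (fun f _ => norm_nonneg f) f.2
    obtain ⟨q, -, hq⟩ := (isCompact_closedBall (0 : G → 𝕜) _).ultrafilter_le_nhds (𝒰.map T)
      (le_principal_iff.2 hmem)
    exact ⟨q, hq⟩
  -- The losses amount to at most 3τ/2, and ε/4 - (3/2)(ε/40) > ε/5.
  set τ := min (η / 2) (ε / 40) with hτ
  have hτ0 : 0 < τ := by positivity
  have hclose : ∀ᶠ z in (𝒰 : Filter (WeakDual 𝕜 X)), dist (T z) q < τ :=
    hq (Metric.ball_mem_nhds q hτ0)
  -- First u is fixed; only then is z chosen, close to y at the vector `x u`.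
  obtain ⟨u, huS, hu⟩ := ((eventually_of_mem h𝒰S fun _ h => h).and hclose).exists
  have hev : ∀ᶠ z in 𝓝 y, ‖z (x u) - y (x u)‖ < τ := by
    have := (WeakDual.eval_continuous (𝕜 := 𝕜) (x u)).tendsto y
    filter_upwards [this (Metric.ball_mem_nhds _ hτ0)] with z hz
    simpa [dist_eq_norm] using hz
  obtain ⟨z, ⟨⟨⟨hzS, hz⟩, hzU⟩, hzu⟩⟩ := ((((eventually_of_mem h𝒰S fun _ h => h).and
    hclose).and (h𝒰y hU)).and (h𝒰y hev)).exists
  have hhalf : ‖((1 / 2 : ℝ) : 𝕜)‖ = 1 / 2 := by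
    rw [RCLike.norm_ofReal, abs_of_pos (by norm_num)]
  have hG : ∀ f ∈ G, ‖f (((1 / 2 : ℝ) : 𝕜) • (x z - x u))‖ < τ := by
    intro f hf
    have h1 := (dist_le_pi_dist (T z) q ⟨f, hf⟩).trans_lt hz
    have h2 := (dist_le_pi_dist (T u) q ⟨f, hf⟩).trans_lt hu
    have h3 := dist_triangle_right (T z ⟨f, hf⟩) (T u ⟨f, hf⟩) (q ⟨f, hf⟩)
    have h4 : dist (T z ⟨f, hf⟩) (T u ⟨f, hf⟩) = ‖f (x z - x u)‖ := by
      rw [dist_eq_norm, map_sub]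
    rw [map_smul, norm_smul, hhalf]
    linarith
  refine ⟨z, ⟨hzS.1, hzU⟩, ((1 / 2 : ℝ) : 𝕜) • (x z - x u), ?_, fun f hf => ?_, ?_⟩
  · rw [norm_smul, hhalf]
    have := norm_sub_le (x z) (x u)
    linarith [hx1 z hzS, hx1 u huS]
  · refine (hG f (Finset.mem_insert_of_mem hf)).trans_le ((min_le_left _ _).trans ?_)
    linarith
  · have h1 := hG _ (Finset.mem_insert_self _ _)
    have h2 := hx2 z hzS
    have h3 : RCLike.re (z (((1 / 2 : ℝ) : 𝕜) • (x z - x u))) =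
        1 / 2 * RCLike.re (WeakDual.toStrongDual (z - y) (x z)) -
        1 / 2 * RCLike.re (z (x u) - y (x u)) +
        RCLike.re (WeakDual.toStrongDual y (((1 / 2 : ℝ) : 𝕜) • (x z - x u))) := by
      have h4 : WeakDual.toStrongDual (z - y) (x z) = z (x z) - y (x z) := rfl
      have h5 : WeakDual.toStrongDual y (((1 / 2 : ℝ) : 𝕜) • (x z - x u)) =
          ((1 / 2 : ℝ) : 𝕜) * (y (x z) - y (x u)) := by
        rw [map_smul, map_sub, smul_eq_mul]
        rfl
      rw [h4, h5, map_smul, map_sub, smul_eq_mul, RCLike.re_ofReal_mul, RCLike.re_ofReal_mul]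
      simp only [map_sub]
      ring
    have h6 := (abs_le.1 ((RCLike.abs_re_le_norm _).trans h1.le)).1
    have h7 := (RCLike.re_le_norm _).trans hzu.le
    have h8 : τ ≤ ε / 40 := min_le_right _ _
    rw [h3]
    linarith

variable (𝕜 X) in
/-- Basic weak neighbourhoods of `0`, ordered by reverse inclusion. -/
abbrev WeakNhds : Type u :=
  {W : Set X // ∃ (F : Finset (StrongDual 𝕜 X)) (η : ℝ), 0 < η ∧ W = {x | ∀ f ∈ F, ‖f x‖ < η}}ᵒᵈ

instance : Nonempty (WeakNhds 𝕜 X) := ⟨OrderDual.toDual ⟨_, ∅, 1, one_pos, rfl⟩⟩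

instance : IsDirectedOrder (WeakNhds 𝕜 X) := ⟨by
  classical
  rintro ⟨_, F, η, hη, rfl⟩ ⟨_, F', η', hη', rfl⟩
  refine ⟨OrderDual.toDual ⟨_, F ∪ F', min η η', lt_min hη hη', rfl⟩, ?_, ?_⟩
  · exact fun x hx f hf => (hx f (Finset.mem_union_left _ hf)).trans_le (min_le_left _ _)
  · exact fun x hx f hf => (hx f (Finset.mem_union_right _ hf)).trans_le (min_le_right _ _)⟩

theorem tendsto_of_mem_weakNhds {x : WeakNhds 𝕜 X → X} (hx : ∀ W, x W ∈ (OrderDual.ofDual W).1)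
    (f : StrongDual 𝕜 X) : Tendsto (fun W => f (x W)) atTop (𝓝 0) := by
  refine Metric.tendsto_nhds.2 fun η hη => ?_
  filter_upwards [eventually_ge_atTop
    (OrderDual.toDual ⟨_, {f}, η, hη, rfl⟩ : WeakNhds 𝕜 X)] with W hW
  rw [dist_zero_right]
  exact hW (hx W) f (Finset.mem_singleton_self f)

/-- One step of the construction of a tree: given a functional and finitely many vectors, choose
a functional in `s_ε^ζ(K)` which is still large on the given vectors and on a new vector in `W`. -/
noncomputable def nextState (ε : ℝ) (K : Set (WeakDual 𝕜 X)) (s : WeakDual 𝕜 X × List X)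
    (a : Ordinal.{u} × WeakNhds 𝕜 X) : WeakDual 𝕜 X × List X :=
  open Classical in
  if h : ∃ zx : WeakDual 𝕜 X × X, zx.1 ∈ iterDeriv ε K a.1 ∧
      (∀ b ∈ s.2, ε / 5 < RCLike.re (zx.1 b)) ∧ ‖zx.2‖ ≤ 1 ∧ zx.2 ∈ (OrderDual.ofDual a.2).1 ∧
      ε / 5 < RCLike.re (zx.1 zx.2) then (h.choose.1, h.choose.2 :: s.2) else s

/-- Strictly decreasing sequences of ordinals below `α`. -/
def DecreasingBelow (α : Ordinal.{u}) (l : List Ordinal.{u}) : Prop :=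
  l.Pairwise (· > ·) ∧ ∀ a ∈ l, a < α

/-- After an entry ζ the current functional lies in s_ε^ζ(K), and a smaller next entry leaves room
for one derivation, which supplies the new vector. Being above ε/5 on the earlier vectors is a
weak*-open condition, so it survives the change of functional. Indexing by subsets of X keeps the
directed set in the universe required by `theta`. -/
theorem exists_decreasing_tree {ε : ℝ} (hε : 0 < ε) {K : Set (WeakDual 𝕜 X)} {α : Ordinal.{u}}
    (hne : (iterDeriv ε K α).Nonempty) :
    ∃ x : List (Ordinal.{u} × WeakNhds 𝕜 X) → X,
      (∀ l ζ W, DecreasingBelow α ((l ++ [(ζ, W)]).map Prod.fst) →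
        ‖x (l ++ [(ζ, W)])‖ ≤ 1 ∧ x (l ++ [(ζ, W)]) ∈ (OrderDual.ofDual W).1) ∧
      ∀ l, DecreasingBelow α (l.map Prod.fst) →
        ∃ y ∈ K, ∀ r, r ≠ [] → r <+: l → ε / 5 < RCLike.re (y (x r)) := by
  obtain ⟨y₀, hy₀⟩ := hne
  set st : List (Ordinal.{u} × WeakNhds 𝕜 X) → WeakDual 𝕜 X × List X :=
    fun l => l.foldl (nextState ε K) (y₀, []) with hst
  have hstep : ∀ l a, st (l ++ [a]) = nextState ε K (st l) a := fun l a => by simp [hst]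
  set x : List (Ordinal.{u} × WeakNhds 𝕜 X) → X := fun l => (st l).2.headD 0 with hxdef
  -- The second clause is what permits the next step: at an entry γ below all previous ones, the
  -- functional belongs to the derived set of s_ε^γ(K).
  have main : ∀ l, DecreasingBelow α (l.map Prod.fst) →
      (st l).1 ∈ K ∧ (∀ γ < α, (∀ a ∈ l, γ < a.1) → (st l).1 ∈ iterDeriv ε K (γ + 1)) ∧
      (∀ b ∈ (st l).2, ε / 5 < RCLike.re ((st l).1 b)) ∧
      (∀ r, r ≠ [] → r <+: l → x r ∈ (st l).2) ∧
      ∀ l' ζ W, l = l' ++ [(ζ, W)] → ‖x l‖ ≤ 1 ∧ x l ∈ (OrderDual.ofDual W).1 := by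
    intro l
    induction l using List.reverseRecOn with
    | nil =>
      intro _
      refine ⟨iterDeriv_subset _ _ _ hy₀, fun γ hγ _ => ?_, by simp [hst], fun r hr hp => ?_, ?_⟩
      · exact iterDeriv_antitone _ _ (Order.add_one_le_of_lt hγ) hy₀
      · exact absurd (List.prefix_nil.1 hp) hr
      · intro l' ζ W h
        simp at h
    | append_singleton l a ih =>
      rintro ⟨hl1, hl2⟩
      rw [List.map_append, List.pairwise_append] at hl1
      obtain ⟨-, h2, h3, h4, -⟩ := ih ⟨hl1.1, fun b hb => hl2 b
        (by rw [List.map_append]; exact List.mem_append_left _ hb)⟩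
      have haα : a.1 < α := hl2 _ (by simp)
      have hal : ∀ b ∈ l, a.1 < b.1 := fun b hb =>
        hl1.2.2 b.1 (List.mem_map_of_mem hb) a.1 (by simp)
      have hder := h2 a.1 haα hal
      rw [iterDeriv_add_one] at hder
      have hU : {z : WeakDual 𝕜 X | ∀ b ∈ (st l).2, ε / 5 < RCLike.re (z b)} ∈ 𝓝 (st l).1 := by
        refine (Filter.eventually_all_finite (List.finite_toSet (st l).2)).2 fun b hb => ?_
        exact ((RCLike.continuous_re.comp (WeakDual.eval_continuous b)).tendsto _).eventually_const_lt
          (h3 b hb)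
      have hex : ∃ zx : WeakDual 𝕜 X × X, zx.1 ∈ iterDeriv ε K a.1 ∧
          (∀ b ∈ (st l).2, ε / 5 < RCLike.re (zx.1 b)) ∧ ‖zx.2‖ ≤ 1 ∧
          zx.2 ∈ (OrderDual.ofDual a.2).1 ∧ ε / 5 < RCLike.re (zx.1 zx.2) := by
        obtain ⟨F, η, hη, hW⟩ := (OrderDual.ofDual a.2).2
        obtain ⟨z, hz, x, hx1, hx2, hx3⟩ := exists_mem_and_lt_re hε hder hU F hη
        exact ⟨(z, x), hz.1, hz.2, hx1, by rw [hW]; exact hx2, hx3⟩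
      have hst' : st (l ++ [a]) = (hex.choose.1, hex.choose.2 :: (st l).2) := by
        rw [hstep, nextState, dif_pos hex]
      obtain ⟨c1, c2, c3, c4, c5⟩ := hex.choose_spec
      have hxl : x (l ++ [a]) = hex.choose.2 := by simp only [hxdef, hst', List.headD_cons]
      refine ⟨?_, ?_, ?_, ?_, ?_⟩
      · rw [hst']
        exact iterDeriv_subset _ _ _ c1
      · intro γ _ hγ
        rw [hst']
        exact iterDeriv_antitone _ _ (Order.add_one_le_of_lt (hγ a (by simp))) c1
      · rw [hst']
        intro b hb
        rcases List.mem_cons.1 hb with rfl | hb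
        · exact c5
        · exact c2 b hb
      · intro r hr hp
        rcases List.prefix_concat_iff.1 hp with rfl | hp
        · rw [hxl, hst']
          exact List.mem_cons_self
        · rw [hst']
          exact List.mem_cons_of_mem _ (h4 r hr hp)
      · intro l' ζ W h
        obtain ⟨-, rfl⟩ : l = l' ∧ a = (ζ, W) := by simpa using h
        rw [hxl]
        exact ⟨c3, c4⟩
  refine ⟨x, fun l ζ W h => (main _ h).2.2.2.2 l ζ W rfl, fun l hl => ?_⟩
  obtain ⟨h1, -, h3, h4, -⟩ := main l hl
  exact ⟨_, h1, fun r hr hp => h3 _ (h4 r hr hp)⟩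

end WeakNeighborhoods

/-! ### The lower bound for θ_{ζ,n} -/

section LowerTheta

open Ordinal

theorem maxNodes_treeOne_nonempty (ζ : Ordinal.{u}) : (maxNodes (treeOne ζ)).Nonempty := by
  induction ζ using Ordinal.limitRecOn with
  | zero =>
    rw [treeOne_zero]
    refine ⟨[0], by simp, fun s hs _ => ?_⟩
    simpa using hs
  | add_one ζ ih =>
    obtain ⟨t, ht⟩ := ih
    exact ⟨_, mem_maxNodes_treeOne_add_one.2 ⟨0, t, ht, [], rfl, rfl⟩⟩
  | limit ξ hξ ih =>
    obtain ⟨t, ht⟩ := ih (0 + 1) (hξ.add_one_lt hξ.bot_lt)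
    exact ⟨_, (mem_maxNodes_treeOne_limit hξ).2 ⟨0, hξ.bot_lt, t, ht, rfl⟩⟩

theorem branches_nonempty (ζ : Ordinal.{u}) (n : ℕ) : (branches ζ n).Nonempty := by
  induction n with
  | zero => exact ⟨[], rfl⟩
  | succ n ih =>
    obtain ⟨s, hs⟩ := ih
    obtain ⟨t, ht⟩ := maxNodes_treeOne_nonempty ζ
    exact ⟨_, t, ht, s, hs, rfl⟩

variable {𝕜 : Type*} [RCLike 𝕜] {X : Type u} [NormedAddCommGroup X] [NormedSpace 𝕜 X]
  {Y : Type v} [NormedAddCommGroup Y] [NormedSpace 𝕜 Y]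

theorem nonempty_maxNodes_treeD (D : Type u) [Nonempty D] (ζ : Ordinal.{u}) (n : ℕ) :
    Nonempty (maxNodes (treeD ζ (n + 1) D)) := by
  obtain ⟨t, ht⟩ := branches_nonempty ζ (n + 1)
  obtain ⟨d⟩ := ‹Nonempty D›
  refine ⟨⟨t.map fun ζ => (ζ, d), ?_⟩⟩
  have : Nonempty D := ⟨d⟩
  rw [mem_maxNodes_treeD_iff, ← branches_add_one_eq]
  simpa [Function.comp_def] using ht

/-- It makes the set defining θ nonempty, so that its `sInf` is not a default value, and bounds θ
uniformly over the summands. The added 1 provides the strict positivity. -/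
theorem norm_add_one_mem_theta_set (ζ : Ordinal.{u}) (n : ℕ) (A : X →L[𝕜] Y) :
    ‖A‖ + 1 ∈ {θ : ℝ | 0 < θ ∧ ∀ (D : Type u) [Preorder D] [IsDirectedOrder D] [Nonempty D]
      (x : List (Ordinal.{u} × D) → X), WeaklyNull 𝕜 ζ (n + 1) D x →
      (∀ t ∈ treeD ζ (n + 1) D, ‖x t‖ ≤ 1) →
      ⨅ t : maxNodes (treeD ζ (n + 1) D), supportFun (dualBallImage A)
        ((1 / ((n + 1 : ℕ) : 𝕜)) • branchSum 𝕜 ζ x t) ≤ θ} := by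
  refine ⟨by positivity, fun D _ _ _ x _ hx => ?_⟩
  obtain ⟨t⟩ := nonempty_maxNodes_treeD D ζ n
  refine (ciInf_le ⟨0, ?_⟩ t).trans (supportFun_le fun f hf => ?_)
  · rintro _ ⟨s, rfl⟩
    exact supportFun_nonneg A _
  · have ht := mem_maxNodes_treeD_iff.1 t.2
    refine (re_apply_le (norm_le_of_mem_dualBallImage hf) _).trans ?_
    have h1 : ‖branchSum 𝕜 ζ x t‖ ≤ ((n + 1 : ℕ) : ℝ) := by
      rw [← prefixSum_coeff (branches_add_one_eq ζ n ▸ ht)]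
      refine norm_weightedSum_le (coeff_nonneg ζ) fun s hs hp => hx s ?_
      exact mem_tree_of_prefix ht.1 (by simpa using hs) (hp.map _)
    have h2 : ‖(1 / ((n + 1 : ℕ) : 𝕜)) • branchSum 𝕜 ζ x t‖ ≤ 1 := by
      rw [norm_smul, norm_div, norm_one, RCLike.norm_natCast, one_div]
      exact inv_mul_le_one_of_le₀ h1 (Nat.cast_nonneg _)
    have := mul_le_of_le_one_right (norm_nonneg A) h2
    linarith

theorem opTheta_le_norm_add_one (ζ : Ordinal.{u}) (n : ℕ) (A : X →L[𝕜] Y) :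
    opTheta ζ (n + 1) A ≤ ‖A‖ + 1 :=
  csInf_le ⟨0, fun _ h => h.1.le⟩ (norm_add_one_mem_theta_set ζ n A)

/-- Nodes of Γ_{ζ,n+1} are decreasing sequences below ω^ζ (n+1), so the tree just constructed
restricts to them; coefficients along a branch add up to n + 1, so the normalised sum retains the
bound ε/5. -/
theorem le_opTheta {A : X →L[𝕜] Y} {ε : ℝ} (hε : 0 < ε) {ζ : Ordinal.{u}} {n : ℕ}
    (hne : (iterDeriv ε (dualBallImage A) (ω ^ ζ * ((n + 1 : ℕ) : Ordinal.{u}))).Nonempty) :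
    ε / 5 ≤ opTheta ζ (n + 1) A := by
  refine le_csInf ⟨_, norm_add_one_mem_theta_set ζ n A⟩ ?_
  rintro θ ⟨-, hθ⟩
  obtain ⟨x, hx, hy⟩ := exists_decreasing_tree hε hne
  have hdec : ∀ l ∈ tree ζ (n + 1), DecreasingBelow (ω ^ ζ * ((n + 1 : ℕ) : Ordinal.{u})) l :=
    fun l hl => ⟨pairwise_of_mem_tree_of (pairwise_of_mem_treeOne ζ) _ l hl,
      (stack_ok (treeOne_ok ζ) n l hl).2.1⟩
  have := nonempty_maxNodes_treeD (WeakNhds 𝕜 X) ζ n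
  refine le_trans (le_ciInf fun t => ?_) (hθ (WeakNhds 𝕜 X) x ?_ ?_)
  · have ht := mem_maxNodes_treeD_iff.1 t.2
    obtain ⟨y, hyK, hyx⟩ := hy t (hdec _ ht.1)
    refine le_trans ?_ (re_apply_le_supportFun hyK _)
    have h1 := le_re_apply_weightedSum (coeff_nonneg ζ) fun s hs hp => (hyx s hs hp).le
    rw [prefixSum_coeff (branches_add_one_eq ζ n ▸ ht)] at h1
    have h2 : (1 / ((n + 1 : ℕ) : 𝕜)) = ((((n + 1 : ℕ) : ℝ)⁻¹ : ℝ) : 𝕜) := by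
      push_cast
      rw [one_div]
    rw [map_smul, _root_.smul_eq_mul, h2, RCLike.re_ofReal_mul, le_inv_mul_iff₀ (by positivity)]
    exact h1
  · intro t ζ' ht f
    exact tendsto_of_mem_weakNhds (fun W => (hx t ζ' W (hdec _ (ht W))).2) f
  · intro t ht
    have hne : t ≠ [] := by
      have := (stack_ok (treeOne_ok ζ) n _ ht).1
      simpa using this
    obtain ⟨l, ⟨ζ', W⟩, rfl⟩ := (List.eq_nil_or_concat' t).resolve_left hne
    exact (hx l ζ' W (hdec _ ht)).1

end LowerTheta

end Szlenk
namespace Szlenk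

/-! ### Assembly of the equivalences -/

section Ordinals

open Ordinal

theorem exists_le_opow_mul_natCast {ξ β : Ordinal.{u}} (hξ : ξ ≠ 0) (hβ : β < ω ^ ξ) :
    ∃ ζ < ξ, ∃ m : ℕ, β ≤ ω ^ ζ * m := by
  induction ξ using Ordinal.limitRecOn with
  | zero => exact absurd rfl hξ
  | add_one ζ _ =>
    rw [opow_add, opow_one, lt_mul_iff_of_isSuccLimit isSuccLimit_omega0] at hβ
    obtain ⟨c, hc, hβ⟩ := hβ
    obtain ⟨m, rfl⟩ := lt_omega0.1 hc
    exact ⟨ζ, lt_add_one ζ, m, hβ.le⟩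
  | limit ξ hl _ =>
    obtain ⟨ζ, hζ, h⟩ := (lt_opow_of_isSuccLimit omega0_ne_zero hl).1 hβ
    exact ⟨ζ, hζ, 1, by simpa using h.le⟩

theorem opow_mul_natCast_lt {ζ ξ : Ordinal.{u}} (h : ζ < ξ) (m : ℕ) :
    ω ^ ζ * (m : Ordinal.{u}) < ω ^ ξ := by
  calc ω ^ ζ * (m : Ordinal.{u}) < ω ^ ζ * ω :=
        (mul_lt_mul_iff_right₀ (omega_opow_pos ζ)).2 (natCast_lt_omega0 m)
    _ = ω ^ (ζ + 1) := by rw [opow_add, opow_one]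
    _ ≤ ω ^ ξ := opow_le_opow_right omega0_pos (Order.add_one_le_of_lt h)

end Ordinals

section Main

open Ordinal

variable {𝕜 : Type*} [RCLike 𝕜] {Λ : Type u}
  {X : Λ → Type u} [∀ l, NormedAddCommGroup (X l)] [∀ l, NormedSpace 𝕜 (X l)]
  {Y : Λ → Type v} [∀ l, NormedAddCommGroup (Y l)] [∀ l, NormedSpace 𝕜 (Y l)]
  {A : ∀ l, X l →L[𝕜] Y l} {hA : ∃ R, ∀ l, ‖A l‖ ≤ R} {p r : Exponent} {hpr : Admissible p r}

theorem opIndex_le_opIndex_diagOp (l : Λ) : opIndex (A l) ≤ opIndex (diagOp A hA hpr) := by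
  cases h : opIndex (diagOp A hA hpr) with
  | top => exact le_top
  | coe α =>
    exact index_le_iff.2 fun ε hε =>
      iterDeriv_eq_empty_of_diagOp A hA hpr hε.le (index_le_iff.1 h.le ε hε) l

theorem iSup_opIndexEps_le_iff {ε : ℝ} {α : Ordinal.{u}} :
    (⨆ l, opIndexEps (A l) ε) ≤ (α : WithTop Ordinal.{u}) ↔
      ∀ l, iterDeriv ε (dualBallImage (A l)) α = ∅ :=
  iSup_le_iff.trans (forall_congr' fun _ => indexEps_le_iff)

theorem exists_iterDeriv_eq_empty_of_iSup_lt {ξ : Ordinal.{u}} (hξ : ξ ≠ 0) {ε : ℝ}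
    (h : (⨆ l, opIndexEps (A l) ε) < ((ω ^ ξ : Ordinal.{u}) : WithTop Ordinal.{u})) :
    ∃ ζ < ξ, ∃ m : ℕ, ∀ l, iterDeriv ε (dualBallImage (A l)) (ω ^ ζ * m) = ∅ := by
  obtain ⟨β, hβ, hlt⟩ := WithTop.lt_iff_exists_coe.1 h
  rw [WithTop.coe_lt_coe] at hlt
  obtain ⟨ζ, hζ, m, hm⟩ := exists_le_opow_mul_natCast hξ hlt
  exact ⟨ζ, hζ, m, iSup_opIndexEps_le_iff.1 (hβ.trans_le (WithTop.coe_le_coe.2 hm))⟩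

theorem iSup_opIndexEps_lt {ζ ξ : Ordinal.{u}} (hζ : ζ < ξ) {m : ℕ} {ε : ℝ}
    (h : ∀ l, iterDeriv ε (dualBallImage (A l)) (ω ^ ζ * m) = ∅) :
    (⨆ l, opIndexEps (A l) ε) < ((ω ^ ξ : Ordinal.{u}) : WithTop Ordinal.{u}) :=
  (iSup_opIndexEps_le_iff.2 h).trans_lt (WithTop.coe_lt_coe.2 (opow_mul_natCast_lt hζ m))

theorem iSup_opIndexEps_lt_of_opIndex_diagOp_le {α : Ordinal.{u}} (hα : Order.IsSuccLimit α)
    (h : opIndex (diagOp A hA hpr) ≤ (α : WithTop Ordinal.{u})) {ε : ℝ} (hε : 0 < ε) :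
    (⨆ l, opIndexEps (A l) ε) < (α : WithTop Ordinal.{u}) := by
  obtain ⟨β, hβ, hsub⟩ := exists_iterDeriv_subset_of_limit (isCompact_dualBallImage _)
    isOpen_empty hα (index_le_iff.1 h ε hε).subset
  exact (iSup_opIndexEps_le_iff.2 fun l => iterDeriv_eq_empty_of_diagOp A hA hpr hε.le
    (Set.subset_empty_iff.1 hsub) l).trans_lt (WithTop.coe_lt_coe.2 hβ)

/-- A bound ω^ζ m at scale ε/8 becomes ω^ζ M at scale ε, and a finite M keeps it below ω^ξ. -/
theorem opIndex_diagOp_le_of_forall_lt {ξ : Ordinal.{u}} (hξ : ξ ≠ 0)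
    (h : ∀ ε : ℝ, 0 < ε →
      (⨆ l, opIndexEps (A l) ε) < ((ω ^ ξ : Ordinal.{u}) : WithTop Ordinal.{u})) :
    opIndex (diagOp A hA hpr) ≤ ((ω ^ ξ : Ordinal.{u}) : WithTop Ordinal.{u}) := by
  refine index_le_iff.2 fun ε hε => ?_
  obtain ⟨ζ, hζ, m, hm⟩ := exists_iterDeriv_eq_empty_of_iSup_lt hξ (h (ε / 8) (by positivity))
  obtain ⟨M, hM⟩ := exists_iterDeriv_diagOp_eq_empty A hA hpr hε hm
  exact Set.subset_empty_iff.1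
    (hM ▸ iterDeriv_antitone _ _ (opow_mul_natCast_lt hζ M).le)

/-- Relative to ξ + 1, the bound ω^ξ is a single block, so the preceding criterion applies. -/
theorem opIndex_diagOp_le_opow_add_one {ξ : Ordinal.{u}}
    (h : ∀ l, opIndex (A l) ≤ ((ω ^ ξ : Ordinal.{u}) : WithTop Ordinal.{u})) :
    opIndex (diagOp A hA hpr) ≤ ((ω ^ (ξ + 1) : Ordinal.{u}) : WithTop Ordinal.{u}) :=
  opIndex_diagOp_le_of_forall_lt (by simp) fun ε hε =>
    iSup_opIndexEps_lt (m := 1) (lt_add_one ξ) fun l => by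
      simpa using index_le_iff.1 (h l) ε hε

theorem opow_add_one_le_opIndex_diagOp {ξ : Ordinal.{u}} (hξ : ξ ≠ 0) {ε : ℝ} (hε : 0 < ε)
    (h : ((ω ^ ξ : Ordinal.{u}) : WithTop Ordinal.{u}) ≤ ⨆ l, opIndexEps (A l) ε) :
    ((ω ^ (ξ + 1) : Ordinal.{u}) : WithTop Ordinal.{u}) ≤ opIndex (diagOp A hA hpr) := by
  refine omega0_opow_add_one_le_opIndex hε (isSuccLimit_omega0_opow hξ) fun α hα => ?_
  rw [Set.nonempty_iff_ne_empty]
  intro he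
  exact (h.trans (iSup_opIndexEps_le_iff.2 (iterDeriv_eq_empty_of_diagOp A hA hpr hε.le he))).not_gt
    (WithTop.coe_lt_coe.2 hα)

theorem sInf_iSup_opTheta_eq_zero {R : ℝ} (hR : ∀ l, ‖A l‖ ≤ R) {ξ : Ordinal.{u}} (hξ : ξ ≠ 0)
    (h : ∀ ε : ℝ, 0 < ε →
      (⨆ l, opIndexEps (A l) ε) < ((ω ^ ξ : Ordinal.{u}) : WithTop Ordinal.{u})) :
    sInf {c : ℝ | ∃ ζ < ξ, ∃ m : ℕ, 1 ≤ m ∧ c = ⨆ l, opTheta ζ m (A l)} = 0 := by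
  have hnonneg : ∀ c ∈ {c : ℝ | ∃ ζ < ξ, ∃ m : ℕ, 1 ≤ m ∧ c = ⨆ l, opTheta ζ m (A l)}, 0 ≤ c := by
    rintro _ ⟨ζ, -, m, -, rfl⟩
    exact Real.iSup_nonneg fun l => opTheta_nonneg ζ m (A l)
  refine le_antisymm (le_of_forall_pos_le_add fun η hη => ?_) (Real.sInf_nonneg hnonneg)
  obtain ⟨ζ, hζ, m, hm⟩ := exists_iterDeriv_eq_empty_of_iSup_lt hξ (h (η / 4) (by positivity))
  -- With δ = η/2, the remaining η/2 per block must absorb the total cost mR.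
  obtain ⟨n, hn⟩ := exists_nat_ge (m * R / (η / 2))
  rw [div_le_iff₀ (by positivity)] at hn
  rw [zero_add]
  refine (csInf_le ⟨0, hnonneg⟩ ⟨ζ, hζ, n + 1, by omega, rfl⟩).trans
    (Real.iSup_le (fun l => ?_) hη.le)
  exact opTheta_le (hR l) (δ₀ := η / 4) (δ := η / 2) (by positivity) (by linarith) (hm l) hη
    (by linarith)

theorem iSup_opIndexEps_lt_of_sInf_eq_zero {R : ℝ} (hR : ∀ l, ‖A l‖ ≤ R) {ξ : Ordinal.{u}}
    (hξ : ξ ≠ 0)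
    (h : sInf {c : ℝ | ∃ ζ < ξ, ∃ m : ℕ, 1 ≤ m ∧ c = ⨆ l, opTheta ζ m (A l)} = 0)
    {ε : ℝ} (hε : 0 < ε) :
    (⨆ l, opIndexEps (A l) ε) < ((ω ^ ξ : Ordinal.{u}) : WithTop Ordinal.{u}) := by
  have hlt := h.trans_lt (show (0 : ℝ) < ε / 5 by positivity)
  obtain ⟨_, ⟨ζ, hζ, m, hm, rfl⟩, hlt⟩ := exists_lt_of_csInf_lt
    (by exact ⟨_, 0, pos_iff_ne_zero.2 hξ, 1, le_rfl, rfl⟩) hlt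
  obtain ⟨n, rfl⟩ := Nat.exists_eq_add_of_le' hm
  refine iSup_opIndexEps_lt (m := n + 1) hζ fun l => Set.not_nonempty_iff_eq_empty.1 fun hne => ?_
  -- An unbounded supremum in ℝ would default to 0, so boundedness is needed to compare one θ with
  -- the supremum.
  have hbdd : BddAbove (Set.range fun l => opTheta ζ (n + 1) (A l)) := by
    refine ⟨R + 1, ?_⟩
    rintro _ ⟨l, rfl⟩
    linarith [opTheta_le_norm_add_one ζ n (A l), hR l]
  exact ((le_opTheta hε hne).trans (le_ciSup hbdd l)).not_gt hlt

end Main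

end Szlenk

theorem mainTheorem9 {𝕜 : Type*} [RCLike 𝕜] {Λ : Type u}
    {X : Λ → Type u} [∀ l, NormedAddCommGroup (X l)] [∀ l, NormedSpace 𝕜 (X l)]
    [∀ l, CompleteSpace (X l)]
    {Y : Λ → Type v} [∀ l, NormedAddCommGroup (Y l)] [∀ l, NormedSpace 𝕜 (Y l)]
    [∀ l, CompleteSpace (Y l)]
    (A : ∀ l, X l →L[𝕜] Y l) (hA : ∃ R, ∀ l, ‖A l‖ ≤ R)
    (p r : Szlenk.Exponent) (hpr : Szlenk.Admissible p r)
    (ξ : Ordinal.{u}) (hξ : (1 : Ordinal.{u}) < ω ^ ξ)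
    (hsup : (⨆ l, Szlenk.opIndex (A l)) = ((ω ^ ξ : Ordinal.{u}) : WithTop Ordinal.{u})) :
    List.TFAE
      [Szlenk.opIndex (Szlenk.diagOp A hA hpr) = ((ω ^ ξ : Ordinal.{u}) : WithTop Ordinal.{u}),
       ∀ ε : ℝ, 0 < ε →
        (⨆ l, Szlenk.opIndexEps (A l) ε) < ((ω ^ ξ : Ordinal.{u}) : WithTop Ordinal.{u}),
       sInf {c : ℝ | ∃ ζ < ξ, ∃ m : ℕ, 1 ≤ m ∧ c = ⨆ l, Szlenk.opTheta ζ m (A l)} = 0] ∧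
    (Szlenk.opIndex (Szlenk.diagOp A hA hpr) ≠ ((ω ^ ξ : Ordinal.{u}) : WithTop Ordinal.{u}) →
      Szlenk.opIndex (Szlenk.diagOp A hA hpr) =
        ((ω ^ (ξ + 1) : Ordinal.{u}) : WithTop Ordinal.{u})) := by
  have hξ0 : ξ ≠ 0 := by
    rintro rfl
    simp at hξ
  have hle : ∀ l, Szlenk.opIndex (A l) ≤ ((ω ^ ξ : Ordinal.{u}) : WithTop Ordinal.{u}) :=
    fun l => hsup ▸ le_iSup (fun l => Szlenk.opIndex (A l)) l
  have hge : ((ω ^ ξ : Ordinal.{u}) : WithTop Ordinal.{u}) ≤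
      Szlenk.opIndex (Szlenk.diagOp A hA hpr) :=
    hsup ▸ iSup_le Szlenk.opIndex_le_opIndex_diagOp
  obtain ⟨R, hR⟩ := id hA
  refine ⟨?_, fun hne => ?_⟩
  · tfae_have 1 → 2 := fun h ε hε => Szlenk.iSup_opIndexEps_lt_of_opIndex_diagOp_le
      (Szlenk.isSuccLimit_omega0_opow hξ0) h.le hε
    tfae_have 2 → 1 := fun h => (Szlenk.opIndex_diagOp_le_of_forall_lt hξ0 h).antisymm hge
    tfae_have 2 → 3 := Szlenk.sInf_iSup_opTheta_eq_zero hR hξ0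
    tfae_have 3 → 2 := fun h ε hε => Szlenk.iSup_opIndexEps_lt_of_sInf_eq_zero hR hξ0 h hε
    tfae_finish
  · refine (Szlenk.opIndex_diagOp_le_opow_add_one hle).antisymm ?_
    -- If Sz(D) were not at least ω^(ξ+1), condition 2 could fail at no ε, and then Sz(D) = ω^ξ.
    by_contra hlt
    refine hne (le_antisymm (Szlenk.opIndex_diagOp_le_of_forall_lt hξ0 fun ε hε => ?_) hge)
    by_contra h
    exact hlt (Szlenk.opow_add_one_le_opIndex_diagOp hξ0 hε (not_lt.1 h))
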